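/- **Notation.** Let $\mathbb T^2=\mathbb R^2/2\pi\mathbb Z^2$ with Lebesgue measure. For $f\in L^2(\mathbb T^2)$ write $f_k=(2\pi)^{-2}\int_{\mathbb T^2}e^{-ik\cdot x}f(x)\,dx$, $k\in\mathbb Z^2$. For a finite set $S\subset\mathbb Z^2$ and $\theta\in\mathbb R$ put $e^{i\theta\Delta}P_Sf(x)=\sum_{k\in S}e^{-i\theta|k|^2}f_ke^{ik\cdot x}$. For $a,b\in\mathbb R$ and $N\ge 1$ let $S=S_{a,b,N}=\{(\xi_1,\xi_2)\in\mathbb Z^2:|\xi_1-a|\le N,\ |\xi_2-b|\le N\}$. For $T>0$, a continuous function $W:[0,T]\to\mathbb R$ is called $(\rho,\gamma)$-irregular if $$\sup_{0\le s<t\le T}\ \sup_{\tau\in\mathbb R}\ \frac{(1+|\tau|)^{\rho}\,\bigl|\int_s^te^{iW_u\tau}\,du\bigr|}{|t-s|^{\gamma}}<\infty .$$ A fractional Brownian motion with Hurst index $H$ on a probability space $(\Omega,\mathcal F,P)$ is a centered Gaussian process $(B^H_t)_{t\ge 0}$ with almost surely continuous paths and $\mathbb E[B^H_sB^H_t]=\tfrac12\bigl(s^{2H}+t^{2H}-|t-s|^{2H}\bigr)$.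 **Theorem.** (1) (Pathwise Strichartz estimates.) Let $T>0$, $\varepsilon>0$, $\rho\ge 1-\varepsilon$, and let $W:[0,T]\to\mathbb R$ be $(\rho,1/2)$-irregular. There is a constant $C$ depending only on $W$ (including its domain $[0,T]$) and $\varepsilon$ such that for all $a,b\in\mathbb R$ and $N\ge1$, all intervals $I\subset[0,T]$ of length $T_0$, and all $f\in L^2(\mathbb T^2)$, $$\|e^{iW_t\Delta}P_Sf\|_{L^4(I\times\mathbb T^2)}\le C\,\bigl(N^{2\varepsilon}\sqrt{T_0}\bigr)^{1/4}\|f\|_{L^2(\mathbb T^2)} .$$ In particular this holds for every $\varepsilon>0$ if $W$ is $(\rho,1/2)$-irregular for all $\rho<1$. (2) (Stochastic Strichartz estimates.) Let $0<H\le\frac12$. There is a constant $C$ depending only on $H$ such that the following holds. Let $B^H$ be a fractional Brownian motion with Hurst index $H$ on a probability space $(\Omega,\mathcal F,P)$, and let $W_t=B^H_t$. Let $a,b\in\mathbb R$, $N\ge1$, and let $I\subset[0,\infty)$ be a bounded interval of length $T_0$, where $N\ge2$ or $T_0\le1$. Let $f\in L^2(\Omega\times\mathbb T^2)$ be such that the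 family of its Fourier coefficients $(f_k)_{k\in\mathbb Z^2}$ is independent of the family of increments $(B^H_t-B^H_s)_{s,t\ge0}$. Then $$\|e^{iW_t\Delta}P_Sf\|_{L^4(\Omega\times I\times\mathbb T^2)}\le C\,\bigl(T_0\log N+T_0^{1-H}\bigr)^{1/4}\|f\|_{L^4(\Omega;L^2(\mathbb T^2))} ,$$ where the right-hand side may be infinite. -/

import Mathlib

open MeasureTheory ProbabilityTheory
open scoped NNReal ENNReal

instance fact_zero_lt_two_pi : Fact (0 < 2 * Real.pi) := ⟨Real.two_pi_pos⟩

/-- The square torus `ℝ² / 2πℤ²`. Its `volume` is Lebesgue measure, of total mass `(2π)²`. -/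
abbrev Torus2 : Type := AddCircle (2 * Real.pi) × AddCircle (2 * Real.pi)

/-- The character `x ↦ e^{i k · x}` of the torus, for a frequency `k ∈ ℤ²`. -/
noncomputable def torusChar (k : ℤ × ℤ) (x : Torus2) : ℂ :=
  fourier k.1 x.1 * fourier k.2 x.2

theorem torusChar_coe (k : ℤ × ℤ) (x y : ℝ) :
    torusChar k ((x : AddCircle (2 * Real.pi)), (y : AddCircle (2 * Real.pi))) =
      Complex.exp (Complex.I * ((k.1 : ℂ) * x + (k.2 : ℂ) * y)) := by
  have h : (Real.pi : ℂ) ≠ 0 := by exact_mod_cast Real.pi_ne_zero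
  rw [torusChar, fourier_coe_apply, fourier_coe_apply, ← Complex.exp_add]
  congr 1
  push_cast
  field_simp

/-- The Fourier coefficient `f_k = (2π)⁻² ∫ e^{-i k · x} f(x) dx`, normalized so that an
`L²` function `f` is the sum of its Fourier series `∑ f_k e^{i k · x}`. -/
noncomputable def torusCoeff (f : Torus2 → ℂ) (k : ℤ × ℤ) : ℂ :=
  (((2 * Real.pi) ^ 2)⁻¹ : ℝ) • ∫ x : Torus2, torusChar (-k) x * f x

/-- The frequency square `{(ξ₁, ξ₂) ∈ ℤ² : |ξ₁ - a| ≤ N, |ξ₂ - b| ≤ N}`. -/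
noncomputable def freqSquare (a b N : ℝ) : Finset (ℤ × ℤ) :=
  Finset.Icc ⌈a - N⌉ ⌊a + N⌋ ×ˢ Finset.Icc ⌈b - N⌉ ⌊b + N⌋

theorem mem_freqSquare {a b N : ℝ} {k : ℤ × ℤ} :
    k ∈ freqSquare a b N ↔ |(k.1 : ℝ) - a| ≤ N ∧ |(k.2 : ℝ) - b| ≤ N := by
  simp only [freqSquare, Finset.mem_product, Finset.mem_Icc, Int.ceil_le, Int.le_floor, abs_le]
  constructor
  · rintro ⟨⟨h1, h2⟩, h3, h4⟩
    refine ⟨⟨?_, ?_⟩, ?_, ?_⟩ <;> linarith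
  · rintro ⟨⟨h1, h2⟩, h3, h4⟩
    refine ⟨⟨?_, ?_⟩, ?_, ?_⟩ <;> linarith

/-- `e^{iθΔ} P_S f` for a finite set `S` of frequencies: the Fourier projection
`P_S f = ∑_{k ∈ S} f_k e^{i k · x}`, to which the Fourier multiplier `e^{-iθ|k|²}` is applied
(`Δ e^{i k · x} = -|k|² e^{i k · x}`). -/
noncomputable def schrodingerProj (θ : ℝ) (S : Finset (ℤ × ℤ)) (f : Torus2 → ℂ) (x : Torus2) : ℂ :=
  ∑ k ∈ S, Complex.exp (-Complex.I * θ * ((k.1 : ℂ) ^ 2 + (k.2 : ℂ) ^ 2)) *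
    torusCoeff f k * torusChar k x

/-- `(ρ, γ)`-irregularity of a continuous function `W` on `[0, T]`: the supremum over
`0 ≤ s < t ≤ T` and `τ ∈ ℝ` of `(1 + |τ|)^ρ |∫_s^t e^{i W_u τ} du| / |s - t|^γ` is finite. -/
structure IsIrregular (ρ γ T : ℝ) (W : ℝ → ℝ) : Prop where
  continuousOn : ContinuousOn W (Set.Icc 0 T)
  bounded : ∃ C : ℝ, ∀ s t : ℝ, 0 ≤ s → s < t → t ≤ T → ∀ τ : ℝ,
    (1 + |τ|) ^ ρ * ‖∫ u in s..t, Complex.exp (Complex.I * W u * τ)‖ / |s - t| ^ γ ≤ C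

/-- Fractional Brownian motion with Hurst index `H`: a centered Gaussian process on `[0, ∞)` with
almost surely continuous paths and `E[B_s B_t] = (s^{2H} + t^{2H} - |t - s|^{2H}) / 2`. -/
structure IsFractionalBrownian {Ω : Type*} [MeasurableSpace Ω] (H : ℝ) (B : ℝ≥0 → Ω → ℝ)
    (P : Measure Ω) : Prop where
  gaussian : IsGaussianProcess B P
  centered : ∀ t, ∫ ω, B t ω ∂P = 0
  covariance : ∀ s t : ℝ≥0, cov[B s, B t; P] =
    ((s : ℝ) ^ (2 * H) + (t : ℝ) ^ (2 * H) - |(t : ℝ) - s| ^ (2 * H)) / 2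
  continuous_paths : ∀ᵐ ω ∂P, Continuous fun t ↦ B t ω

/-! Put u = Σ a_k e^{-iW|k|²} e^{ik·x} over k ∈ S. Expanding ‖u‖₄⁴ in space pairs (x, x+v) with (y,
y+v), all four points in S, with phase -2W v·(x-y). The terms v = 0 give (Σ|a_k|²)². For v ≠ 0 the
pairs are grouped by their key κ = (v, v·x); with A_κ the sum of a_{x+v} conj a_x over pairs of key
κ, the rest is Σ A_κ conj A_μ e^{-2iW(κ₂-μ₂)} over keys with the same v. Averaging over time
(irregular W) or over Ω at a fixed time (fractional Brownian W) replaces the exponential by a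
decaying kernel Φ(κ₂-μ₂). Since κ₂-μ₂ is a multiple of g = gcd(v), the row sums of Φ are O(1 + M/g),
and Schur's test (`sum_keySum_le`) leaves Σ (1 + M/g)|A_κ|². Here M is of order N^{2ε} for irregular
W and r^{-H} at time r for fractional Brownian motion.

Two pairs have the same key exactly when they are equal or opposite sides of a rectangle, possibly
of zero area, so what remains is a weighted sum over rectangles in S. The heart of the proof is
`rectForm_le`: this sum is O((M + 1 + log|S|) ‖a‖⁴). For the indicator of n points,
Szemerédi–Trotter shows that O(n²/k²) pairs (direction, point) have about k points on their line.
Hence each dyadic k contributes O(n²) rectangles, and the number of scales is the logarithm. The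
weight M/g contributes at most M√k instead of k per line, which sums geometrically over scales, so M
is not multiplied by the logarithm. Lines with more than 2√n points are not covered, but have only
O(n) incidences (`IsDirectionSet.card_filter_rich_le`). For general coefficients the points are
sorted into levels |a| ≈ 16^{-j}; distant levels interact with a geometric gain
(`rectForm_tamePairs_le`), so that summing over levels costs no further logarithm.

Szemerédi–Trotter follows from the crossing inequality, which is obtained by random sampling from
the linear bound on the edges of a plane graph; the latter is proved by charging wedges between
neighbouring edges to vertices.

In the pathwise estimate the logarithm is absorbed by N^{2ε}. In the stochastic one, integrating
r^{-H} over I gives the term T₀^{1-H}, and log N comes from log|S|. -/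

open scoped ComplexConjugate

/-! ### Plane straight-line graphs have linearly many edges. -/

/-- The slope of the chord of `Y` over the interval `e`. -/
noncomputable def chordSlope (Y : ℝ → ℝ) (e : ℝ × ℝ) : ℝ := (Y e.2 - Y e.1) / (e.2 - e.1)

/-- The height at `x` of the line through the points of the graph of `Y` over the endpoints
of `e`. -/
noncomputable def chord (Y : ℝ → ℝ) (e : ℝ × ℝ) (x : ℝ) : ℝ := Y e.1 + chordSlope Y e * (x - e.1)

theorem chord_left (Y : ℝ → ℝ) (e : ℝ × ℝ) : chord Y e e.1 = Y e.1 := by simp [chord]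

theorem chord_right (Y : ℝ → ℝ) {e : ℝ × ℝ} (h : e.1 < e.2) : chord Y e e.2 = Y e.2 := by
  have : e.2 - e.1 ≠ 0 := (sub_pos.2 h).ne'
  simp only [chord, chordSlope]
  field_simp
  ring

theorem chordSlope_neg (Y : ℝ → ℝ) (e : ℝ × ℝ) : chordSlope (-Y) e = -chordSlope Y e := by
  simp only [chordSlope, Pi.neg_apply]; ring

theorem chord_neg (Y : ℝ → ℝ) (e : ℝ × ℝ) (x : ℝ) : chord (-Y) e x = -chord Y e x := by
  simp only [chord, chordSlope_neg, Pi.neg_apply]; ring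

/-- Two chords that do not meet over `(p, w)` keep their order from `w` down to `p`. -/
theorem chord_le_of_lt_of_ne {Y : ℝ → ℝ} {e f : ℝ × ℝ} {p w : ℝ} (hpw : p < w)
    (hw : chord Y e w < chord Y f w)
    (h : ∀ x, p < x → x < w → chord Y e x ≠ chord Y f x) : chord Y e p ≤ chord Y f p := by
  by_contra! hp
  have hc : ∀ g, Continuous (chord Y g) := fun g ↦ by unfold chord; fun_prop
  have := intermediate_value_Ioo hpw.le
    (((hc f).sub (hc e)).continuousOn (s := Set.Icc p w))
  obtain ⟨x, hx, hx0⟩ := this (show (0 : ℝ) ∈ _ from ⟨by simp; linarith, by simp; linarith⟩)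
  exact h x hx.1 hx.2 (by simp at hx0; linarith)

/-- A straight-line drawing: edges are chords of the graph of `Y` over `V` with no vertex in the
interior of an edge. -/
structure IsDrawing (V : Finset ℝ) (Y : ℝ → ℝ) (E : Finset (ℝ × ℝ)) : Prop where
  left_mem : ∀ e ∈ E, e.1 ∈ V
  right_mem : ∀ e ∈ E, e.2 ∈ V
  lt : ∀ e ∈ E, e.1 < e.2
  vertex : ∀ e ∈ E, ∀ v ∈ V, e.1 < v → v < e.2 → chord Y e v ≠ Y v

/-- The two edges have an interior point in common. -/
def EdgesCross (Y : ℝ → ℝ) (e f : ℝ × ℝ) : Prop :=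
  ∃ x, e.1 < x ∧ f.1 < x ∧ x < e.2 ∧ x < f.2 ∧ chord Y e x = chord Y f x

/-- `f` is the next edge above `e` among those with the same left endpoint. -/
structure IsGap (Y : ℝ → ℝ) (E : Finset (ℝ × ℝ)) (e f : ℝ × ℝ) : Prop where
  left : e ∈ E
  right : f ∈ E
  eq : e.1 = f.1
  lt : chordSlope Y e < chordSlope Y f
  none : ∀ g ∈ E, g.1 = e.1 → chordSlope Y e < chordSlope Y g → chordSlope Y f ≤ chordSlope Y g

/-- `v` is the leftmost vertex in the wedge between `e` and `f`. -/
structure IsFirstVertex (V : Finset ℝ) (Y : ℝ → ℝ) (e f : ℝ × ℝ) (w : ℝ) : Prop where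
  mem : w ∈ V
  gt : e.1 < w
  le_left : w ≤ e.2
  le_right : w ≤ f.2
  above : chord Y e w ≤ Y w
  below : Y w ≤ chord Y f w
  first : ∀ v ∈ V, e.1 < v → v < w → chord Y e v ≤ Y v → Y v ≤ chord Y f v → False

/-- Reflection in the horizontal axis exchanges the two sides of a wedge, so only one side has to be
analysed. -/
theorem IsDrawing.neg {V : Finset ℝ} {Y : ℝ → ℝ} {E : Finset (ℝ × ℝ)} (h : IsDrawing V Y E) :
    IsDrawing V (-Y) E :=
  ⟨h.left_mem, h.right_mem, h.lt, fun e he v hv h1 h2 ↦ by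
    rw [chord_neg]; simpa using h.vertex e he v hv h1 h2⟩

theorem EdgesCross.of_neg {Y : ℝ → ℝ} {e f : ℝ × ℝ} (h : EdgesCross (-Y) e f) :
    EdgesCross Y e f := by
  obtain ⟨x, h1, h2, h3, h4, h5⟩ := h
  exact ⟨x, h1, h2, h3, h4, by simpa [chord_neg] using h5⟩

/-- Edges with common left endpoint and slope overlap, and an overlap counts as a crossing. -/
theorem IsGap.slope_ne {V : Finset ℝ} {Y : ℝ → ℝ} {E : Finset (ℝ × ℝ)} (h : IsDrawing V Y E)
    (hX : ∀ e ∈ E, ∀ f ∈ E, e ≠ f → ¬ EdgesCross Y e f) {e f : ℝ × ℝ} (he : e ∈ E) (hf : f ∈ E)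
    (h1 : e.1 = f.1) (h2 : chordSlope Y e = chordSlope Y f) : e = f := by
  by_contra hne
  obtain ⟨x, hx1, hx2⟩ := exists_between (lt_min (h.lt e he) (h1 ▸ h.lt f hf))
  rw [lt_min_iff] at hx2
  exact hX e he f hf hne ⟨x, hx1, h1 ▸ hx1, hx2.1, hx2.2, by simp [chord, h1, h2]⟩

theorem IsGap.neg {Y : ℝ → ℝ} {E : Finset (ℝ × ℝ)} {e f : ℝ × ℝ} (hg : IsGap Y E e f) :
    IsGap (-Y) E f e := by
  refine ⟨hg.right, hg.left, hg.eq.symm, by simpa [chordSlope_neg] using hg.lt, ?_⟩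
  intro g hgE hg1 hlt
  simp only [chordSlope_neg, neg_lt_neg_iff, neg_le_neg_iff] at hlt ⊢
  by_contra! hc
  exact absurd (hg.none g hgE (hg1.trans hg.eq.symm) hc) (not_le.2 hlt)

theorem IsFirstVertex.neg {V : Finset ℝ} {Y : ℝ → ℝ} {e f : ℝ × ℝ} {w : ℝ} (he : e.1 = f.1)
    (h : IsFirstVertex V Y e f w) : IsFirstVertex V (-Y) f e w :=
  ⟨h.mem, he ▸ h.gt, h.le_right, h.le_left, by simpa [chord_neg] using h.below,
    by simpa [chord_neg] using h.above, fun v hv h1 h2 h3 h4 ↦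
      h.first v hv (he ▸ h1) h2 (by simpa [chord_neg] using h4) (by simpa [chord_neg] using h3)⟩

/-- The nearer of the two right endpoints lies in the closed wedge, so there is a vertex to minimize
over. -/
theorem IsGap.exists_firstVertex {V : Finset ℝ} {Y : ℝ → ℝ} {E : Finset (ℝ × ℝ)}
    (h : IsDrawing V Y E) {e f : ℝ × ℝ} (hg : IsGap Y E e f) :
    ∃ w, IsFirstVertex V Y e f w := by
  classical
  have hef := h.lt e hg.left
  have hff := h.lt f hg.right
  have hmono : ∀ x, e.1 < x → chord Y e x ≤ chord Y f x := fun x hx ↦ by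
    simp only [chord, ← hg.eq]
    have := mul_le_mul_of_nonneg_right hg.lt.le (sub_pos.2 hx).le
    linarith
  let s := V.filter fun v ↦ e.1 < v ∧ v ≤ e.2 ∧ v ≤ f.2 ∧ chord Y e v ≤ Y v ∧ Y v ≤ chord Y f v
  have hs : s.Nonempty := by
    rcases le_total e.2 f.2 with hle | hle
    · refine ⟨e.2, Finset.mem_filter.2 ⟨h.right_mem e hg.left, hef, le_rfl, hle, ?_, ?_⟩⟩
      · rw [chord_right Y hef]
      · rw [← chord_right Y hef]; exact hmono _ hef
    · refine ⟨f.2, Finset.mem_filter.2 ⟨h.right_mem f hg.right, hg.eq ▸ hff, hle, le_rfl, ?_, ?_⟩⟩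
      · rw [← chord_right Y hff]; exact hmono _ (hg.eq ▸ hff)
      · rw [chord_right Y hff]
  obtain ⟨w, hw, hmin⟩ := s.exists_min_image id hs
  obtain ⟨hwV, h1, h2, h3, h4, h5⟩ := Finset.mem_filter.1 hw
  refine ⟨w, hwV, h1, h2, h3, h4, h5, fun v hv g1 g2 g3 g4 ↦ ?_⟩
  exact absurd (hmin v (Finset.mem_filter.2 ⟨hv, g1, by linarith, by linarith, g3, g4⟩))
    (not_le.2 g2)

/-- At `w` the edge `e'` runs strictly inside the wedge of `e` and `f`. Without crossings it stays
there when followed to the left. If it starts inside the wedge, its left endpoint is an earlier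
vertex than `w`; if it starts at the apex, `e` and `f` are not neighbours; if it starts further
left, it is squeezed through the apex, which is then a vertex in its interior. -/
theorem IsGap.eq_of_firstVertex_aux {V : Finset ℝ} {Y : ℝ → ℝ} {E : Finset (ℝ × ℝ)}
    (h : IsDrawing V Y E) (hX : ∀ e ∈ E, ∀ f ∈ E, e ≠ f → ¬ EdgesCross Y e f)
    {e f e' f' : ℝ × ℝ} {w : ℝ} (hg : IsGap Y E e f) (hg' : IsGap Y E e' f')
    (hw : IsFirstVertex V Y e f w) (hw' : IsFirstVertex V Y e' f' w)
    (ha' : chord Y e' w < Y w) (hlt : chord Y e w < chord Y e' w) : False := by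
  have hne : e ≠ e' := by rintro rfl; exact lt_irrefl _ hlt
  have hlt2 : chord Y e' w < chord Y f w := ha'.trans_le hw.below
  have hne2 : e' ≠ f := by rintro rfl; exact lt_irrefl _ hlt2
  have key : ∀ p, e.1 ≤ p → e'.1 ≤ p → p < w →
      chord Y e p ≤ chord Y e' p ∧ chord Y e' p ≤ chord Y f p := by
    intro p hp1 hp2 hpw
    refine ⟨chord_le_of_lt_of_ne hpw hlt fun x h1 h2 h3 ↦ ?_,
      chord_le_of_lt_of_ne hpw hlt2 fun x h1 h2 h3 ↦ ?_⟩
    · exact hX e hg.left e' hg'.left hne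
        ⟨x, by linarith, by linarith, by linarith [hw.le_left], by linarith [hw'.le_left], h3⟩
    · exact hX e' hg'.left f hg.right hne2
        ⟨x, by linarith, by linarith [hg.eq], by linarith [hw'.le_left],
          by linarith [hw.le_right], h3⟩
  rcases lt_trichotomy e.1 e'.1 with hu | hu | hu
  · obtain ⟨k1, k2⟩ := key e'.1 hu.le le_rfl hw'.gt
    rw [chord_left] at k1 k2
    exact hw.first _ (h.left_mem e' hg'.left) hu hw'.gt k1 k2
  · have hpos : 0 < w - e.1 := sub_pos.2 hw.gt
    simp only [chord, ← hu, ← hg.eq] at hlt hlt2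
    have s1 : chordSlope Y e < chordSlope Y e' :=
      lt_of_mul_lt_mul_right (by linarith) hpos.le
    have s2 : chordSlope Y e' < chordSlope Y f :=
      lt_of_mul_lt_mul_right (by linarith) hpos.le
    exact absurd (hg.none e' hg'.left hu.symm s1) (not_le.2 s2)
  · obtain ⟨k1, k2⟩ := key e.1 le_rfl hu.le hw.gt
    rw [chord_left] at k1
    rw [hg.eq, chord_left, ← hg.eq] at k2
    exact h.vertex e' hg'.left e.1 (h.left_mem e hg.left) hu (hw.gt.trans_le hw'.le_left)
      (le_antisymm k2 k1)

/-- A vertex is charged at most once from above a lower side. Strictness means that `w` is not the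
right endpoint of either edge, so equal heights at `w` would be an interior crossing. -/
theorem IsGap.eq_of_firstVertex {V : Finset ℝ} {Y : ℝ → ℝ} {E : Finset (ℝ × ℝ)}
    (h : IsDrawing V Y E) (hX : ∀ e ∈ E, ∀ f ∈ E, e ≠ f → ¬ EdgesCross Y e f)
    {e f e' f' : ℝ × ℝ} {w : ℝ} (hg : IsGap Y E e f) (hg' : IsGap Y E e' f')
    (hw : IsFirstVertex V Y e f w) (hw' : IsFirstVertex V Y e' f' w)
    (ha : chord Y e w < Y w) (ha' : chord Y e' w < Y w) : e = e' := by
  by_contra hne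
  have l1 : w < e.2 := lt_of_le_of_ne hw.le_left fun hc ↦ by
    rw [hc, chord_right Y (h.lt e hg.left)] at ha; exact lt_irrefl _ ha
  have l2 : w < e'.2 := lt_of_le_of_ne hw'.le_left fun hc ↦ by
    rw [hc, chord_right Y (h.lt e' hg'.left)] at ha'; exact lt_irrefl _ ha'
  rcases lt_trichotomy (chord Y e w) (chord Y e' w) with hlt | heq | hlt
  · exact hg.eq_of_firstVertex_aux h hX hg' hw hw' ha' hlt
  · exact hX e hg.left e' hg'.left hne ⟨w, hw.gt, hw'.gt, l1, l2, heq⟩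
  · exact hg'.eq_of_firstVertex_aux h hX hg hw' hw ha hlt

/-- A plane straight-line graph on `n` vertices has at most `3 n` edges. -/
theorem IsDrawing.card_le_of_not_cross {V : Finset ℝ} {Y : ℝ → ℝ} {E : Finset (ℝ × ℝ)}
    (h : IsDrawing V Y E) (hX : ∀ e ∈ E, ∀ f ∈ E, e ≠ f → ¬ EdgesCross Y e f) :
    E.card ≤ 3 * V.card := by
  classical
  -- The edges split into three classes of at most |V| each: the topmost edge at each left endpoint;
  -- the others whose wedge has its first vertex strictly above the lower side; and those whose
  -- first vertex is on the lower side, hence strictly below the upper one.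
  let NT := E.filter fun e ↦ ∃ f ∈ E, f.1 = e.1 ∧ chordSlope Y e < chordSlope Y f
  have hsucc : ∀ e ∈ NT, ∃ f, IsGap Y E e f := by
    intro e he
    obtain ⟨heE, f0, hf0, h1, h2⟩ := Finset.mem_filter.1 he
    obtain ⟨f, hf, hmin⟩ := (E.filter fun f ↦ f.1 = e.1 ∧ chordSlope Y e < chordSlope Y f)
      |>.exists_min_image (chordSlope Y) ⟨f0, Finset.mem_filter.2 ⟨hf0, h1, h2⟩⟩
    obtain ⟨hfE, h3, h4⟩ := Finset.mem_filter.1 hf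
    exact ⟨f, heE, hfE, h3.symm, h4, fun g hg hg1 hg2 ↦
      hmin g (Finset.mem_filter.2 ⟨hg, hg1, hg2⟩)⟩
  choose! s hs using hsucc
  have hfirst : ∀ e ∈ NT, ∃ w, IsFirstVertex V Y e (s e) w := fun e he ↦
    (hs e he).exists_firstVertex h
  choose! w hw using hfirst
  have hT : (E \ NT).card ≤ V.card := by
    refine Finset.card_le_card_of_injOn Prod.fst (fun e he ↦ h.left_mem e ?_) ?_
    · exact (Finset.mem_sdiff.1 he).1
    · intro e he f hf hef
      obtain ⟨he1, he2⟩ := Finset.mem_sdiff.1 he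
      obtain ⟨hf1, hf2⟩ := Finset.mem_sdiff.1 hf
      refine IsGap.slope_ne h hX he1 hf1 hef (le_antisymm ?_ ?_)
      · by_contra! hc; exact hf2 (Finset.mem_filter.2 ⟨hf1, e, he1, hef, hc⟩)
      · by_contra! hc; exact he2 (Finset.mem_filter.2 ⟨he1, f, hf1, hef.symm, hc⟩)
  have hA : (NT.filter fun e ↦ chord Y e (w e) < Y (w e)).card ≤ V.card := by
    refine Finset.card_le_card_of_injOn w (fun e he ↦ ?_) ?_
    · exact (hw e (Finset.mem_filter.1 he).1).mem
    · intro e he f hf hef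
      obtain ⟨he1, he2⟩ := Finset.mem_filter.1 he
      obtain ⟨hf1, hf2⟩ := Finset.mem_filter.1 hf
      exact (hs e he1).eq_of_firstVertex h hX (hs f hf1) (hw e he1)
        (by rw [hef]; exact hw f hf1) he2 (by rw [hef]; exact hf2)
  have hB : (NT.filter fun e ↦ ¬ chord Y e (w e) < Y (w e)).card ≤ V.card := by
    refine Finset.card_le_card_of_injOn w (fun e he ↦ ?_) ?_
    · exact (hw e (Finset.mem_filter.1 he).1).mem
    · intro e he f hf hef
      obtain ⟨he1, he2⟩ := Finset.mem_filter.1 he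
      obtain ⟨hf1, hf2⟩ := Finset.mem_filter.1 hf
      have hb : ∀ g ∈ NT, ¬ chord Y g (w g) < Y (w g) →
          chord (-Y) (s g) (w g) < (-Y) (w g) := by
        intro g hg hgn
        have h1 := hs g hg
        have h2 := hw g hg
        have h3 : 0 < w g - g.1 := sub_pos.2 h2.gt
        rw [chord_neg, Pi.neg_apply, neg_lt_neg_iff]
        refine (not_lt.1 hgn).trans_lt ?_
        simp only [chord, ← h1.eq]
        have := mul_lt_mul_of_pos_right h1.lt h3
        linarith
      have hXn : ∀ e ∈ E, ∀ f ∈ E, e ≠ f → ¬ EdgesCross (-Y) e f := fun e he f hf hn hc ↦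
        hX e he f hf hn hc.of_neg
      -- After reflection the upper side `s e` becomes the lower side of the gap, so the same
      -- charging argument identifies the upper sides.
      have hse : s e = s f := IsGap.eq_of_firstVertex h.neg hXn (hs e he1).neg
        (hs f hf1).neg ((hw e he1).neg (hs e he1).eq)
        (by rw [hef]; exact (hw f hf1).neg (hs f hf1).eq) (hb e he1 he2)
        (by rw [hef]; exact hb f hf1 hf2)
      have hl : e.1 = f.1 := by rw [(hs e he1).eq, (hs f hf1).eq, hse]
      refine IsGap.slope_ne h hX (hs e he1).left (hs f hf1).left hl (le_antisymm ?_ ?_)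
      · by_contra! hc
        have := (hs f hf1).none e (hs e he1).left hl hc
        rw [← hse] at this
        exact absurd (hs e he1).lt (not_lt.2 this)
      · by_contra! hc
        have := (hs e he1).none f (hs f hf1).left hl.symm hc
        rw [hse] at this
        exact absurd (hs f hf1).lt (not_lt.2 this)
  have hNT : NT ⊆ E := Finset.filter_subset _ _
  have h1 := Finset.card_sdiff_add_card_eq_card hNT
  have h2 := Finset.card_filter_add_card_filter_not (s := NT) (fun e ↦ chord Y e (w e) < Y (w e))
  omega

/-! ### The crossing inequality. -/

theorem IsDrawing.mono {V V' : Finset ℝ} {Y : ℝ → ℝ} {E E' : Finset (ℝ × ℝ)}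
    (h : IsDrawing V Y E) (hE : E' ⊆ E) (hV : V' ⊆ V) (h1 : ∀ e ∈ E', e.1 ∈ V')
    (h2 : ∀ e ∈ E', e.2 ∈ V') : IsDrawing V' Y E' :=
  ⟨h1, h2, fun e he ↦ h.lt e (hE he), fun e he v hv ↦ h.vertex e (hE he) v (hV hv)⟩

open Classical in
/-- The ordered pairs of distinct crossing edges. -/
noncomputable def crossings (Y : ℝ → ℝ) (E : Finset (ℝ × ℝ)) : Finset ((ℝ × ℝ) × (ℝ × ℝ)) :=
  (E ×ˢ E).filter fun p ↦ p.1 ≠ p.2 ∧ EdgesCross Y p.1 p.2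

/-- Deleting one edge of a crossing pair destroys at least one crossing; repeat until the graph is
plane. -/
theorem IsDrawing.card_le_add_crossings {V : Finset ℝ} {Y : ℝ → ℝ} {E : Finset (ℝ × ℝ)}
    (h : IsDrawing V Y E) : E.card ≤ 3 * V.card + (crossings Y E).card := by
  classical
  induction hn : E.card generalizing E with
  | zero => omega
  | succ n ih =>
    by_cases hX : ∀ e ∈ E, ∀ f ∈ E, e ≠ f → ¬ EdgesCross Y e f
    · have := h.card_le_of_not_cross hX; omega
    · push Not at hX
      obtain ⟨e, he, f, hf, hne, hc⟩ := hX
      have h' : IsDrawing V Y (E.erase e) := h.mono (Finset.erase_subset _ _) (Finset.Subset.refl _)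
        (fun g hg ↦ h.left_mem g (Finset.mem_of_mem_erase hg))
        (fun g hg ↦ h.right_mem g (Finset.mem_of_mem_erase hg))
      have h1 := ih h' (by rw [Finset.card_erase_of_mem he]; omega)
      have h2 : (crossings Y (E.erase e)).card < (crossings Y E).card := by
        refine Finset.card_lt_card ⟨?_, fun hsub ↦ ?_⟩
        · exact Finset.filter_subset_filter _
            (Finset.product_subset_product (Finset.erase_subset _ _) (Finset.erase_subset _ _))
        · have : (e, f) ∈ crossings Y (E.erase e) :=
            hsub (Finset.mem_filter.2 ⟨Finset.mk_mem_product he hf, hne, hc⟩)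
          have := (Finset.mem_product.1 (Finset.mem_filter.1 this).1).1
          simp at this
      omega

open Classical in
/-- The number of colourings of `V` by `q` colours in which all of `T` has colour `0`. -/
theorem card_colourings_mul (V T : Finset ℝ) (hT : T ⊆ V) (q : ℕ) [NeZero q] :
    (Finset.univ.filter fun χ : V → Fin q ↦ ∀ v (h : v ∈ V), v ∈ T → χ ⟨v, h⟩ = 0).card *
      q ^ T.card = q ^ V.card := by
  have h1 : (Finset.univ.filter fun χ : V → Fin q ↦ ∀ v (h : v ∈ V), v ∈ T → χ ⟨v, h⟩ = 0) =
      Fintype.piFinset fun v : V ↦ if v.1 ∈ T then {0} else Finset.univ := by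
    ext χ
    simp only [Finset.mem_filter, Finset.mem_univ, true_and, Fintype.mem_piFinset]
    constructor
    · rintro h ⟨v, hv⟩
      by_cases hvT : v ∈ T
      · simp [hvT, h v hv hvT]
      · simp [hvT]
    · intro h v hv hvT
      simpa [hvT] using h ⟨v, hv⟩
  rw [h1, Fintype.card_piFinset]
  have h2 : ∀ v : V, (if v.1 ∈ T then ({0} : Finset (Fin q)) else Finset.univ).card =
      (fun v : ℝ ↦ if v ∈ T then 1 else q) v.1 := fun v ↦ by
    by_cases hv : v.1 ∈ T <;> simp [hv]
  rw [Finset.prod_congr rfl fun v _ ↦ h2 v, Finset.prod_coe_sort V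
    (fun v : ℝ ↦ if v ∈ T then 1 else q), Finset.prod_ite]
  simp only [Finset.prod_const_one, one_mul, Finset.prod_const]
  rw [← pow_add]
  congr 1
  rw [← Finset.card_sdiff_add_card_eq_card hT]
  congr 2
  ext v; simp

theorem sum_card_filter_comm {ι κ : Type*} [Fintype ι] (r : ι → κ → Prop)
    [∀ i a, Decidable (r i a)] (s : Finset κ) :
    ∑ i, (s.filter (r i)).card = ∑ a ∈ s, (Finset.univ.filter fun i ↦ r i a).card :=
  Finset.sum_card_bipartiteAbove_eq_sum_card_bipartiteBelow r

/-- The crossing inequality, in the form given by a random colouring with `q` colours. -/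
theorem IsDrawing.card_mul_sq_le {V : Finset ℝ} {Y : ℝ → ℝ} {E : Finset (ℝ × ℝ)}
    (h : IsDrawing V Y E)
    (hd : ∀ p ∈ crossings Y E, p.1.1 ≠ p.2.1 ∧ p.1.1 ≠ p.2.2 ∧ p.1.2 ≠ p.2.1 ∧ p.1.2 ≠ p.2.2)
    {q : ℕ} (hq : 0 < q) :
    E.card * q ^ 2 ≤ 3 * V.card * q ^ 3 + (crossings Y E).card := by
  classical
  have : NeZero q := ⟨hq.ne'⟩
  -- The vertices of colour 0 are a random sample of density 1/q; off `V` the condition is vacuous.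
  let C : (V → Fin q) → ℝ → Prop := fun χ v ↦ ∀ h : v ∈ V, χ ⟨v, h⟩ = 0
  have hcount : ∀ T : Finset ℝ, T ⊆ V →
      (Finset.univ.filter fun χ : V → Fin q ↦ ∀ v ∈ T, C χ v).card * q ^ T.card =
        q ^ V.card := by
    intro T hT
    rw [← card_colourings_mul V T hT q]
    congr 2
    ext χ
    simp only [Finset.mem_filter, Finset.mem_univ, true_and, C]
    exact ⟨fun h v hv hvT ↦ h v hvT hv, fun h v hvT hv ↦ h v hv hvT⟩
  have hχ : ∀ χ, (E.filter fun e ↦ C χ e.1 ∧ C χ e.2).card ≤ 3 * (V.filter (C χ)).card +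
      ((crossings Y E).filter fun p ↦ (C χ p.1.1 ∧ C χ p.1.2) ∧ C χ p.2.1 ∧ C χ p.2.2).card := by
    intro χ
    have h' : IsDrawing (V.filter (C χ)) Y (E.filter fun e ↦ C χ e.1 ∧ C χ e.2) := by
      refine h.mono (Finset.filter_subset _ _) (Finset.filter_subset _ _) (fun e he ↦ ?_)
        (fun e he ↦ ?_)
      · obtain ⟨h1, h2, h3⟩ := Finset.mem_filter.1 he
        exact Finset.mem_filter.2 ⟨h.left_mem e h1, h2⟩
      · obtain ⟨h1, h2, h3⟩ := Finset.mem_filter.1 he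
        exact Finset.mem_filter.2 ⟨h.right_mem e h1, h3⟩
    refine h'.card_le_add_crossings.trans (Nat.add_le_add_left (Finset.card_le_card ?_) _)
    intro p hp
    simp only [crossings, Finset.mem_filter, Finset.mem_product] at hp ⊢
    tauto
  -- Summing the deletion bound over all colourings: a vertex survives with frequency q⁻¹, an edge
  -- with q⁻² and a crossing with q⁻⁴, its four endpoints being distinct by `hd`. The claim is the
  -- resulting average multiplied by q⁴.
  have hsum := Finset.sum_le_sum fun χ (_ : χ ∈ (Finset.univ : Finset (V → Fin q))) ↦ hχ χ
  rw [Finset.sum_add_distrib, ← Finset.mul_sum] at hsum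
  rw [sum_card_filter_comm (fun χ (e : ℝ × ℝ) ↦ C χ e.1 ∧ C χ e.2), sum_card_filter_comm C,
    sum_card_filter_comm (fun χ (p : (ℝ × ℝ) × (ℝ × ℝ)) ↦
      (C χ p.1.1 ∧ C χ p.1.2) ∧ C χ p.2.1 ∧ C χ p.2.2)] at hsum
  have e1 : ∀ e ∈ E, (Finset.univ.filter fun χ : V → Fin q ↦ C χ e.1 ∧ C χ e.2).card * q ^ 2 =
      q ^ V.card := by
    intro e he
    have := hcount {e.1, e.2} (by
      simp [Finset.insert_subset_iff, h.left_mem e he, h.right_mem e he])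
    rw [Finset.card_pair (h.lt e he).ne] at this
    simpa using this
  have e2 : ∀ v ∈ V, (Finset.univ.filter fun χ : V → Fin q ↦ C χ v).card * q = q ^ V.card := by
    intro v hv
    have := hcount {v} (by simpa using hv)
    simpa using this
  have e3 : ∀ p ∈ crossings Y E, (Finset.univ.filter fun χ : V → Fin q ↦
      (C χ p.1.1 ∧ C χ p.1.2) ∧ C χ p.2.1 ∧ C χ p.2.2).card * q ^ 4 = q ^ V.card := by
    intro p hp
    obtain ⟨h1, h2, h3, h4⟩ := hd p hp
    have hpE := Finset.mem_product.1 (Finset.mem_filter.1 hp).1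
    have := hcount {p.1.1, p.1.2, p.2.1, p.2.2} (by
      simp [Finset.insert_subset_iff, h.left_mem _ hpE.1, h.right_mem _ hpE.1,
        h.left_mem _ hpE.2, h.right_mem _ hpE.2])
    have hc : ({p.1.1, p.1.2, p.2.1, p.2.2} : Finset ℝ).card = 4 := by
      rw [Finset.card_insert_of_notMem, Finset.card_insert_of_notMem, Finset.card_pair]
      · exact (h.lt _ hpE.2).ne
      · simp [h3, h4]
      · simp [h1, h2, (h.lt _ hpE.1).ne]
    rw [hc] at this
    rw [← this]
    congr 2
    ext χ
    simp [and_assoc]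
  have hq4 := Nat.mul_le_mul_right (q ^ 4) hsum
  have s1 : (∑ e ∈ E, (Finset.univ.filter fun χ : V → Fin q ↦ C χ e.1 ∧ C χ e.2).card) * q ^ 4 =
      E.card * q ^ V.card * q ^ 2 := by
    rw [Finset.sum_mul, Finset.sum_congr rfl fun e he ↦ by
      rw [show q ^ 4 = q ^ 2 * q ^ 2 by ring, ← mul_assoc, e1 e he]]
    simp; ring
  have s2 : (∑ v ∈ V, (Finset.univ.filter fun χ : V → Fin q ↦ C χ v).card) * q ^ 4 =
      V.card * q ^ V.card * q ^ 3 := by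
    rw [Finset.sum_mul, Finset.sum_congr rfl fun e he ↦ by
      rw [show q ^ 4 = q * q ^ 3 by ring, ← mul_assoc, e2 e he]]
    simp; ring
  have s3 : (∑ p ∈ crossings Y E, (Finset.univ.filter fun χ : V → Fin q ↦
      (C χ p.1.1 ∧ C χ p.1.2) ∧ C χ p.2.1 ∧ C χ p.2.2).card) * q ^ 4 =
      (crossings Y E).card * q ^ V.card := by
    rw [Finset.sum_mul, Finset.sum_congr rfl e3]
    simp
  rw [add_mul, mul_assoc 3, s1, s2, s3] at hq4
  refine Nat.le_of_mul_le_mul_right (c := q ^ V.card) ?_ (by positivity)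
  calc _ = E.card * q ^ V.card * q ^ 2 := by ring
    _ ≤ _ := hq4
    _ = _ := by ring

/-! ### The Szemerédi–Trotter theorem. -/

open Classical in
/-- The abscissae in `V` at which the graph of `Y` meets the line of slope `l.1` and
intercept `l.2`. -/
noncomputable def linePoints (V : Finset ℝ) (Y : ℝ → ℝ) (l : ℝ × ℝ) : Finset ℝ :=
  V.filter fun v ↦ Y v = l.1 * v + l.2

theorem mem_linePoints {V : Finset ℝ} {Y : ℝ → ℝ} {l : ℝ × ℝ} {v : ℝ} :
    v ∈ linePoints V Y l ↔ v ∈ V ∧ Y v = l.1 * v + l.2 := by simp [linePoints]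

/-- `e` joins consecutive points of the line `l`. -/
structure IsConsecutive (V : Finset ℝ) (Y : ℝ → ℝ) (l e : ℝ × ℝ) : Prop where
  left : e.1 ∈ linePoints V Y l
  right : e.2 ∈ linePoints V Y l
  lt : e.1 < e.2
  none : ∀ v ∈ linePoints V Y l, e.1 < v → v < e.2 → False

theorem IsConsecutive.chord_eq {V : Finset ℝ} {Y : ℝ → ℝ} {l e : ℝ × ℝ}
    (h : IsConsecutive V Y l e) (x : ℝ) : chord Y e x = l.1 * x + l.2 := by
  have h1 := (mem_linePoints.1 h.left).2
  have h2 := (mem_linePoints.1 h.right).2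
  have h3 : e.2 - e.1 ≠ 0 := (sub_pos.2 h.lt).ne'
  have : chordSlope Y e = l.1 := by
    rw [chordSlope, h1, h2]; field_simp; ring
  rw [chord, this, h1]; ring

theorem eq_of_two_common_abscissae {l m : ℝ × ℝ} {x y : ℝ} (hxy : x ≠ y)
    (hx : l.1 * x + l.2 = m.1 * x + m.2) (hy : l.1 * y + l.2 = m.1 * y + m.2) : l = m := by
  have h : (l.1 - m.1) * (x - y) = 0 := by linear_combination hx - hy
  have h1 : l.1 = m.1 := by
    rcases mul_eq_zero.1 h with h | h
    · linarith
    · exact absurd (by linarith) hxy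
  refine Prod.ext h1 ?_
  rw [h1] at hx; linarith

theorem IsConsecutive.line_eq {V : Finset ℝ} {Y : ℝ → ℝ} {l m e : ℝ × ℝ}
    (h : IsConsecutive V Y l e) (h' : IsConsecutive V Y m e) : l = m :=
  eq_of_two_common_abscissae h.lt.ne
    ((mem_linePoints.1 h.left).2.symm.trans (mem_linePoints.1 h'.left).2)
    ((mem_linePoints.1 h.right).2.symm.trans (mem_linePoints.1 h'.right).2)

theorem IsConsecutive.eq_of_mem_Ioo {V : Finset ℝ} {Y : ℝ → ℝ} {l e f : ℝ × ℝ} {x : ℝ}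
    (h : IsConsecutive V Y l e) (h' : IsConsecutive V Y l f) (h1 : e.1 < x) (h2 : x < e.2)
    (h3 : f.1 < x) (h4 : x < f.2) : e = f := by
  refine Prod.ext ?_ ?_
  · rcases lt_trichotomy e.1 f.1 with hc | hc | hc
    · exact (h.none _ h'.left hc (by linarith)).elim
    · exact hc
    · exact (h'.none _ h.left hc (by linarith)).elim
  · rcases lt_trichotomy e.2 f.2 with hc | hc | hc
    · exact (h'.none _ h.right (by linarith) hc).elim
    · exact hc
    · exact (h.none _ h'.right (by linarith) hc).elim

open Classical in
/-- The segments between consecutive points on the lines of `L`. -/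
noncomputable def lineEdges (V : Finset ℝ) (Y : ℝ → ℝ) (L : Finset (ℝ × ℝ)) : Finset (ℝ × ℝ) :=
  (V ×ˢ V).filter fun e ↦ ∃ l ∈ L, IsConsecutive V Y l e

theorem isDrawing_lineEdges (V : Finset ℝ) (Y : ℝ → ℝ) (L : Finset (ℝ × ℝ)) :
    IsDrawing V Y (lineEdges V Y L) := by
  classical
  refine ⟨fun e he ↦ ?_, fun e he ↦ ?_, fun e he ↦ ?_, fun e he v hv h1 h2 h3 ↦ ?_⟩ <;>
    obtain ⟨hV, l, hl, hc⟩ := Finset.mem_filter.1 he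
  · exact (Finset.mem_product.1 hV).1
  · exact (Finset.mem_product.1 hV).2
  · exact hc.lt
  · exact hc.none v (mem_linePoints.2 ⟨hv, by rw [← h3, hc.chord_eq]⟩) h1 h2

theorem crossings_lineEdges {V : Finset ℝ} {Y : ℝ → ℝ} {L : Finset (ℝ × ℝ)}
    {p : (ℝ × ℝ) × (ℝ × ℝ)} (hp : p ∈ crossings Y (lineEdges V Y L)) :
    ∃ l ∈ L, ∃ m ∈ L, l ≠ m ∧ IsConsecutive V Y l p.1 ∧ IsConsecutive V Y m p.2 ∧
      ∃ x, p.1.1 < x ∧ p.2.1 < x ∧ x < p.1.2 ∧ x < p.2.2 ∧ l.1 * x + l.2 = m.1 * x + m.2 := by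
  classical
  obtain ⟨hE, hne, x, h1, h2, h3, h4, h5⟩ := Finset.mem_filter.1 hp
  obtain ⟨he, hf⟩ := Finset.mem_product.1 hE
  obtain ⟨-, l, hl, hcl⟩ := Finset.mem_filter.1 he
  obtain ⟨-, m, hm, hcm⟩ := Finset.mem_filter.1 hf
  rw [hcl.chord_eq, hcm.chord_eq] at h5
  refine ⟨l, hl, m, hm, ?_, hcl, hcm, x, h1, h2, h3, h4, h5⟩
  rintro rfl
  exact hne (hcl.eq_of_mem_Ioo hcm h1 h3 h2 h4)

/-- Two distinct lines have at most one common abscissa, and it lies in the interior of at most one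
segment of each. -/
theorem card_crossings_lineEdges_le (V : Finset ℝ) (Y : ℝ → ℝ) (L : Finset (ℝ × ℝ)) :
    (crossings Y (lineEdges V Y L)).card ≤ L.card ^ 2 := by
  classical
  rw [sq, ← Finset.card_product]
  have h := fun p (hp : p ∈ crossings Y (lineEdges V Y L)) ↦ crossings_lineEdges hp
  choose! l hl m hm hne hcl hcm x h1 h2 h3 h4 h5 using h
  refine Finset.card_le_card_of_injOn (fun p ↦ (l p, m p))
    (fun p hp ↦ Finset.mk_mem_product (hl p hp) (hm p hp)) ?_
  intro p hp p' hp' hpp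
  obtain ⟨hl', hm'⟩ := Prod.mk_inj.1 hpp
  have hx : x p = x p' := by
    by_contra hxx
    refine hne p hp (eq_of_two_common_abscissae hxx (h5 p hp) ?_)
    rw [hl', hm']; exact h5 p' hp'
  refine Prod.ext ?_ ?_
  · exact (hcl p hp).eq_of_mem_Ioo (hl' ▸ hcl p' hp') (h1 p hp) (h3 p hp)
      (hx ▸ h1 p' hp') (hx ▸ h3 p' hp')
  · exact (hcm p hp).eq_of_mem_Ioo (hm' ▸ hcm p' hp') (h2 p hp) (h4 p hp)
      (hx ▸ h2 p' hp') (hx ▸ h4 p' hp')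

/-- The two lines meet only at the crossing, which is interior to both segments, so no endpoint is
shared. The sampling argument needs this. -/
theorem crossings_lineEdges_endpoints {V : Finset ℝ} {Y : ℝ → ℝ} {L : Finset (ℝ × ℝ)}
    {p : (ℝ × ℝ) × (ℝ × ℝ)} (hp : p ∈ crossings Y (lineEdges V Y L)) :
    p.1.1 ≠ p.2.1 ∧ p.1.1 ≠ p.2.2 ∧ p.1.2 ≠ p.2.1 ∧ p.1.2 ≠ p.2.2 := by
  obtain ⟨l, hl, m, hm, hne, hcl, hcm, x, h1, h2, h3, h4, h5⟩ := crossings_lineEdges hp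
  have key : ∀ v, v ∈ linePoints V Y l → v ∈ linePoints V Y m → v ≠ x → False := by
    intro v hv hv' hvx
    exact hne (eq_of_two_common_abscissae hvx
      ((mem_linePoints.1 hv).2.symm.trans (mem_linePoints.1 hv').2) h5)
  refine ⟨fun hc ↦ ?_, fun hc ↦ ?_, fun hc ↦ ?_, fun hc ↦ ?_⟩
  · exact key _ hcl.left (hc ▸ hcm.left) h1.ne
  · exact key _ hcl.left (hc ▸ hcm.right) h1.ne
  · exact key _ hcl.right (hc ▸ hcm.left) h3.ne'
  · exact key _ hcl.right (hc ▸ hcm.right) h3.ne'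

/-- Every point of a line except the last starts a segment, and a segment determines its line. -/
theorem mul_le_card_lineEdges {V : Finset ℝ} {Y : ℝ → ℝ} {L : Finset (ℝ × ℝ)} {k : ℕ}
    (hk : ∀ l ∈ L, k + 1 ≤ (linePoints V Y l).card) :
    L.card * k ≤ (lineEdges V Y L).card := by
  classical
  have hnext : ∀ l, ∀ v ∈ linePoints V Y l, ∀ u ∈ linePoints V Y l, v < u →
      ∃ w, IsConsecutive V Y l (v, w) := by
    intro l v hv u hu hvu
    obtain ⟨w, hw, hmin⟩ := ((linePoints V Y l).filter fun u ↦ v < u).exists_min_image id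
      ⟨u, Finset.mem_filter.2 ⟨hu, hvu⟩⟩
    obtain ⟨hw1, hw2⟩ := Finset.mem_filter.1 hw
    exact ⟨w, hv, hw1, hw2, fun z hz h1 h2 ↦
      absurd (hmin z (Finset.mem_filter.2 ⟨hz, h1⟩)) (not_le.2 h2)⟩
  have hcard : ∀ l ∈ L, k ≤ ((V ×ˢ V).filter (IsConsecutive V Y l)).card := by
    intro l hl
    have hpos : (linePoints V Y l).Nonempty := Finset.card_pos.1 (by have := hk l hl; omega)
    have h1 : k ≤ ((linePoints V Y l).erase ((linePoints V Y l).max' hpos)).card := by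
      rw [Finset.card_erase_of_mem (Finset.max'_mem _ _)]
      have := hk l hl; omega
    refine h1.trans ?_
    have hn : ∀ v ∈ (linePoints V Y l).erase ((linePoints V Y l).max' hpos),
        ∃ w, IsConsecutive V Y l (v, w) := fun v hv ↦
      hnext l v (Finset.mem_of_mem_erase hv) _ (Finset.max'_mem _ hpos)
        (Finset.lt_max'_of_mem_erase_max' _ hpos hv)
    choose! w hw using hn
    refine Finset.card_le_card_of_injOn (fun v ↦ (v, w v)) (fun v hv ↦ ?_) ?_
    · refine Finset.mem_filter.2 ⟨Finset.mk_mem_product ?_ ?_, hw v hv⟩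
      · exact (mem_linePoints.1 (hw v hv).left).1
      · exact (mem_linePoints.1 (hw v hv).right).1
    · intro v _ v' _ h
      exact (Prod.mk_inj.1 h).1
  have heq : lineEdges V Y L = L.biUnion fun l ↦ (V ×ˢ V).filter (IsConsecutive V Y l) := by
    ext e
    simp only [lineEdges, Finset.mem_filter, Finset.mem_biUnion]
    exact ⟨fun ⟨h, l, hl, hc⟩ ↦ ⟨l, hl, h, hc⟩, fun ⟨l, hl, h, hc⟩ ↦ ⟨h, l, hl, hc⟩⟩
  rw [heq, Finset.card_biUnion]
  · rw [← smul_eq_mul]; exact Finset.card_nsmul_le_sum _ _ _ hcard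
  · intro l _ m _ hlm
    refine Finset.disjoint_left.2 fun e he hf ↦ hlm ?_
    exact (Finset.mem_filter.1 he).2.line_eq (Finset.mem_filter.1 hf).2

/-- The **Szemerédi–Trotter theorem**, for lines with at least `k` points where `k² ≤ 4 n`. -/
theorem card_mul_cube_le_of_linePoints {V : Finset ℝ} {Y : ℝ → ℝ} {L : Finset (ℝ × ℝ)} {k : ℕ}
    (hk2 : 2 ≤ k) (hkV : k ^ 2 ≤ 4 * V.card) (hk : ∀ l ∈ L, k ≤ (linePoints V Y l).card) :
    (L.card : ℝ) * k ^ 3 ≤ 2304 * (V.card : ℝ) ^ 2 := by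
  obtain ⟨j, rfl⟩ : ∃ j, k = j + 1 := ⟨k - 1, by omega⟩
  have hE := mul_le_card_lineEdges hk
  have hC := fun q (hq : 0 < q) ↦ (isDrawing_lineEdges V Y L).card_mul_sq_le
    (fun p hp ↦ crossings_lineEdges_endpoints hp) (q := q) hq
  have hX := card_crossings_lineEdges_le V Y L
  set l : ℝ := (L.card : ℝ) with hl
  set n : ℝ := (V.card : ℝ) with hn
  set κ : ℝ := ((j + 1 : ℕ) : ℝ) with hκ
  have hκ2 : 2 ≤ κ := by rw [hκ]; exact_mod_cast hk2
  have hκn : κ ^ 2 ≤ 4 * n := by rw [hκ, hn]; exact_mod_cast hkV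
  have hn0 : 0 < n := by nlinarith
  have hl0 : 0 ≤ l := Nat.cast_nonneg _
  have key : ∀ q : ℕ, 0 < q → l * κ * q ^ 2 ≤ 6 * n * q ^ 3 + 2 * l ^ 2 := by
    intro q hq
    have h1 : L.card * j * q ^ 2 ≤ 3 * V.card * q ^ 3 + L.card ^ 2 :=
      (Nat.mul_le_mul_right _ hE).trans ((hC q hq).trans (Nat.add_le_add_left hX _))
    have h2 : l * j * q ^ 2 ≤ 3 * n * q ^ 3 + l ^ 2 := by rw [hl, hn]; exact_mod_cast h1
    have h3 : κ ≤ 2 * j := by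
      rw [hκ]; push_cast
      have : (1 : ℝ) ≤ j := by exact_mod_cast (show 1 ≤ j by omega)
      linarith
    have h4 : l * κ * q ^ 2 ≤ l * (2 * j) * q ^ 2 := by gcongr
    linarith
  -- With few lines, lκ³ ≤ 12nκ² ≤ 48n² already suffices.
  rcases lt_or_ge (l * κ) (12 * n) with hsmall | hbig
  · nlinarith [mul_le_mul_of_nonneg_left hκn (mul_nonneg hl0 (by linarith : (0 : ℝ) ≤ κ))]
  · have hr1 : 1 ≤ l * κ / (12 * n) := by rw [le_div_iff₀ (by positivity)]; linarith
    -- The largest sampling parameter for which the vertex term 6nq³ is at most half of lκq²; the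
    -- floor loses at most a factor 2.
    set q := ⌊l * κ / (12 * n)⌋₊ with hq
    have hq1 : 1 ≤ q := Nat.one_le_floor_iff _ |>.2 hr1
    have hq1' : (1 : ℝ) ≤ q := by exact_mod_cast hq1
    have hqle : (q : ℝ) ≤ l * κ / (12 * n) := Nat.floor_le (by linarith)
    have hqlt : l * κ / (12 * n) < q + 1 := Nat.lt_floor_add_one _
    have h1 : 12 * n * q ≤ l * κ := by
      rw [le_div_iff₀ (by positivity)] at hqle; linarith
    have h2 : l * κ ≤ 24 * n * q := by
      rw [div_lt_iff₀ (by positivity)] at hqlt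
      nlinarith
    have h3 := key q hq1
    have h4 : κ * (q : ℝ) ^ 2 ≤ 4 * l := by
      have h5 : l * (κ * (q : ℝ) ^ 2) ≤ l * (4 * l) := by
        nlinarith [mul_le_mul_of_nonneg_right h1 (sq_nonneg (q : ℝ))]
      have hl1 : 0 < l := by
        by_contra! hc
        have : l = 0 := le_antisymm hc hl0
        rw [this] at hbig; linarith
      exact le_of_mul_le_mul_left h5 hl1
    have h5 : (l * κ) ^ 2 ≤ (24 * n * q) ^ 2 := by gcongr
    have hl1 : 0 < l := by
      by_contra! hc
      have : l = 0 := le_antisymm hc hl0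
      rw [this] at hbig; linarith
    have h6 : l * (l * κ ^ 3) ≤ l * (2304 * n ^ 2) := by
      calc l * (l * κ ^ 3) = (l * κ) ^ 2 * κ := by ring
        _ ≤ (24 * n * q) ^ 2 * κ := by gcongr
        _ = 576 * n ^ 2 * (κ * q ^ 2) := by ring
        _ ≤ 576 * n ^ 2 * (4 * l) := by gcongr
        _ = _ := by ring
    exact le_of_mul_le_mul_left h6 hl1

/-! ### Incidences of lattice lines with a finite set. -/

/-- The integer inner product on `ℤ²`. -/
def latticeDot (d z : ℤ × ℤ) : ℤ := d.1 * z.1 + d.2 * z.2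

/-- Rotation by a right angle. -/
def latticeRot (d : ℤ × ℤ) : ℤ × ℤ := (-d.2, d.1)

/-- The number of points of `E` on the line through `y` with normal `d`. -/
def lineCount (E : Finset (ℤ × ℤ)) (d y : ℤ × ℤ) : ℕ :=
  (E.filter fun z ↦ latticeDot d z = latticeDot d y).card

/-- A set of primitive vectors without antipodal pairs, so that distinct members are not
parallel. -/
def IsDirectionSet (D : Finset (ℤ × ℤ)) : Prop := ∀ d ∈ D, IsCoprime d.1 d.2 ∧ -d ∉ D

theorem lineCount_congr {E : Finset (ℤ × ℤ)} {d y z : ℤ × ℤ}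
    (h : latticeDot d z = latticeDot d y) : lineCount E d z = lineCount E d y := by
  simp only [lineCount, h]

theorem lineCount_le_card (E : Finset (ℤ × ℤ)) (d y : ℤ × ℤ) : lineCount E d y ≤ E.card :=
  Finset.card_filter_le _ _

theorem exists_smul_of_parallel {d v : ℤ × ℤ} (hd : IsCoprime d.1 d.2)
    (h : d.1 * v.2 = d.2 * v.1) : ∃ t : ℤ, v = t • d := by
  obtain ⟨a, b, hab⟩ := hd
  refine ⟨a * v.1 + b * v.2, Prod.ext ?_ ?_⟩ <;> simp only [Prod.smul_fst, Prod.smul_snd, smul_eq_mul]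
  · linear_combination (-v.1) * hab - b * h
  · linear_combination (-v.2) * hab + a * h

theorem IsDirectionSet.eq_of_parallel {D : Finset (ℤ × ℤ)} (hD : IsDirectionSet D)
    {d d' : ℤ × ℤ} (hd : d ∈ D) (hd' : d' ∈ D) (h : d.1 * d'.2 = d.2 * d'.1) : d = d' := by
  obtain ⟨t, ht⟩ := exists_smul_of_parallel (hD d hd).1 h
  obtain ⟨u, hu⟩ := exists_smul_of_parallel (hD d' hd').1 (v := d) (by linarith)
  obtain ⟨a, b, hab⟩ := (hD d hd).1
  have h1 : d.1 = u * (t * d.1) := by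
    conv_lhs => rw [hu, ht]
    simp
  have h2 : d.2 = u * (t * d.2) := by
    conv_lhs => rw [hu, ht]
    simp
  have h3 : u * t = 1 := by linear_combination (1 - u * t) * hab - a * h1 - b * h2
  rcases Int.eq_one_or_neg_one_of_mul_eq_one' h3 with ⟨-, h4⟩ | ⟨-, h4⟩
  · rw [ht, h4, one_smul]
  · rw [h4, neg_one_smul] at ht
    exact absurd (ht ▸ hd') (hD d hd).2

theorem IsDirectionSet.eq_of_two_lines {D : Finset (ℤ × ℤ)} (hD : IsDirectionSet D)
    {d d' y z : ℤ × ℤ} (hd : d ∈ D) (hd' : d' ∈ D) (hne : d ≠ d')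
    (h : latticeDot d z = latticeDot d y) (h' : latticeDot d' z = latticeDot d' y) : z = y := by
  have hdet : d.1 * d'.2 - d.2 * d'.1 ≠ 0 := fun hc ↦
    hne (hD.eq_of_parallel hd hd' (by linarith))
  simp only [latticeDot] at h h'
  refine Prod.ext ?_ ?_
  · have : (d.1 * d'.2 - d.2 * d'.1) * (z.1 - y.1) = 0 := by
      linear_combination d'.2 * h - d.2 * h'
    rcases mul_eq_zero.1 this with h0 | h0
    · exact absurd h0 hdet
    · linarith
  · have : (d.1 * d'.2 - d.2 * d'.1) * (z.2 - y.2) = 0 := by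
      linear_combination d.1 * h' - d'.1 * h
    rcases mul_eq_zero.1 this with h0 | h0
    · exact absurd h0 hdet
    · linarith

theorem IsDirectionSet.rot {D : Finset (ℤ × ℤ)} (hD : IsDirectionSet D) :
    IsDirectionSet (D.image latticeRot) := by
  intro d hd
  obtain ⟨e, he, rfl⟩ := Finset.mem_image.1 hd
  obtain ⟨h1, h2⟩ := hD e he
  refine ⟨h1.symm.neg_left, fun hc ↦ h2 ?_⟩
  obtain ⟨f, hf, hfe⟩ := Finset.mem_image.1 hc
  have : f = -e := by
    simp only [latticeRot, Prod.ext_iff, Prod.fst_neg, Prod.snd_neg] at hfe ⊢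
    constructor <;> linarith [hfe.1, hfe.2]
  exact this ▸ hf

theorem latticeRot_injective : Function.Injective latticeRot := by
  intro a b h
  simp only [latticeRot, Prod.mk.injEq, neg_inj] at h
  exact Prod.ext h.2 h.1

theorem eq_zero_of_add_mul_sqrt_two {a b : ℤ} (h : (a : ℝ) + b * √2 = 0) : a = 0 ∧ b = 0 := by
  by_cases hb : b = 0
  · subst hb
    simpa using h
  · have h1 := (irrational_sqrt_two.intCast_mul hb).intCast_add a
    exact absurd h h1.ne_zero

/-- An injective linear functional on the lattice. -/
noncomputable def latticeCoord (z : ℤ × ℤ) : ℝ := z.1 + z.2 * √2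

theorem latticeCoord_injective : Function.Injective latticeCoord := by
  intro z w h
  have : (((z.1 - w.1 : ℤ) : ℝ)) + ((z.2 - w.2 : ℤ) : ℝ) * √2 = 0 := by
    simp only [latticeCoord] at h; push_cast; linarith
  obtain ⟨h1, h2⟩ := eq_zero_of_add_mul_sqrt_two this
  exact Prod.ext (by linarith) (by linarith)

/-- Pairs `(d, y)` for which the line through `y` with normal `d` has between `k` and `2 k` points
of `E`: the Szemerédi–Trotter bound. -/
theorem IsDirectionSet.card_filter_lineCount_le {D : Finset (ℤ × ℤ)} (hD : IsDirectionSet D)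
    (E : Finset (ℤ × ℤ)) {k : ℕ} (hk : 2 ≤ k) (hkE : k ^ 2 ≤ 4 * E.card) :
    (((D ×ˢ E).filter fun p ↦ k ≤ lineCount E p.1 p.2 ∧ lineCount E p.1 p.2 < 2 * k).card : ℝ) *
      k ^ 2 ≤ 4608 * (E.card : ℝ) ^ 2 := by
  classical
  set Q := (D ×ˢ E).filter fun p ↦ k ≤ lineCount E p.1 p.2 ∧ lineCount E p.1 p.2 < 2 * k with hQ
  let line : (ℤ × ℤ) × (ℤ × ℤ) → (ℤ × ℤ) × ℤ := fun p ↦ (p.1, latticeDot p.1 p.2)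
  -- Each line carries fewer than 2k of the pairs, so it remains to count lines.
  have hfib : Q.card ≤ 2 * k * (Q.image line).card := by
    refine Finset.card_le_mul_card_image _ _ fun l hl ↦ ?_
    obtain ⟨p, hp, rfl⟩ := Finset.mem_image.1 hl
    refine le_trans ?_ (Finset.mem_filter.1 hp).2.2.le
    refine Finset.card_le_card_of_injOn Prod.snd (fun q hq ↦ ?_) ?_
    · obtain ⟨hq1, hq2⟩ := Finset.mem_filter.1 hq
      obtain ⟨hq3, hq4⟩ := Prod.mk_inj.1 hq2
      rw [hq3] at hq4
      exact Finset.mem_filter.2 ⟨(Finset.mem_product.1 (Finset.mem_filter.1 hq1).1).2, hq4⟩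
    · intro q hq q' hq' h
      exact Prod.ext ((Prod.mk_inj.1 (Finset.mem_filter.1 hq).2).1.trans
        (Prod.mk_inj.1 (Finset.mem_filter.1 hq').2).1.symm) h
  -- With abscissa z₁ + z₂√2, distinct lattice points have distinct abscissae and no lattice line is
  -- vertical, both because √2 is irrational. So the points form the graph of a function, as the
  -- planar argument requires.
  let V := E.image latticeCoord
  let Y : ℝ → ℝ := fun v ↦ (Function.invFun latticeCoord v).2
  have hY : ∀ z, Y (latticeCoord z) = z.2 := fun z ↦ by
    simp only [Y, Function.leftInverse_invFun latticeCoord_injective z]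
  -- Slope and intercept from solving d₁z₁ + d₂z₂ = m with z₁ = v - √2 z₂.
  let toLine : (ℤ × ℤ) × ℤ → ℝ × ℝ := fun l ↦
    (-l.1.1 / (l.1.2 - l.1.1 * √2), l.2 / (l.1.2 - l.1.1 * √2))
  have hden : ∀ d ∈ D, (d.2 : ℝ) - d.1 * √2 ≠ 0 := by
    intro d hd hc
    obtain ⟨h1, h2⟩ := eq_zero_of_add_mul_sqrt_two (a := d.2) (b := -d.1) (by push_cast; linarith)
    have := (hD d hd).1
    rw [h1, neg_eq_zero.1 h2] at this
    exact not_isCoprime_zero_zero this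
  have hV : V.card = E.card := Finset.card_image_of_injective _ latticeCoord_injective
  have hQD : ∀ l ∈ Q.image line, l.1 ∈ D := by
    intro l hl
    obtain ⟨p, hp, rfl⟩ := Finset.mem_image.1 hl
    exact (Finset.mem_product.1 (Finset.mem_filter.1 hp).1).1
  have hL : ((Q.image line).image toLine).card = (Q.image line).card := by
    refine Finset.card_image_of_injOn fun l hl m hm hlm ↦ ?_
    obtain ⟨h1, h2⟩ := Prod.mk_inj.1 hlm
    have dl := hden _ (hQD l hl)
    have dm := hden _ (hQD m hm)
    rw [div_eq_div_iff dl dm] at h1 h2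
    have h3 : l.1 = m.1 := by
      refine hD.eq_of_parallel (hQD l hl) (hQD m hm) ?_
      have : (l.1.1 : ℝ) * m.1.2 = l.1.2 * m.1.1 := by linarith
      exact_mod_cast this
    rw [h3] at h2
    exact Prod.ext h3 (by exact_mod_cast mul_right_cancel₀ dm h2)
  have hST := card_mul_cube_le_of_linePoints (V := V) (Y := Y) (L := (Q.image line).image toLine)
    hk (by rw [hV]; exact hkE) (by
      intro l hl
      obtain ⟨m, hm, rfl⟩ := Finset.mem_image.1 hl
      have dm := hden _ (hQD m hm)
      obtain ⟨p, hp, rfl⟩ := Finset.mem_image.1 hm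
      refine (Finset.mem_filter.1 hp).2.1.trans ?_
      refine Finset.card_le_card_of_injOn latticeCoord (fun z hz ↦ ?_)
        latticeCoord_injective.injOn
      obtain ⟨hz1, hz2⟩ := Finset.mem_filter.1 hz
      refine mem_linePoints.2 ⟨Finset.mem_image_of_mem _ hz1, ?_⟩
      rw [hY]
      have hz3 : (p.1.1 : ℝ) * z.1 + p.1.2 * z.2 = latticeDot p.1 p.2 := by
        rw [← hz2]; simp [latticeDot]
      simp only [toLine, line, latticeCoord] at dm ⊢
      rw [← hz3]
      field_simp
      ring)
  rw [hV, hL] at hST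
  have h1 : (Q.card : ℝ) ≤ 2 * k * (Q.image line).card := by exact_mod_cast hfib
  calc (Q.card : ℝ) * k ^ 2 ≤ (2 * k * (Q.image line).card) * k ^ 2 := by gcongr
    _ = 2 * ((Q.image line).card * (k : ℝ) ^ 3) := by ring
    _ ≤ _ := by linarith

/-- Few incidences with very rich lines. -/
theorem IsDirectionSet.card_filter_rich_le {D : Finset (ℤ × ℤ)} (hD : IsDirectionSet D)
    (E : Finset (ℤ × ℤ)) :
    ((D ×ˢ E).filter fun p ↦ 4 * E.card < lineCount E p.1 p.2 ^ 2).card ≤ 2 * E.card := by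
  classical
  set Q := (D ×ˢ E).filter fun p ↦ 4 * E.card < lineCount E p.1 p.2 ^ 2 with hQ
  let line : (ℤ × ℤ) × (ℤ × ℤ) → (ℤ × ℤ) × ℤ := fun p ↦ (p.1, latticeDot p.1 p.2)
  set m := Nat.sqrt (4 * E.card) + 1 with hm
  have hm2 : 4 * E.card < m ^ 2 := Nat.lt_succ_sqrt' _
  have hfib : m * (Q.image line).card ≤ Q.card := by
    refine Finset.mul_card_image_le_card _ _ fun l hl ↦ ?_
    obtain ⟨p, hp, rfl⟩ := Finset.mem_image.1 hl
    obtain ⟨hp1, hp2⟩ := Finset.mem_filter.1 hp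
    have : m ≤ lineCount E p.1 p.2 := Nat.succ_le_of_lt (Nat.sqrt_lt'.2 hp2)
    refine this.trans ?_
    refine Finset.card_le_card_of_injOn (fun z ↦ (p.1, z)) (fun z hz ↦ ?_) ?_
    · obtain ⟨hz1, hz2⟩ := Finset.mem_filter.1 hz
      refine Finset.mem_filter.2 ⟨Finset.mem_filter.2
        ⟨Finset.mk_mem_product (Finset.mem_product.1 hp1).1 hz1, ?_⟩, ?_⟩
      · simpa only [lineCount_congr hz2] using hp2
      · simp only [line, hz2]
    · intro z _ z' _ h
      exact (Prod.mk_inj.1 h).2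
  -- Pairs of incidences at a common point. Distinct lines meet at most once, so off the diagonal a
  -- pair is determined by its two lines; Cauchy–Schwarz over the points then bounds the number of
  -- incidences.
  let R := (Q ×ˢ Q).filter fun r ↦ r.1.2 = r.2.2
  have hQE : ∀ p ∈ Q, p.2 ∈ E := fun p hp ↦ (Finset.mem_product.1 (Finset.mem_filter.1 hp).1).2
  have hQD : ∀ p ∈ Q, p.1 ∈ D := fun p hp ↦ (Finset.mem_product.1 (Finset.mem_filter.1 hp).1).1
  have hQsum : Q.card = ∑ y ∈ E, (Q.filter fun p ↦ p.2 = y).card :=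
    Finset.card_eq_sum_card_fiberwise hQE
  have hRsum : R.card = ∑ y ∈ E, (Q.filter fun p ↦ p.2 = y).card ^ 2 := by
    rw [Finset.card_eq_sum_card_fiberwise (f := fun r ↦ r.1.2) (t := E) fun r hr ↦
      hQE _ (Finset.mem_product.1 (Finset.mem_filter.1 hr).1).1]
    refine Finset.sum_congr rfl fun y _ ↦ ?_
    rw [sq, ← Finset.card_product]
    congr 1
    ext r
    simp only [Finset.mem_filter, Finset.mem_product]
    constructor
    · rintro ⟨⟨⟨h1, h2⟩, h3⟩, h4⟩
      exact ⟨⟨h1, h4⟩, h2, h3 ▸ h4⟩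
    · rintro ⟨⟨h1, h2⟩, h3, h4⟩
      exact ⟨⟨⟨h1, h3⟩, h2.trans h4.symm⟩, h2⟩
  have hCS : Q.card ^ 2 ≤ E.card * R.card := by
    rw [hQsum, hRsum]; exact sq_sum_le_card_mul_sum_sq
  have hR : R.card ≤ Q.card + (Q.image line).card ^ 2 := by
    rw [← Finset.card_filter_add_card_filter_not (s := R) (fun r ↦ r.1 = r.2), sq,
      ← Finset.card_product]
    refine Nat.add_le_add ?_ ?_
    · refine Finset.card_le_card_of_injOn Prod.fst (fun r hr ↦ ?_) ?_
      · exact (Finset.mem_product.1 (Finset.mem_filter.1 (Finset.mem_filter.1 hr).1).1).1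
      · intro r hr r' hr' h
        have h1 := (Finset.mem_filter.1 hr).2
        have h2 := (Finset.mem_filter.1 hr').2
        exact Prod.ext h (by rw [← h1, ← h2, h])
    · refine Finset.card_le_card_of_injOn (fun r ↦ (line r.1, line r.2)) (fun r hr ↦ ?_) ?_
      · obtain ⟨h1, h2⟩ := Finset.mem_product.1
          (Finset.mem_filter.1 (Finset.mem_filter.1 hr).1).1
        exact Finset.mk_mem_product (Finset.mem_image_of_mem _ h1) (Finset.mem_image_of_mem _ h2)
      · intro r hr r' hr' h
        obtain ⟨hr1, hr2⟩ := Finset.mem_filter.1 hr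
        obtain ⟨hr1', hr2'⟩ := Finset.mem_filter.1 hr'
        obtain ⟨hr3, hr4⟩ := Finset.mem_filter.1 hr1
        obtain ⟨hr3', hr4'⟩ := Finset.mem_filter.1 hr1'
        obtain ⟨ha, hb⟩ := Prod.mk_inj.1 h
        obtain ⟨ha1, ha2⟩ := Prod.mk_inj.1 ha
        obtain ⟨hb1, hb2⟩ := Prod.mk_inj.1 hb
        have hne : r.1.1 ≠ r.2.1 := fun hc ↦ hr2 (Prod.ext hc hr4)
        have hy : r.1.2 = r'.1.2 := by
          refine hD.eq_of_two_lines (hQD _ (Finset.mem_product.1 hr3).1)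
            (hQD _ (Finset.mem_product.1 hr3).2) hne ?_ ?_
          · rw [ha2, ha1]
          · rw [hr4, hb2, hb1, hr4']
        exact Prod.ext (Prod.ext ha1 hy) (Prod.ext hb1 (by rw [← hr4, hy, hr4']))
  set I := Q.card
  set l := (Q.image line).card
  set n := E.card
  -- Each line has more than 2√n points, so n l² is at most a quarter of I² and can be absorbed on
  -- the left of I² ≤ nI + nl².
  have h1 : 4 * n * l ^ 2 ≤ I ^ 2 := by
    calc 4 * n * l ^ 2 ≤ m ^ 2 * l ^ 2 := Nat.mul_le_mul_right _ hm2.le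
      _ = (m * l) ^ 2 := by ring
      _ ≤ I ^ 2 := Nat.pow_le_pow_left hfib 2
  have h2 : I ^ 2 ≤ n * I + n * l ^ 2 := by
    calc I ^ 2 ≤ n * R.card := hCS
      _ ≤ n * (I + l ^ 2) := Nat.mul_le_mul_left _ hR
      _ = _ := by ring
  rcases Nat.eq_zero_or_pos I with h0 | h0
  · omega
  · refine Nat.le_of_mul_le_mul_right (c := I) ?_ h0
    nlinarith

/-! ### Weighted incidence sums over dyadic richness. -/

/-- The majorant `k + M √k` of a sum of `1 + M / |i|` over `k` distinct nonzero integers. -/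
noncomputable def richWeight (M : ℝ) (k : ℕ) : ℝ := k + M * √k

theorem richWeight_nonneg {M : ℝ} (hM : 0 ≤ M) (k : ℕ) : 0 ≤ richWeight M k := by
  unfold richWeight; positivity

theorem richWeight_mono {M : ℝ} (hM : 0 ≤ M) : Monotone (richWeight M) := fun a b h ↦ by
  unfold richWeight
  have : (a : ℝ) ≤ b := by exact_mod_cast h
  gcongr

theorem richWeight_mul_le {M : ℝ} (hM : 0 ≤ M) {l : ℕ} (hl : 1 ≤ l) (k : ℕ) :
    richWeight M (l * k) ≤ l * richWeight M k := by
  unfold richWeight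
  have hl' : (1 : ℝ) ≤ l := by exact_mod_cast hl
  have : √(l : ℝ) ≤ l := (Real.sqrt_le_left (by linarith)).2 (by nlinarith)
  rw [Nat.cast_mul, Real.sqrt_mul (by positivity), mul_add]
  have h2 : M * (√(l : ℝ) * √(k : ℝ)) ≤ l * (M * √(k : ℝ)) := by
    calc M * (√(l : ℝ) * √(k : ℝ)) = √(l : ℝ) * (M * √(k : ℝ)) := by ring
      _ ≤ _ := by gcongr
  linarith

theorem sum_inv_sq_natAbs_le (I : Finset ℤ) (hI : 0 ∉ I) :
    ∑ i ∈ I, ((i.natAbs : ℝ) ^ 2)⁻¹ ≤ 4 := by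
  classical
  have hnat : ∀ J : Finset ℕ, 0 ∉ J → ∑ j ∈ J, ((j : ℝ) ^ 2)⁻¹ ≤ 2 := by
    intro J hJ
    have h1 : J ⊆ Finset.Ioc 0 (J.sup id) := fun j hj ↦
      Finset.mem_Ioc.2 ⟨Nat.pos_of_ne_zero fun h ↦ hJ (h ▸ hj), Finset.le_sup (f := id) hj⟩
    refine (Finset.sum_le_sum_of_subset_of_nonneg h1 fun _ _ _ ↦ by positivity).trans ?_
    have := sum_Ioc_inv_sq_le_sub (α := ℝ) (k := 1) (n := max 1 (J.sup id)) one_ne_zero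
      (le_max_left _ _)
    have h2 : Finset.Ioc 0 (J.sup id) ⊆ insert 1 (Finset.Ioc 1 (max 1 (J.sup id))) := by
      intro j hj
      simp only [Finset.mem_Ioc, Finset.mem_insert] at hj ⊢
      omega
    refine (Finset.sum_le_sum_of_subset_of_nonneg h2 fun _ _ _ ↦ by positivity).trans ?_
    rw [Finset.sum_insert (by simp)]
    have h3 : (0 : ℝ) ≤ ((max 1 (J.sup id) : ℕ) : ℝ)⁻¹ := by positivity
    rw [Nat.cast_one, inv_one] at this
    rw [Nat.cast_one, one_pow, inv_one]
    linarith
  have hfib : ∀ J : Finset ℤ, 0 ∉ J → (Set.InjOn Int.natAbs J) →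
      ∑ i ∈ J, ((i.natAbs : ℝ) ^ 2)⁻¹ ≤ 2 := by
    intro J hJ hinj
    rw [← Finset.sum_image (f := fun j : ℕ ↦ ((j : ℝ) ^ 2)⁻¹) hinj]
    refine hnat _ fun h ↦ ?_
    obtain ⟨i, hi, h0⟩ := Finset.mem_image.1 h
    exact hJ (Int.natAbs_eq_zero.1 h0 ▸ hi)
  rw [← Finset.sum_filter_add_sum_filter_not I (fun i ↦ 0 < i)]
  have h1 := hfib (I.filter fun i ↦ 0 < i) (by simp) (by
    intro a ha b hb h
    have ha' := (Finset.mem_filter.1 ha).2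
    have hb' := (Finset.mem_filter.1 hb).2
    omega)
  have h2 := hfib (I.filter fun i ↦ ¬ 0 < i) (by simp [hI]) (by
    intro a ha b hb h
    have ha' := (Finset.mem_filter.1 ha).2
    have hb' := (Finset.mem_filter.1 hb).2
    omega)
  linarith

/-- Cauchy–Schwarz against Σ 1/i². The √k is cruder than the true log k, but harmless: weighted by
the incidence count, its dyadic sum still converges. -/
theorem sum_one_add_div_natAbs_le {M : ℝ} (hM : 0 ≤ M) (I : Finset ℤ) (hI : 0 ∉ I) :
    ∑ i ∈ I, (1 + M / i.natAbs) ≤ 2 * richWeight M I.card := by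
  have h1 : (∑ i ∈ I, (1 : ℝ) / i.natAbs) ^ 2 ≤ I.card * 4 := by
    refine (sq_sum_le_card_mul_sum_sq).trans ?_
    gcongr
    simpa using sum_inv_sq_natAbs_le I hI
  have h2 : ∑ i ∈ I, (1 : ℝ) / i.natAbs ≤ 2 * √(I.card : ℝ) := by
    refine abs_le_of_sq_le_sq' ?_ (by positivity) |>.2
    rw [mul_pow, Real.sq_sqrt (by positivity)]; linarith
  rw [Finset.sum_add_distrib]
  have h3 : ∑ i ∈ I, M / (i.natAbs : ℝ) = M * ∑ i ∈ I, (1 : ℝ) / i.natAbs := by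
    rw [Finset.mul_sum]; exact Finset.sum_congr rfl fun i _ ↦ by ring
  rw [h3]
  unfold richWeight
  have h4 := mul_le_mul_of_nonneg_left h2 hM
  have h5 : (0 : ℝ) ≤ I.card := Nat.cast_nonneg _
  simp only [Finset.sum_const, nsmul_eq_mul, mul_one]
  nlinarith

/-- The pairs (direction, point) whose line has at least two points but is not very rich. -/
def poorPairs (D E : Finset (ℤ × ℤ)) : Finset ((ℤ × ℤ) × (ℤ × ℤ)) :=
  (D ×ˢ E).filter fun p ↦ 2 ≤ lineCount E p.1 p.2 ∧ lineCount E p.1 p.2 ^ 2 ≤ 4 * E.card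

theorem mem_poorPairs {D E : Finset (ℤ × ℤ)} {p : (ℤ × ℤ) × (ℤ × ℤ)} :
    p ∈ poorPairs D E ↔ (p.1 ∈ D ∧ p.2 ∈ E) ∧ 2 ≤ lineCount E p.1 p.2 ∧
      lineCount E p.1 p.2 ^ 2 ≤ 4 * E.card := by
  simp only [poorPairs, Finset.mem_filter, Finset.mem_product]

/-- About n²/4^j incidences lie on lines with about 2^j points, each contributing at most about 4^j
+ M 2^{3j/2}. The first part gives n² at each of the log n scales, the second a convergent geometric
series, so M carries no logarithm. -/
theorem IsDirectionSet.sum_poorPairs_le {D : Finset (ℤ × ℤ)} (hD : IsDirectionSet D)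
    (E : Finset (ℤ × ℤ)) {M : ℝ} (hM : 0 ≤ M) :
    ∑ p ∈ poorPairs D E, (lineCount E p.1 p.2 : ℝ) * richWeight M (lineCount E p.1 p.2) ≤
      80000 * (M + Nat.log 2 E.card) * (E.card : ℝ) ^ 2 := by
  classical
  set J := Nat.log 2 E.card with hJ
  have hmap : ∀ p ∈ poorPairs D E, Nat.log 2 (lineCount E p.1 p.2) ∈ Finset.Icc 1 J := by
    intro p hp
    obtain ⟨-, h1, -⟩ := mem_poorPairs.1 hp
    refine Finset.mem_Icc.2 ⟨?_, Nat.log_mono_right (lineCount_le_card _ _ _)⟩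
    exact Nat.log_pos (by norm_num) h1
  rw [← Finset.sum_fiberwise_of_maps_to hmap]
  have hterm : ∀ j ∈ Finset.Icc 1 J, ∑ p ∈ (poorPairs D E).filter
      (fun p ↦ Nat.log 2 (lineCount E p.1 p.2) = j),
      (lineCount E p.1 p.2 : ℝ) * richWeight M (lineCount E p.1 p.2) ≤
        4608 * (E.card : ℝ) ^ 2 * (4 + 4 * M * (3 / 4) ^ j) := by
    intro j hj
    have hj1 := (Finset.mem_Icc.1 hj).1
    rcases ((poorPairs D E).filter
      (fun p ↦ Nat.log 2 (lineCount E p.1 p.2) = j)).eq_empty_or_nonempty with h0 | h0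
    · rw [h0, Finset.sum_empty]; positivity
    have hb : ∀ p ∈ (poorPairs D E).filter (fun p ↦ Nat.log 2 (lineCount E p.1 p.2) = j),
        2 ^ j ≤ lineCount E p.1 p.2 ∧ lineCount E p.1 p.2 < 2 * 2 ^ j := by
      intro p hp
      obtain ⟨hp1, hp2⟩ := Finset.mem_filter.1 hp
      have h1 := (mem_poorPairs.1 hp1).2.1
      rw [← hp2]
      refine ⟨Nat.pow_log_le_self 2 (by omega), ?_⟩
      have := Nat.lt_pow_succ_log_self (b := 2) (by norm_num) (lineCount E p.1 p.2)
      rw [pow_succ] at this; omega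
    have hcard := hD.card_filter_lineCount_le E (k := 2 ^ j)
      (by calc 2 = 2 ^ 1 := rfl
            _ ≤ 2 ^ j := Nat.pow_le_pow_right (by norm_num) hj1)
      (by obtain ⟨p, hp⟩ := h0
          exact (Nat.pow_le_pow_left (hb p hp).1 2).trans
            (mem_poorPairs.1 (Finset.mem_filter.1 hp).1).2.2)
    have hsub : ((poorPairs D E).filter
        (fun p ↦ Nat.log 2 (lineCount E p.1 p.2) = j)).card ≤ ((D ×ˢ E).filter fun p ↦
          2 ^ j ≤ lineCount E p.1 p.2 ∧ lineCount E p.1 p.2 < 2 * 2 ^ j).card := by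
      refine Finset.card_le_card fun p hp ↦ ?_
      refine Finset.mem_filter.2 ⟨?_, hb p hp⟩
      exact Finset.mem_product.2 (mem_poorPairs.1 (Finset.mem_filter.1 hp).1).1
    set c := ((poorPairs D E).filter (fun p ↦ Nat.log 2 (lineCount E p.1 p.2) = j)).card
    have hc : (c : ℝ) * 4 ^ j ≤ 4608 * (E.card : ℝ) ^ 2 := by
      refine le_trans ?_ hcard
      have h1 : ((2 ^ j : ℕ) : ℝ) ^ 2 = 4 ^ j := by
        push_cast; rw [← pow_mul, mul_comm, pow_mul]; norm_num
      rw [h1]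
      gcongr
    have hone : ∀ p ∈ (poorPairs D E).filter (fun p ↦ Nat.log 2 (lineCount E p.1 p.2) = j),
        (lineCount E p.1 p.2 : ℝ) * richWeight M (lineCount E p.1 p.2) ≤
          4 ^ j * (4 + 4 * M * (3 / 4) ^ j) := by
      intro p hp
      have h1 : (lineCount E p.1 p.2 : ℝ) ≤ 2 * 2 ^ j := by exact_mod_cast (hb p hp).2.le
      -- The base 3/2 is a rational substitute for √2; it gives the ratio 2 · (3/2) / 4 = 3/4 below.
      have h2 : √(lineCount E p.1 p.2 : ℝ) ≤ 2 * (3 / 2) ^ j := by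
        rw [Real.sqrt_le_left (by positivity)]
        refine h1.trans ?_
        have : (2 : ℝ) ^ j ≤ ((3 / 2) ^ 2) ^ j := by gcongr; norm_num
        rw [mul_pow, ← pow_mul, mul_comm j 2, pow_mul]
        nlinarith [pow_pos (show (0 : ℝ) < 2 by norm_num) j]
      calc (lineCount E p.1 p.2 : ℝ) * richWeight M (lineCount E p.1 p.2)
          ≤ (2 * 2 ^ j) * (2 * 2 ^ j + M * (2 * (3 / 2) ^ j)) := by
            unfold richWeight; gcongr
        _ = 4 * (2 * 2) ^ j + 4 * M * (2 * (3 / 2)) ^ j := by rw [mul_pow, mul_pow]; ring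
        _ = 4 * 4 ^ j + 4 * M * (4 * (3 / 4)) ^ j := by norm_num
        _ = _ := by rw [mul_pow]; ring
    calc _ ≤ c * (4 ^ j * (4 + 4 * M * (3 / 4) ^ j)) := by
          rw [← nsmul_eq_mul]; exact Finset.sum_le_card_nsmul _ _ _ hone
      _ = c * 4 ^ j * (4 + 4 * M * (3 / 4) ^ j) := by ring
      _ ≤ _ := by gcongr
  refine (Finset.sum_le_sum hterm).trans ?_
  rw [← Finset.mul_sum, Finset.sum_add_distrib, ← Finset.mul_sum]
  have hgeom : ∑ j ∈ Finset.Icc 1 J, (3 / 4 : ℝ) ^ j ≤ 4 := by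
    have h1 : ∑ j ∈ Finset.range (J + 1), (3 / 4 : ℝ) ^ j ≤ 4 := by
      rw [geom_sum_eq (by norm_num)]
      have : (0 : ℝ) ≤ (3 / 4) ^ (J + 1) := by positivity
      rw [div_le_iff_of_neg (by norm_num)]; linarith
    refine (Finset.sum_le_sum_of_subset_of_nonneg (fun j hj ↦ ?_) fun _ _ _ ↦ ?_).trans h1
    · have := (Finset.mem_Icc.1 hj).2
      exact Finset.mem_range.2 (by omega)
    · positivity
  have hn : (0 : ℝ) ≤ (E.card : ℝ) ^ 2 := by positivity
  have h1 : ∑ j ∈ Finset.Icc 1 J, (4 : ℝ) + 4 * M * ∑ j ∈ Finset.Icc 1 J, (3 / 4 : ℝ) ^ j ≤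
      16 * (M + J) := by
    simp only [Finset.sum_const, Nat.card_Icc, Nat.add_sub_cancel, nsmul_eq_mul]
    have := mul_le_mul_of_nonneg_left hgeom hM
    have : (0 : ℝ) ≤ J := Nat.cast_nonneg _
    linarith
  calc _ ≤ 4608 * (E.card : ℝ) ^ 2 * (16 * (M + J)) := by gcongr
    _ ≤ _ := by
      have : (0 : ℝ) ≤ (M + J) * (E.card : ℝ) ^ 2 := by positivity
      linarith

/-! ### Primitive directions and keys of rectangles. -/

/-- The greatest common divisor of the coordinates. -/
def latticeGcd (v : ℤ × ℤ) : ℕ := Int.gcd v.1 v.2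

/-- The half plane of vectors that are lexicographically positive. -/
def IsLexPos (v : ℤ × ℤ) : Prop := 0 < v.1 ∨ v.1 = 0 ∧ 0 < v.2

open Classical in
/-- The primitive, lexicographically positive vector parallel to `v`. -/
noncomputable def latticeDir (v : ℤ × ℤ) : ℤ × ℤ :=
  if IsLexPos v then (v.1 / latticeGcd v, v.2 / latticeGcd v)
  else (-v.1 / latticeGcd v, -v.2 / latticeGcd v)

theorem latticeGcd_pos {v : ℤ × ℤ} (hv : v ≠ 0) : 0 < latticeGcd v := by
  refine Nat.pos_of_ne_zero fun h ↦ hv ?_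
  rw [latticeGcd, Int.gcd_eq_zero_iff] at h
  exact Prod.ext h.1 h.2

theorem latticeGcd_neg (v : ℤ × ℤ) : latticeGcd (-v) = latticeGcd v := by
  simp [latticeGcd]

theorem isLexPos_neg_iff {v : ℤ × ℤ} (hv : v ≠ 0) : IsLexPos (-v) ↔ ¬ IsLexPos v := by
  have : v.1 ≠ 0 ∨ v.2 ≠ 0 := by
    by_contra! h; exact hv (Prod.ext h.1 h.2)
  simp only [IsLexPos, Prod.fst_neg, Prod.snd_neg]
  omega

theorem latticeDir_neg {v : ℤ × ℤ} (hv : v ≠ 0) : latticeDir (-v) = latticeDir v := by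
  unfold latticeDir
  by_cases h : IsLexPos v
  · simp [h, (isLexPos_neg_iff hv).not_left.2 h, latticeGcd_neg]
  · simp [h, (isLexPos_neg_iff hv).2 h, latticeGcd_neg]

theorem latticeDir_spec {v : ℤ × ℤ} (hv : v ≠ 0) :
    IsCoprime (latticeDir v).1 (latticeDir v).2 ∧ IsLexPos (latticeDir v) ∧
      ∃ t : ℤ, t ≠ 0 ∧ t.natAbs = latticeGcd v ∧ v = t • latticeDir v := by
  have hg := latticeGcd_pos hv
  have hg' : (0 : ℤ) < latticeGcd v := by exact_mod_cast hg
  have h1 : ((latticeGcd v : ℕ) : ℤ) ∣ v.1 := Int.gcd_dvd_left ..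
  have h2 : ((latticeGcd v : ℕ) : ℤ) ∣ v.2 := Int.gcd_dvd_right ..
  obtain ⟨a, ha⟩ := h1
  obtain ⟨b, hb⟩ := h2
  have hab : IsCoprime a b := by
    rw [Int.isCoprime_iff_gcd_eq_one]
    have h3 : Int.gcd v.1 v.2 = latticeGcd v * Int.gcd a b := by
      conv_lhs => rw [ha, hb, Int.gcd_mul_left]
      simp
    have h4 : latticeGcd v * Int.gcd a b = latticeGcd v * 1 := by rw [← h3, mul_one]; rfl
    exact Nat.eq_of_mul_eq_mul_left hg h4
  unfold latticeDir
  by_cases h : IsLexPos v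
  · simp only [h, if_true]
    have e1 : v.1 / latticeGcd v = a := by
      conv_lhs => rw [ha]
      exact Int.mul_ediv_cancel_left _ hg'.ne'
    have e2 : v.2 / latticeGcd v = b := by
      conv_lhs => rw [hb]
      exact Int.mul_ediv_cancel_left _ hg'.ne'
    rw [e1, e2]
    refine ⟨hab, ?_, latticeGcd v, hg'.ne', by simp, Prod.ext (by simpa using ha) (by simpa using hb)⟩
    rcases h with h | ⟨h, h'⟩
    · left; rw [ha] at h; exact (mul_pos_iff_of_pos_left hg').1 h
    · right
      rw [ha] at h; rw [hb] at h'
      exact ⟨(mul_eq_zero.1 h).resolve_left hg'.ne', (mul_pos_iff_of_pos_left hg').1 h'⟩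
  · have hn := (isLexPos_neg_iff hv).2 h
    simp only [h, if_false]
    have e1 : -v.1 / latticeGcd v = -a := by
      conv_lhs => rw [ha]
      rw [← mul_neg]
      exact Int.mul_ediv_cancel_left _ hg'.ne'
    have e2 : -v.2 / latticeGcd v = -b := by
      conv_lhs => rw [hb]
      rw [← mul_neg]
      exact Int.mul_ediv_cancel_left _ hg'.ne'
    rw [e1, e2]
    refine ⟨hab.neg_neg, ?_, -(latticeGcd v : ℤ), by simpa using hg.ne', by simp,
      Prod.ext (by simpa using ha) (by simpa using hb)⟩
    rcases hn with h | ⟨h, h'⟩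
    · left
      rw [Prod.fst_neg, ha, ← mul_neg] at h; exact (mul_pos_iff_of_pos_left hg').1 h
    · right
      rw [Prod.fst_neg, ha, ← mul_neg] at h; rw [Prod.snd_neg, hb, ← mul_neg] at h'
      exact ⟨(mul_eq_zero.1 h).resolve_left hg'.ne', (mul_pos_iff_of_pos_left hg').1 h'⟩

/-- The directions of the differences of distinct points of `S`. -/
noncomputable def directions (S : Finset (ℤ × ℤ)) : Finset (ℤ × ℤ) :=
  S.offDiag.image fun p ↦ latticeDir (p.2 - p.1)

theorem ne_zero_of_mem_offDiag {S : Finset (ℤ × ℤ)} {p : (ℤ × ℤ) × (ℤ × ℤ)}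
    (hp : p ∈ S.offDiag) : p.2 - p.1 ≠ 0 :=
  sub_ne_zero.2 (Finset.mem_offDiag.1 hp).2.2.symm

theorem latticeDir_mem_directions {S : Finset (ℤ × ℤ)} {p : (ℤ × ℤ) × (ℤ × ℤ)}
    (hp : p ∈ S.offDiag) : latticeDir (p.2 - p.1) ∈ directions S :=
  Finset.mem_image_of_mem (fun p : (ℤ × ℤ) × (ℤ × ℤ) ↦ latticeDir (p.2 - p.1)) hp

theorem isDirectionSet_directions (S : Finset (ℤ × ℤ)) : IsDirectionSet (directions S) := by
  have h : ∀ d ∈ directions S, IsCoprime d.1 d.2 ∧ IsLexPos d := by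
    intro d hd
    obtain ⟨p, hp, rfl⟩ := Finset.mem_image.1 hd
    obtain ⟨h1, h2, -⟩ := latticeDir_spec (ne_zero_of_mem_offDiag hp)
    exact ⟨h1, h2⟩
  refine fun d hd ↦ ⟨(h d hd).1, fun hn ↦ ?_⟩
  have h1 := (h d hd).2
  have h2 := (h _ hn).2
  simp only [IsLexPos, Prod.fst_neg, Prod.snd_neg] at h1 h2
  omega

theorem latticeDot_smul (t : ℤ) (d z : ℤ × ℤ) : latticeDot (t • d) z = t * latticeDot d z := by
  simp only [latticeDot, Prod.smul_fst, Prod.smul_snd, smul_eq_mul]; ring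

theorem latticeDot_add (d y z : ℤ × ℤ) : latticeDot d (y + z) = latticeDot d y + latticeDot d z := by
  simp only [latticeDot, Prod.fst_add, Prod.snd_add]; ring

theorem latticeDot_sub (d y z : ℤ × ℤ) : latticeDot d (y - z) = latticeDot d y - latticeDot d z := by
  simp only [latticeDot, Prod.fst_sub, Prod.snd_sub]; ring

theorem eq_of_latticeDot_eq {d y z : ℤ × ℤ} (hd : IsCoprime d.1 d.2)
    (h1 : latticeDot d y = latticeDot d z)
    (h2 : latticeDot (latticeRot d) y = latticeDot (latticeRot d) z) : y = z := by
  have hpos : d.1 ^ 2 + d.2 ^ 2 ≠ 0 := by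
    intro h
    have h3 : d.1 = 0 := by nlinarith [sq_nonneg d.1, sq_nonneg d.2]
    have h4 : d.2 = 0 := by nlinarith [sq_nonneg d.1, sq_nonneg d.2]
    rw [h3, h4] at hd
    exact not_isCoprime_zero_zero hd
  simp only [latticeDot, latticeRot] at h1 h2
  refine Prod.ext (mul_left_cancel₀ hpos ?_) (mul_left_cancel₀ hpos ?_)
  · linear_combination d.1 * h1 - d.2 * h2
  · linear_combination d.2 * h1 + d.1 * h2

/-- Two pairs span a rectangle (or coincide) when they have the same key. -/
def pairKey (p : (ℤ × ℤ) × (ℤ × ℤ)) : (ℤ × ℤ) × ℤ := (p.2 - p.1, latticeDot (p.2 - p.1) p.1)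

theorem pairKey_eq_iff {p q : (ℤ × ℤ) × (ℤ × ℤ)} : pairKey p = pairKey q ↔
    p.2 - p.1 = q.2 - q.1 ∧ latticeDot (p.2 - p.1) p.1 = latticeDot (p.2 - p.1) q.1 := by
  rw [pairKey, pairKey, Prod.mk_inj]
  exact and_congr_right fun h ↦ by rw [h]

theorem latticeDot_dir_eq {v y z : ℤ × ℤ} (hv : v ≠ 0) (h : latticeDot v y = latticeDot v z) :
    latticeDot (latticeDir v) y = latticeDot (latticeDir v) z := by
  obtain ⟨-, -, t, ht, -, hvt⟩ := latticeDir_spec hv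
  rw [hvt, latticeDot_smul, latticeDot_smul] at h
  exact mul_left_cancel₀ ht h

theorem latticeDot_rot_dir_eq {y z : ℤ × ℤ} (hv : z - y ≠ 0) :
    latticeDot (latticeRot (latticeDir (z - y))) z =
      latticeDot (latticeRot (latticeDir (z - y))) y := by
  obtain ⟨-, -, t, ht, -, hvt⟩ := latticeDir_spec hv
  rw [← sub_eq_zero, ← latticeDot_sub]
  set d := latticeDir (z - y)
  rw [hvt]
  simp only [latticeDot, latticeRot, Prod.smul_fst, Prod.smul_snd, smul_eq_mul]; ring

/-- The weight `1 + M / gcd`. -/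
noncomputable def gcdWeight (M : ℝ) (u : ℤ × ℤ) : ℝ := 1 + M / latticeGcd u

theorem gcdWeight_nonneg {M : ℝ} (hM : 0 ≤ M) (u : ℤ × ℤ) : 0 ≤ gcdWeight M u := by
  unfold gcdWeight; positivity

theorem gcdWeight_neg (M : ℝ) (u : ℤ × ℤ) : gcdWeight M (-u) = gcdWeight M u := by
  rw [gcdWeight, gcdWeight, latticeGcd_neg]

theorem gcdWeight_le {M : ℝ} (hM : 0 ≤ M) {u : ℤ × ℤ} (hu : u ≠ 0) : gcdWeight M u ≤ 1 + M := by
  unfold gcdWeight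
  have : (1 : ℝ) ≤ latticeGcd u := by exact_mod_cast latticeGcd_pos hu
  gcongr
  exact div_le_self hM this

/-! ### The quadratic form over rectangles. -/

/-- The quadratic form that sums `f` over pairs of opposite sides of rectangles. -/
noncomputable def rectForm (M : ℝ) (S : Finset (ℤ × ℤ)) (f : (ℤ × ℤ) × (ℤ × ℤ) → ℝ) : ℝ :=
  ∑ p ∈ S.offDiag, ∑ q ∈ S.offDiag with pairKey p = pairKey q,
    gcdWeight M (p.2 - p.1) * (f p * f q)

/-- Being a combination of squares with nonnegative weights (for M ≥ 0), the form can be split over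
sums of functions with only Cauchy–Schwarz losses. -/
theorem rectForm_eq_sum_sq (M : ℝ) (S : Finset (ℤ × ℤ)) (f : (ℤ × ℤ) × (ℤ × ℤ) → ℝ) :
    rectForm M S f = ∑ κ ∈ S.offDiag.image pairKey,
      gcdWeight M κ.1 * (∑ p ∈ S.offDiag with pairKey p = κ, f p) ^ 2 := by
  rw [rectForm, ← Finset.sum_fiberwise_of_maps_to (t := S.offDiag.image pairKey)
    (g := pairKey) (fun p hp ↦ Finset.mem_image_of_mem _ hp)]
  refine Finset.sum_congr rfl fun κ _ ↦ ?_
  rw [sq, Finset.sum_mul_sum, Finset.mul_sum]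
  refine Finset.sum_congr rfl fun p hp ↦ ?_
  have hp2 := (Finset.mem_filter.1 hp).2
  rw [Finset.mul_sum]
  refine Finset.sum_congr ?_ fun q _ ↦ ?_
  · refine Finset.filter_congr fun q _ ↦ ?_
    rw [hp2, eq_comm]
  · rw [← hp2]; rfl

theorem rectForm_add_le {M : ℝ} (hM : 0 ≤ M) (S : Finset (ℤ × ℤ))
    (f g : (ℤ × ℤ) × (ℤ × ℤ) → ℝ) :
    rectForm M S (fun p ↦ f p + g p) ≤ 2 * rectForm M S f + 2 * rectForm M S g := by
  simp only [rectForm_eq_sum_sq, Finset.mul_sum, ← Finset.sum_add_distrib]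
  refine Finset.sum_le_sum fun κ _ ↦ ?_
  have h := gcdWeight_nonneg hM κ.1
  have := add_sq_le (a := ∑ p ∈ S.offDiag with pairKey p = κ, f p)
    (b := ∑ p ∈ S.offDiag with pairKey p = κ, g p)
  rw [Finset.sum_add_distrib]
  nlinarith [mul_le_mul_of_nonneg_left this h]

/-- Cauchy–Schwarz in each square, with free weights θ. They let a sum over pairs of levels be
controlled without counting the pairs. -/
theorem rectForm_sum_le {ι : Type*} {M : ℝ} (hM : 0 ≤ M) (S : Finset (ℤ × ℤ)) (A : Finset ι)
    (f : ι → (ℤ × ℤ) × (ℤ × ℤ) → ℝ) (θ : ι → ℝ) (hθ : ∀ i ∈ A, 0 < θ i) :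
    rectForm M S (fun p ↦ ∑ i ∈ A, f i p) ≤
      (∑ i ∈ A, θ i) * ∑ i ∈ A, rectForm M S (f i) / θ i := by
  have h1 : ∑ i ∈ A, rectForm M S (f i) / θ i = ∑ κ ∈ S.offDiag.image pairKey,
      gcdWeight M κ.1 * ∑ i ∈ A, (∑ p ∈ S.offDiag with pairKey p = κ, f i p) ^ 2 / θ i := by
    simp only [rectForm_eq_sum_sq, Finset.sum_div, Finset.mul_sum]
    rw [Finset.sum_comm]
    exact Finset.sum_congr rfl fun κ _ ↦ Finset.sum_congr rfl fun i _ ↦ by ring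
  rw [h1, rectForm_eq_sum_sq, Finset.mul_sum]
  refine Finset.sum_le_sum fun κ _ ↦ ?_
  rw [Finset.sum_comm, mul_left_comm]
  refine mul_le_mul_of_nonneg_left ?_ (gcdWeight_nonneg hM _)
  refine Finset.sum_sq_le_sum_mul_sum_of_sq_le_mul _ (fun i hi ↦ (hθ i hi).le)
    (fun i hi ↦ div_nonneg (sq_nonneg _) (hθ i hi).le) fun i hi ↦ ?_
  rw [mul_div_cancel₀ _ (hθ i hi).ne']

theorem rectForm_mono {M : ℝ} (hM : 0 ≤ M) {S : Finset (ℤ × ℤ)} {f g : (ℤ × ℤ) × (ℤ × ℤ) → ℝ}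
    (hf : ∀ p ∈ S.offDiag, 0 ≤ f p) (hfg : ∀ p ∈ S.offDiag, f p ≤ g p) :
    rectForm M S f ≤ rectForm M S g := by
  refine Finset.sum_le_sum fun p hp ↦ Finset.sum_le_sum fun q hq ↦ ?_
  have hq' := (Finset.mem_filter.1 hq).1
  have := gcdWeight_nonneg hM (p.2 - p.1)
  have h1 := hf q hq'
  have h2 := (hf p hp).trans (hfg p hp)
  have h3 := hfg p hp
  have h4 := hfg q hq'
  gcongr

theorem pairKey_swap_eq_iff {p q : (ℤ × ℤ) × (ℤ × ℤ)} :
    pairKey p.swap = pairKey q.swap ↔ pairKey p = pairKey q := by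
  have key : ∀ p q : (ℤ × ℤ) × (ℤ × ℤ), pairKey p = pairKey q → pairKey p.swap = pairKey q.swap := by
    intro p q h
    rw [pairKey_eq_iff] at h ⊢
    obtain ⟨h1, h2⟩ := h
    simp only [Prod.swap, Prod.ext_iff, latticeDot, Prod.fst_sub, Prod.snd_sub] at h1 h2 ⊢
    obtain ⟨h3, h4⟩ := h1
    refine ⟨⟨by linarith, by linarith⟩, ?_⟩
    have e1 : q.2.1 = q.1.1 + (p.2.1 - p.1.1) := by linarith
    have e2 : q.2.2 = q.1.2 + (p.2.2 - p.1.2) := by linarith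
    rw [e1, e2]; linear_combination -h2
  exact ⟨fun h ↦ by simpa using key _ _ h, key p q⟩

/-- Reversing both sides of a rectangle changes v to -v, which has the same gcd. This allows either
endpoint of a pair to be taken as the first. -/
theorem rectForm_swap (M : ℝ) (S : Finset (ℤ × ℤ)) (f : (ℤ × ℤ) × (ℤ × ℤ) → ℝ) :
    rectForm M S (fun p ↦ f p.swap) = rectForm M S f := by
  have hmem : ∀ p : (ℤ × ℤ) × (ℤ × ℤ), p.swap ∈ S.offDiag ↔ p ∈ S.offDiag := by
    intro p; simp only [Finset.mem_offDiag, Prod.fst_swap, Prod.snd_swap]; tauto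
  refine Finset.sum_equiv (Equiv.prodComm _ _) (fun p ↦ (hmem p).symm) fun p _ ↦ ?_
  refine Finset.sum_equiv (Equiv.prodComm _ _) (fun q ↦ ?_) fun q _ ↦ ?_
  · rw [Finset.mem_filter, Finset.mem_filter]
    exact and_congr (hmem q).symm pairKey_swap_eq_iff.symm
  · simp only [Equiv.prodComm_apply, Prod.fst_swap, Prod.snd_swap]
    rw [← gcdWeight_neg, neg_sub]

/-- Diagonal contributions: `f` is carried by pairs that are alone with their key. -/
theorem rectForm_le_of_unique {M : ℝ} (hM : 0 ≤ M) {S : Finset (ℤ × ℤ)}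
    {f : (ℤ × ℤ) × (ℤ × ℤ) → ℝ}
    (hu : ∀ p ∈ S.offDiag, ∀ q ∈ S.offDiag, pairKey p = pairKey q → f p ≠ 0 → f q ≠ 0 → p = q) :
    rectForm M S f ≤ (1 + M) * ∑ p ∈ S.offDiag, f p ^ 2 := by
  rw [rectForm, Finset.mul_sum]
  refine Finset.sum_le_sum fun p hp ↦ ?_
  by_cases h0 : f p = 0
  · simp [h0]
  rw [Finset.sum_eq_single p]
  · rw [← sq]
    exact mul_le_mul_of_nonneg_right (gcdWeight_le hM (ne_zero_of_mem_offDiag hp)) (sq_nonneg _)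
  · intro q hq hqp
    obtain ⟨hq1, hq2⟩ := Finset.mem_filter.1 hq
    by_cases h1 : f q = 0
    · simp [h1]
    · exact absurd (hu p hp q hq1 hq2 h0 h1).symm hqp
  · intro h
    exact (h (Finset.mem_filter.2 ⟨hp, rfl⟩)).elim

/-- Contributions of pairs whose first point lies in an exceptional set depending on the
direction. -/
theorem rectForm_le_of_exceptional {M : ℝ} (hM : 0 ≤ M) {S : Finset (ℤ × ℤ)} {c : ℤ × ℤ → ℝ}
    {f : (ℤ × ℤ) × (ℤ × ℤ) → ℝ} (B : Finset ((ℤ × ℤ) × (ℤ × ℤ)))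
    (hf : ∀ p ∈ S.offDiag, (f p = 0 ∨ f p = c p.1 * c p.2 ∧ (latticeDir (p.2 - p.1), p.1) ∈ B)) :
    rectForm M S f ≤ (1 + M) * ((∑ b ∈ B, c b.2 ^ 2) * ∑ x ∈ S, c x ^ 2) := by
  classical
  set R := (S.offDiag ×ˢ S.offDiag).filter fun r ↦ pairKey r.1 = pairKey r.2 with hR
  let g : (ℤ × ℤ) × (ℤ × ℤ) → ℝ := fun p ↦
    if (latticeDir (p.2 - p.1), p.1) ∈ B then c p.1 ^ 2 else 0
  have hg0 : ∀ p, 0 ≤ g p := fun p ↦ by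
    by_cases h : (latticeDir (p.2 - p.1), p.1) ∈ B <;> simp [g, h, sq_nonneg]
  have hpt : ∀ r ∈ R, gcdWeight M (r.1.2 - r.1.1) * (f r.1 * f r.2) ≤
      (1 + M) * ((g r.1 * c r.2.2 ^ 2 + g r.2 * c r.1.2 ^ 2) / 2) := by
    intro r hr
    obtain ⟨hr1, hr2⟩ := Finset.mem_filter.1 hr
    obtain ⟨h1, h2⟩ := Finset.mem_product.1 hr1
    have hn : 0 ≤ (g r.1 * c r.2.2 ^ 2 + g r.2 * c r.1.2 ^ 2) / 2 := by
      have := hg0 r.1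
      have := hg0 r.2
      positivity
    rcases hf _ h1 with h3 | ⟨h3, h3'⟩
    · rw [h3]; simp only [zero_mul, mul_zero]; positivity
    rcases hf _ h2 with h4 | ⟨h4, h4'⟩
    · rw [h4]; simp only [mul_zero]; positivity
    have hw := gcdWeight_le hM (ne_zero_of_mem_offDiag h1)
    have hw0 := gcdWeight_nonneg hM (r.1.2 - r.1.1)
    refine le_trans ?_ (mul_le_mul_of_nonneg_right hw hn)
    refine mul_le_mul_of_nonneg_left ?_ hw0
    simp only [g, h3', h4', if_true]
    rw [h3, h4]
    -- The four corners are grouped into the two diagonals.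
    nlinarith [sq_nonneg (c r.1.1 * c r.2.2 - c r.2.1 * c r.1.2)]
  have hsum : rectForm M S f = ∑ r ∈ R, gcdWeight M (r.1.2 - r.1.1) * (f r.1 * f r.2) := by
    rw [rectForm, hR, Finset.sum_filter, Finset.sum_product]
    exact Finset.sum_congr rfl fun p _ ↦ by rw [Finset.sum_filter]
  have hsymm : ∑ r ∈ R, g r.2 * c r.1.2 ^ 2 = ∑ r ∈ R, g r.1 * c r.2.2 ^ 2 := by
    refine Finset.sum_equiv (Equiv.prodComm _ _) (fun r ↦ ?_) fun r _ ↦ rfl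
    simp only [hR, Finset.mem_filter, Finset.mem_product, Equiv.prodComm_apply, Prod.fst_swap,
      Prod.snd_swap]
    rw [eq_comm (a := pairKey r.1)]; tauto
  rw [hsum]
  refine (Finset.sum_le_sum hpt).trans ?_
  rw [← Finset.mul_sum, ← Finset.sum_div, Finset.sum_add_distrib, hsymm]
  refine mul_le_mul_of_nonneg_left ?_ (by linarith)
  rw [add_self_div_two]
  let R' := R.filter fun r ↦ (latticeDir (r.1.2 - r.1.1), r.1.1) ∈ B
  have h1 : ∑ r ∈ R, g r.1 * c r.2.2 ^ 2 = ∑ r ∈ R', c r.1.1 ^ 2 * c r.2.2 ^ 2 := by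
    refine Eq.trans (Finset.sum_congr rfl fun r _ ↦ ?_) (Finset.sum_filter _ _).symm
    by_cases h : (latticeDir (r.1.2 - r.1.1), r.1.1) ∈ B <;> simp [g, h]
  let corner : ((ℤ × ℤ) × (ℤ × ℤ)) × ((ℤ × ℤ) × (ℤ × ℤ)) → ((ℤ × ℤ) × (ℤ × ℤ)) × (ℤ × ℤ) :=
    fun r ↦ ((latticeDir (r.1.2 - r.1.1), r.1.1), r.2.2)
  -- A rectangle is determined by the direction of a side and two opposite corners, so the sum
  -- factors into one over `B` and one over `S`.
  have hinj : Set.InjOn corner R' := by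
    intro r hr s hs hrs
    obtain ⟨hr1, hr2⟩ := Finset.mem_filter.1 (Finset.mem_filter.1 hr).1
    obtain ⟨hs1, hs2⟩ := Finset.mem_filter.1 (Finset.mem_filter.1 hs).1
    have hrn := ne_zero_of_mem_offDiag (Finset.mem_product.1 hr1).1
    have hsn := ne_zero_of_mem_offDiag (Finset.mem_product.1 hs1).1
    simp only [corner, Prod.mk_inj] at hrs
    obtain ⟨⟨hd, hx⟩, hz⟩ := hrs
    have fact : ∀ r : ((ℤ × ℤ) × (ℤ × ℤ)) × ((ℤ × ℤ) × (ℤ × ℤ)), r.1.2 - r.1.1 ≠ 0 →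
        pairKey r.1 = pairKey r.2 →
        latticeDot (latticeDir (r.1.2 - r.1.1)) r.1.2 =
          latticeDot (latticeDir (r.1.2 - r.1.1)) r.2.2 := by
      intro r hrn hk
      obtain ⟨k1, k2⟩ := pairKey_eq_iff.1 hk
      have := latticeDot_dir_eq hrn k2
      have e1 : r.2.2 = r.2.1 + (r.1.2 - r.1.1) := by rw [k1]; abel
      generalize latticeDir (r.1.2 - r.1.1) = D at this
      rw [e1, latticeDot_add, latticeDot_sub, this]; ring
    have h12 : r.1.2 = s.1.2 := by
      refine eq_of_latticeDot_eq (latticeDir_spec hrn).1 ?_ ?_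
      · rw [fact r hrn hr2, hz, hd, fact s hsn hs2]
      · rw [latticeDot_rot_dir_eq hrn, hd, hx, latticeDot_rot_dir_eq hsn]
    have h11 : r.1 = s.1 := Prod.ext hx h12
    have h21 : r.2.1 = s.2.1 := by
      have k1 := (pairKey_eq_iff.1 hr2).1
      have k2 := (pairKey_eq_iff.1 hs2).1
      rw [h11, k2, hz] at k1
      exact (sub_right_injective k1).symm
    exact Prod.ext h11 (Prod.ext h21 hz)
  rw [h1, Finset.sum_mul_sum, ← Finset.sum_product',
    ← Finset.sum_image (g := corner) (f := fun t : ((ℤ × ℤ) × (ℤ × ℤ)) × (ℤ × ℤ) ↦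
      c t.1.2 ^ 2 * c t.2 ^ 2) hinj]
  refine Finset.sum_le_sum_of_subset_of_nonneg (fun t ht ↦ ?_) fun _ _ _ ↦ by positivity
  obtain ⟨r, hr, rfl⟩ := Finset.mem_image.1 ht
  obtain ⟨hr1, hr2⟩ := Finset.mem_filter.1 hr
  exact Finset.mk_mem_product hr2
    (Finset.mem_offDiag.1 (Finset.mem_product.1 (Finset.mem_filter.1 hr1).1).2).2.1

/-! ### Counting rectangles between nested sets. -/

theorem IsDirectionSet.sum_rot_le {D : Finset (ℤ × ℤ)} (hD : IsDirectionSet D)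
    (E : Finset (ℤ × ℤ)) {M : ℝ} (hM : 0 ≤ M) :
    ∑ p ∈ D ×ˢ E with 2 ≤ lineCount E (latticeRot p.1) p.2 ∧
      lineCount E (latticeRot p.1) p.2 ^ 2 ≤ 4 * E.card,
      (lineCount E (latticeRot p.1) p.2 : ℝ) * richWeight M (lineCount E (latticeRot p.1) p.2) ≤
        80000 * (M + Nat.log 2 E.card) * (E.card : ℝ) ^ 2 := by
  classical
  refine le_trans ?_ (hD.rot.sum_poorPairs_le E hM)
  let φ : (ℤ × ℤ) × (ℤ × ℤ) → (ℤ × ℤ) × (ℤ × ℤ) := fun p ↦ (latticeRot p.1, p.2)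
  have hφ : Function.Injective φ := fun p q h ↦
    Prod.ext (latticeRot_injective (Prod.mk_inj.1 h).1) (Prod.mk_inj.1 h).2
  rw [← Finset.sum_image (g := φ) (f := fun p ↦ (lineCount E p.1 p.2 : ℝ) *
    richWeight M (lineCount E p.1 p.2)) hφ.injOn]
  refine Finset.sum_le_sum_of_subset_of_nonneg (fun p hp ↦ ?_) fun p _ _ ↦
    mul_nonneg (Nat.cast_nonneg _) (richWeight_nonneg hM _)
  obtain ⟨q, hq, rfl⟩ := Finset.mem_image.1 hp
  obtain ⟨hq1, hq2⟩ := Finset.mem_filter.1 hq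
  exact mem_poorPairs.2 ⟨⟨Finset.mem_image_of_mem _ (Finset.mem_product.1 hq1).1,
    (Finset.mem_product.1 hq1).2⟩, hq2⟩

/-- Directions and points at which no line in question is very rich. -/
def cornerPairs (D E F : Finset (ℤ × ℤ)) : Finset ((ℤ × ℤ) × (ℤ × ℤ)) :=
  (D ×ˢ E).filter fun p ↦ (2 ≤ lineCount E p.1 p.2 ∧ lineCount E p.1 p.2 ^ 2 ≤ 4 * E.card) ∧
    lineCount E (latticeRot p.1) p.2 ^ 2 ≤ 4 * E.card ∧
    lineCount F (latticeRot p.1) p.2 ^ 2 ≤ 4 * F.card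

/-- Right angles whose leg in `F` is much richer than the legs in `E` are rare, since the vertex
has to be one of the few points of `E` on that leg. -/
theorem IsDirectionSet.sum_richer_le {D : Finset (ℤ × ℤ)} (hD : IsDirectionSet D)
    {E F : Finset (ℤ × ℤ)} {M : ℝ} (hM : 0 ≤ M) {l : ℕ} (hl : 1 ≤ l)
    (A : Finset ((ℤ × ℤ) × (ℤ × ℤ))) (hA : ∀ p ∈ A, (p.1 ∈ D ∧ p.2 ∈ E) ∧
      (2 ≤ lineCount F (latticeRot p.1) p.2 ∧
        lineCount F (latticeRot p.1) p.2 ^ 2 ≤ 4 * F.card) ∧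
      l * lineCount E (latticeRot p.1) p.2 ≤ lineCount F (latticeRot p.1) p.2) :
    ∑ p ∈ A, ((lineCount F (latticeRot p.1) p.2 : ℝ) / l) *
      richWeight M (lineCount F (latticeRot p.1) p.2) ≤
        80000 * (M + Nat.log 2 F.card) * ((F.card : ℝ) ^ 2 / l ^ 2) := by
  classical
  have hl' : (0 : ℝ) < l := by exact_mod_cast hl
  let q : (ℤ × ℤ) × (ℤ × ℤ) → ℕ := fun p ↦ lineCount F (latticeRot p.1) p.2
  let r : (ℤ × ℤ) × (ℤ × ℤ) → ℤ := fun p ↦ latticeDot (latticeRot p.1) p.2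
  let G := (D ×ˢ F).filter fun p ↦ 2 ≤ q p ∧ q p ^ 2 ≤ 4 * F.card
  -- The factor q is spread over the q points of `F` on the leg through the vertex.
  have h1 : ∀ p ∈ A, ((q p : ℝ) / l) * richWeight M (q p) =
      ∑ z ∈ G with z.1 = p.1 ∧ r z = r p, richWeight M (q z) / l := by
    intro p hp
    obtain ⟨⟨hpD, hpE⟩, ⟨hp2, hp4⟩, hpl⟩ := hA p hp
    have hc : (G.filter fun z ↦ z.1 = p.1 ∧ r z = r p).card = q p := by
      refine Finset.card_bij' (fun z _ ↦ z.2) (fun z _ ↦ (p.1, z)) (fun z hz ↦ ?_) (fun z hz ↦ ?_)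
        (fun z hz ↦ ?_) (fun z hz ↦ rfl)
      · obtain ⟨hz1, hz2, hz3⟩ := Finset.mem_filter.1 hz
        refine Finset.mem_filter.2 ⟨(Finset.mem_product.1 (Finset.mem_filter.1 hz1).1).2, ?_⟩
        simpa only [r, hz2] using hz3
      · obtain ⟨hz1, hz2⟩ := Finset.mem_filter.1 hz
        have : q (p.1, z) = q p := lineCount_congr hz2
        exact Finset.mem_filter.2 ⟨Finset.mem_filter.2 ⟨Finset.mk_mem_product hpD hz1,
          by rw [this]; exact ⟨hp2, hp4⟩⟩, rfl, hz2⟩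
      · exact Prod.ext (Finset.mem_filter.1 hz).2.1.symm rfl
    rw [Finset.sum_congr rfl (g := fun _ ↦ richWeight M (q p) / l), Finset.sum_const, hc,
      nsmul_eq_mul]
    · ring
    · intro z hz
      obtain ⟨-, hz2, hz3⟩ := Finset.mem_filter.1 hz
      have : q z = q p := by
        simp only [q, hz2]
        refine lineCount_congr ?_
        simpa only [r, hz2] using hz3
      rw [this]
  -- A point of the leg is reached only from the vertices in `E` on the same line, of which there
  -- are at most q/l. This second 1/l yields the total gain l⁻².
  have h2 : ∀ z ∈ G, ((A.filter fun p ↦ z.1 = p.1 ∧ r z = r p).card : ℝ) ≤ q z / l := by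
    intro z hz
    rw [le_div_iff₀ hl']
    rcases (A.filter fun p ↦ z.1 = p.1 ∧ r z = r p).eq_empty_or_nonempty with h0 | ⟨p, hp⟩
    · rw [h0]; simp
    obtain ⟨hp1, hp2, hp3⟩ := Finset.mem_filter.1 hp
    have hq : q z = q p := by
      simp only [q, hp2]
      refine lineCount_congr ?_
      simpa only [r, hp2] using hp3
    have hc : (A.filter fun p ↦ z.1 = p.1 ∧ r z = r p).card ≤
        lineCount E (latticeRot p.1) p.2 := by
      refine Finset.card_le_card_of_injOn Prod.snd (fun s hs ↦ ?_) fun s hs t ht hst ↦ ?_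
      · obtain ⟨hs1, hs2, hs3⟩ := Finset.mem_filter.1 hs
        refine Finset.mem_filter.2 ⟨(hA s hs1).1.2, ?_⟩
        have h4 : r s = r p := hs3.symm.trans hp3
        have h5 : s.1 = p.1 := hs2.symm.trans hp2
        simpa only [r, h5] using h4
      · exact Prod.ext ((Finset.mem_filter.1 hs).2.1.symm.trans (Finset.mem_filter.1 ht).2.1) hst
    have h3 := (Nat.mul_le_mul_left l hc).trans (hA p hp1).2.2
    rw [hq]
    have h6 : (l : ℝ) * (A.filter fun p ↦ z.1 = p.1 ∧ r z = r p).card ≤ q p := by exact_mod_cast h3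
    linarith
  calc ∑ p ∈ A, ((q p : ℝ) / l) * richWeight M (q p)
      = ∑ p ∈ A, ∑ z ∈ G with z.1 = p.1 ∧ r z = r p, richWeight M (q z) / l :=
        Finset.sum_congr rfl h1
    _ = ∑ z ∈ G, ∑ p ∈ A with z.1 = p.1 ∧ r z = r p, richWeight M (q z) / l := by
        simp only [Finset.sum_filter]; exact Finset.sum_comm
    _ ≤ ∑ z ∈ G, (q z * richWeight M (q z)) / l ^ 2 := by
        refine Finset.sum_le_sum fun z hz ↦ ?_
        rw [Finset.sum_const, nsmul_eq_mul]
        calc _ ≤ (q z / l : ℝ) * (richWeight M (q z) / l) := by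
              refine mul_le_mul_of_nonneg_right (h2 z hz) ?_
              exact div_nonneg (richWeight_nonneg hM _) hl'.le
          _ = _ := by field_simp
    _ = (∑ z ∈ G, q z * richWeight M (q z)) / l ^ 2 := by rw [Finset.sum_div]
    _ ≤ (80000 * (M + Nat.log 2 F.card) * (F.card : ℝ) ^ 2) / l ^ 2 := by
        gcongr
        exact hD.sum_rot_le F hM
    _ = _ := by ring

/-- Let k, k' count the points of `E` on the two perpendicular lines and q those of `F` on the
second. If q ≤ l·max(k, k'), replacing q by that maximum costs a factor l and leaves a sum over `E`
alone; otherwise `sum_richer_le` gains l⁻². The parameter l balances sets of very different size. -/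
theorem IsDirectionSet.sum_cornerPairs_le {D : Finset (ℤ × ℤ)} (hD : IsDirectionSet D)
    {E F : Finset (ℤ × ℤ)} (hEF : E ⊆ F) {M : ℝ} (hM : 0 ≤ M) {l : ℕ} (hl : 1 ≤ l) :
    ∑ p ∈ cornerPairs D E F, (lineCount E p.1 p.2 : ℝ) *
      richWeight M (lineCount F (latticeRot p.1) p.2) ≤
        160000 * (M + Nat.log 2 F.card) *
          (l * (E.card : ℝ) ^ 2 + (F.card : ℝ) ^ 2 / l ^ 2) := by
  classical
  have hl' : (0 : ℝ) < l := by exact_mod_cast hl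
  set k : (ℤ × ℤ) × (ℤ × ℤ) → ℕ := fun p ↦ lineCount E p.1 p.2 with hk
  set k' : (ℤ × ℤ) × (ℤ × ℤ) → ℕ := fun p ↦ lineCount E (latticeRot p.1) p.2 with hk'
  set q : (ℤ × ℤ) × (ℤ × ℤ) → ℕ := fun p ↦ lineCount F (latticeRot p.1) p.2 with hq
  set A := cornerPairs D E F
  have hA : ∀ p ∈ A, (p.1 ∈ D ∧ p.2 ∈ E) ∧ (2 ≤ k p ∧ k p ^ 2 ≤ 4 * E.card) ∧
      k' p ^ 2 ≤ 4 * E.card ∧ q p ^ 2 ≤ 4 * F.card := fun p hp ↦ by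
    obtain ⟨h1, h2, h3, h4⟩ := Finset.mem_filter.1 hp
    exact ⟨Finset.mem_product.1 h1, h2, h3, h4⟩
  have hh : ∀ n, 0 ≤ richWeight M n := richWeight_nonneg hM
  have hlog : (Nat.log 2 E.card : ℝ) ≤ Nat.log 2 F.card := by
    exact_mod_cast Nat.log_mono_right (Finset.card_le_card hEF)
  have b1 : ∑ p ∈ A with q p ≤ l * k p, (k p : ℝ) * richWeight M (q p) ≤
      l * (80000 * (M + Nat.log 2 F.card) * (E.card : ℝ) ^ 2) := by
    calc _ ≤ ∑ p ∈ A with q p ≤ l * k p, l * ((k p : ℝ) * richWeight M (k p)) := by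
          refine Finset.sum_le_sum fun p hp ↦ ?_
          have h1 := (richWeight_mono hM (Finset.mem_filter.1 hp).2).trans
            (richWeight_mul_le hM hl _)
          calc _ ≤ (k p : ℝ) * (l * richWeight M (k p)) := by gcongr
            _ = _ := by ring
      _ = l * ∑ p ∈ A with q p ≤ l * k p, ((k p : ℝ) * richWeight M (k p)) := by
          rw [Finset.mul_sum]
      _ ≤ l * ∑ p ∈ poorPairs D E, ((k p : ℝ) * richWeight M (k p)) := by
          refine mul_le_mul_of_nonneg_left ?_ hl'.le
          refine Finset.sum_le_sum_of_subset_of_nonneg (fun p hp ↦ ?_) fun p _ _ ↦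
            mul_nonneg (Nat.cast_nonneg _) (hh _)
          have := hA p (Finset.mem_filter.1 hp).1
          exact mem_poorPairs.2 ⟨this.1, this.2.1⟩
      _ ≤ _ := by
          refine mul_le_mul_of_nonneg_left ((hD.sum_poorPairs_le E hM).trans ?_) hl'.le
          gcongr
  have b2 : ∑ p ∈ A.filter (fun p ↦ ¬ q p ≤ l * k p) with q p ≤ l * k' p,
      (k p : ℝ) * richWeight M (q p) ≤
      l * (80000 * (M + Nat.log 2 F.card) * (E.card : ℝ) ^ 2) := by
    have hkk : ∀ p ∈ (A.filter (fun p ↦ ¬ q p ≤ l * k p)).filter fun p ↦ q p ≤ l * k' p,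
        k p ≤ k' p := by
      intro p hp
      obtain ⟨h1, h2⟩ := Finset.mem_filter.1 hp
      have h3 := (Finset.mem_filter.1 h1).2
      by_contra! hc
      exact h3 (h2.trans (Nat.mul_le_mul_left _ hc.le))
    calc _ ≤ ∑ p ∈ A.filter (fun p ↦ ¬ q p ≤ l * k p) with q p ≤ l * k' p,
          l * ((k' p : ℝ) * richWeight M (k' p)) := by
          refine Finset.sum_le_sum fun p hp ↦ ?_
          have h1 := (richWeight_mono hM (Finset.mem_filter.1 hp).2).trans
            (richWeight_mul_le hM hl _)
          have h2 : (k p : ℝ) ≤ k' p := by exact_mod_cast hkk p hp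
          have := hh (k' p)
          have := hh (q p)
          calc _ ≤ (k' p : ℝ) * (l * richWeight M (k' p)) := by gcongr
            _ = _ := by ring
      _ = l * ∑ p ∈ A.filter (fun p ↦ ¬ q p ≤ l * k p) with q p ≤ l * k' p,
          ((k' p : ℝ) * richWeight M (k' p)) := by rw [Finset.mul_sum]
      _ ≤ l * ∑ p ∈ D ×ˢ E with 2 ≤ k' p ∧ k' p ^ 2 ≤ 4 * E.card,
          ((k' p : ℝ) * richWeight M (k' p)) := by
          refine mul_le_mul_of_nonneg_left ?_ hl'.le
          refine Finset.sum_le_sum_of_subset_of_nonneg (fun p hp ↦ ?_) fun p _ _ ↦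
            mul_nonneg (Nat.cast_nonneg _) (hh _)
          have h1 := hA p (Finset.mem_filter.1 (Finset.mem_filter.1 hp).1).1
          exact Finset.mem_filter.2 ⟨Finset.mem_product.2 h1.1,
            h1.2.1.1.trans (hkk p hp), h1.2.2.1⟩
      _ ≤ _ := by
          refine mul_le_mul_of_nonneg_left ((hD.sum_rot_le E hM).trans ?_) hl'.le
          gcongr
  have b3 : ∑ p ∈ A.filter (fun p ↦ ¬ q p ≤ l * k p) with ¬ q p ≤ l * k' p,
      (k p : ℝ) * richWeight M (q p) ≤
      80000 * (M + Nat.log 2 F.card) * ((F.card : ℝ) ^ 2 / l ^ 2) := by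
    refine le_trans (Finset.sum_le_sum fun p hp ↦ ?_) (hD.sum_richer_le (E := E) hM hl
      ((A.filter fun p ↦ ¬ q p ≤ l * k p).filter fun p ↦ ¬ q p ≤ l * k' p) fun p hp ↦ ?_)
    · obtain ⟨h1, h2⟩ := Finset.mem_filter.1 hp
      have h3 := not_le.1 (Finset.mem_filter.1 h1).2
      have h4 : (k p : ℝ) ≤ q p / l := by
        rw [le_div_iff₀ hl', mul_comm]; exact_mod_cast h3.le
      exact mul_le_mul_of_nonneg_right h4 (hh _)
    · obtain ⟨h1, h2⟩ := Finset.mem_filter.1 hp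
      obtain ⟨h0, h3⟩ := Finset.mem_filter.1 h1
      have h4 := hA p h0
      refine ⟨h4.1, ⟨?_, h4.2.2.2⟩, (not_le.1 h2).le⟩
      have h5 : 1 * k p ≤ l * k p := Nat.mul_le_mul_right _ hl
      have h6 := h4.2.1.1
      have h7 := not_le.1 h3
      change 2 ≤ q p
      omega
  rw [← Finset.sum_filter_add_sum_filter_not A (fun p ↦ q p ≤ l * k p),
    ← Finset.sum_filter_add_sum_filter_not (A.filter fun p ↦ ¬ q p ≤ l * k p)
      (fun p ↦ q p ≤ l * k' p)]
  have hn : 0 ≤ (M + Nat.log 2 F.card) * ((F.card : ℝ) ^ 2 / l ^ 2) := by positivity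
  linarith

/-- The number of rectangles with one side in `E` and the opposite side in `F`. -/
theorem sum_rectangles_le {S E F : Finset (ℤ × ℤ)} (hEF : E ⊆ F) {M : ℝ}
    (hM : 0 ≤ M) {l : ℕ} (hl : 1 ≤ l) (Q : Finset ((ℤ × ℤ) × (ℤ × ℤ)))
    (hQ : ∀ p ∈ Q, p ∈ S.offDiag ∧ p.2 ∈ F ∧
      (latticeDir (p.2 - p.1), p.1) ∈ cornerPairs (directions S) E F) :
    ∑ p ∈ Q, ∑ q ∈ Q with pairKey p = pairKey q, gcdWeight M (p.2 - p.1) ≤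
      320000 * (M + Nat.log 2 F.card) *
        (l * (E.card : ℝ) ^ 2 + (F.card : ℝ) ^ 2 / l ^ 2) := by
  classical
  let τ : (ℤ × ℤ) × (ℤ × ℤ) → (ℤ × ℤ) × (ℤ × ℤ) := fun p ↦ (latticeDir (p.2 - p.1), p.1)
  have hE : ∀ p ∈ Q, p.1 ∈ E := fun p hp ↦
    (Finset.mem_product.1 (Finset.mem_filter.1 (hQ p hp).2.2).1).2
  -- The opposite side is fixed by its first point, which lies in `E` on the perpendicular to the
  -- side at `p.1`.
  have h1 : ∀ p ∈ Q, ∑ q ∈ Q with pairKey p = pairKey q, gcdWeight M (p.2 - p.1) ≤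
      lineCount E (τ p).1 (τ p).2 * gcdWeight M (p.2 - p.1) := by
    intro p hp
    rw [Finset.sum_const, nsmul_eq_mul]
    refine mul_le_mul_of_nonneg_right ?_ (gcdWeight_nonneg hM _)
    norm_cast
    refine Finset.card_le_card_of_injOn Prod.fst (fun q hq ↦ ?_) fun q hq s hs hqs ↦ ?_
    · obtain ⟨hq1, hq2⟩ := Finset.mem_filter.1 hq
      refine Finset.mem_filter.2 ⟨hE q hq1, ?_⟩
      exact (latticeDot_dir_eq (ne_zero_of_mem_offDiag (hQ p hp).1) (pairKey_eq_iff.1 hq2).2).symm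
    · have h2 := (pairKey_eq_iff.1 (Finset.mem_filter.1 hq).2).1
      have h3 := (pairKey_eq_iff.1 (Finset.mem_filter.1 hs).2).1
      rw [h2, hqs] at h3
      exact Prod.ext hqs (sub_left_injective h3)
  -- With direction and first point fixed, the sides are distinct nonzero multiples i of a primitive
  -- vector, with gcd |i|.
  have h2 : ∀ t ∈ cornerPairs (directions S) E F, ∑ p ∈ Q with τ p = t,
      lineCount E (τ p).1 (τ p).2 * gcdWeight M (p.2 - p.1) ≤
        2 * (lineCount E t.1 t.2 * richWeight M (lineCount F (latticeRot t.1) t.2)) := by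
    intro t _
    have hs : ∀ p ∈ Q.filter (fun p ↦ τ p = t), ∃ i : ℤ, i ≠ 0 ∧
        i.natAbs = latticeGcd (p.2 - p.1) ∧ p.2 - p.1 = i • t.1 := by
      intro p hp
      obtain ⟨hp1, hp2⟩ := Finset.mem_filter.1 hp
      obtain ⟨-, -, i, hi⟩ := latticeDir_spec (ne_zero_of_mem_offDiag (hQ p hp1).1)
      rw [← hp2]
      exact ⟨i, hi⟩
    choose! i hi0 hi1 hi2 using hs
    have hfst : ∀ p ∈ Q.filter (fun p ↦ τ p = t), p.1 = t.2 := fun p hp ↦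
      (Prod.ext_iff.1 (Finset.mem_filter.1 hp).2).2
    have hinj : Set.InjOn i (Q.filter fun p ↦ τ p = t) := by
      intro p hp s hs hps
      have e1 := hi2 p hp
      rw [hps, ← hi2 s hs, hfst p hp, hfst s hs] at e1
      exact Prod.ext ((hfst p hp).trans (hfst s hs).symm) (sub_left_injective e1)
    have hw : ∑ p ∈ Q with τ p = t, gcdWeight M (p.2 - p.1) ≤
        2 * richWeight M (lineCount F (latticeRot t.1) t.2) := by
      have e1 : ∑ p ∈ Q with τ p = t, gcdWeight M (p.2 - p.1) =
          ∑ j ∈ (Q.filter fun p ↦ τ p = t).image i, (1 + M / j.natAbs) := by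
        rw [Finset.sum_image hinj]
        exact Finset.sum_congr rfl fun p hp ↦ by rw [hi1 p hp, gcdWeight]
      rw [e1]
      refine (sum_one_add_div_natAbs_le hM _ ?_).trans ?_
      · intro h0
        obtain ⟨p, hp, hp0⟩ := Finset.mem_image.1 h0
        exact hi0 p hp hp0
      · refine mul_le_mul_of_nonneg_left (richWeight_mono hM ?_) (by norm_num)
        rw [Finset.card_image_of_injOn hinj]
        refine Finset.card_le_card_of_injOn Prod.snd (fun p hp ↦ ?_) fun p hp s hs hps ↦
          Prod.ext ((hfst p hp).trans (hfst s hs).symm) hps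
        obtain ⟨hp1, hp2⟩ := Finset.mem_filter.1 hp
        refine Finset.mem_filter.2 ⟨(hQ p hp1).2.1, ?_⟩
        rw [← hp2]
        exact latticeDot_rot_dir_eq (ne_zero_of_mem_offDiag (hQ p hp1).1)
    calc _ = ∑ p ∈ Q with τ p = t, lineCount E t.1 t.2 * gcdWeight M (p.2 - p.1) :=
          Finset.sum_congr rfl fun p hp ↦ by rw [(Finset.mem_filter.1 hp).2]
      _ = lineCount E t.1 t.2 * ∑ p ∈ Q with τ p = t, gcdWeight M (p.2 - p.1) := by
          rw [Finset.mul_sum]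
      _ ≤ lineCount E t.1 t.2 * (2 * richWeight M (lineCount F (latticeRot t.1) t.2)) := by gcongr
      _ = _ := by ring
  refine (Finset.sum_le_sum h1).trans ?_
  rw [← Finset.sum_fiberwise_of_maps_to (g := τ) (t := cornerPairs (directions S) E F)
    fun p hp ↦ (hQ p hp).2.2]
  refine (Finset.sum_le_sum h2).trans ?_
  rw [← Finset.mul_sum]
  have := (isDirectionSet_directions S).sum_cornerPairs_le hEF hM hl
  linarith

/-! ### Decomposition into levels and the rectangle inequality. -/

theorem sum_half_pow_le (A : Finset ℕ) : ∑ n ∈ A, (1 / 2 : ℝ) ^ n ≤ 2 := by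
  exact (summable_geometric_two.sum_le_tsum A fun _ _ ↦ by positivity).trans_eq
    tsum_geometric_two

theorem sum_half_pow_sub_le (A : Finset ℕ) (l : ℕ) :
    ∑ a ∈ A with l ≤ a, (1 / 2 : ℝ) ^ (a - l) ≤ 2 := by
  classical
  have : Set.InjOn (fun a ↦ a - l) (A.filter fun a ↦ l ≤ a) := by
    intro a ha b hb h
    have h1 := (Finset.mem_filter.1 ha).2
    have h2 := (Finset.mem_filter.1 hb).2
    simp only at h
    omega
  rw [← Finset.sum_image (f := fun n : ℕ ↦ (1 / 2 : ℝ) ^ n) this]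
  exact sum_half_pow_le _

theorem sum_half_pow_sub_le' (A : Finset ℕ) (l : ℕ) :
    ∑ a ∈ A with a ≤ l, (1 / 2 : ℝ) ^ (l - a) ≤ 2 := by
  classical
  have : Set.InjOn (fun a ↦ l - a) (A.filter fun a ↦ a ≤ l) := by
    intro a ha b hb h
    have h1 := (Finset.mem_filter.1 ha).2
    have h2 := (Finset.mem_filter.1 hb).2
    simp only at h
    omega
  rw [← Finset.sum_image (f := fun n : ℕ ↦ (1 / 2 : ℝ) ^ n) this]
  exact sum_half_pow_le _

/-- The points of level at most `a`. -/
def sublevel (S : Finset (ℤ × ℤ)) (lev : ℤ × ℤ → ℕ) (a : ℕ) : Finset (ℤ × ℤ) :=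
  S.filter fun x ↦ lev x ≤ a

/-- Neither the line through `x` with normal `d` nor its perpendicular is very rich in the
superlevel set of `x`. -/
def IsPoorAt (S : Finset (ℤ × ℤ)) (lev : ℤ × ℤ → ℕ) (d x : ℤ × ℤ) : Prop :=
  lineCount (sublevel S lev (lev x)) d x ^ 2 ≤ 4 * (sublevel S lev (lev x)).card ∧
    lineCount (sublevel S lev (lev x)) (latticeRot d) x ^ 2 ≤ 4 * (sublevel S lev (lev x)).card

/-- The normalized size of the points of level at most `a`. -/
noncomputable def levelMass (S : Finset (ℤ × ℤ)) (lev : ℤ × ℤ → ℕ) (a : ℕ) : ℝ :=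
  (1 / 256) ^ a * (sublevel S lev a).card

theorem levelMass_nonneg (S : Finset (ℤ × ℤ)) (lev : ℤ × ℤ → ℕ) (a : ℕ) :
    0 ≤ levelMass S lev a := by unfold levelMass; positivity

section Levels

variable {S : Finset (ℤ × ℤ)} {lev : ℤ × ℤ → ℕ} {c : ℤ × ℤ → ℝ}

/-- A point is counted at its own level and all higher ones; the geometric series is comparable to
its first term 256^{-lev x}, hence to c(x)². -/
theorem sum_levelMass_le (A : Finset ℕ)
    (h2 : ∀ x ∈ S, (1 / 16 : ℝ) ^ (lev x + 1) < c x) :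
    ∑ a ∈ A, levelMass S lev a ≤ 512 * ∑ x ∈ S, c x ^ 2 := by
  have e1 : ∀ a, levelMass S lev a = ∑ x ∈ S, if lev x ≤ a then (1 / 256 : ℝ) ^ a else 0 := by
    intro a
    rw [levelMass, sublevel, ← Finset.sum_filter, Finset.sum_const, nsmul_eq_mul, mul_comm]
  simp only [e1]
  rw [Finset.sum_comm, Finset.mul_sum]
  refine Finset.sum_le_sum fun x hx ↦ ?_
  rw [← Finset.sum_filter]
  calc ∑ a ∈ A with lev x ≤ a, (1 / 256 : ℝ) ^ a
      ≤ ∑ a ∈ A with lev x ≤ a, (1 / 256 : ℝ) ^ lev x * (1 / 2) ^ (a - lev x) := by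
        refine Finset.sum_le_sum fun a ha ↦ ?_
        have h := (Finset.mem_filter.1 ha).2
        conv_lhs => rw [← Nat.add_sub_cancel' h, pow_add]
        gcongr
        norm_num
    _ ≤ (1 / 256 : ℝ) ^ lev x * 2 := by
        rw [← Finset.mul_sum]
        gcongr
        exact sum_half_pow_sub_le _ _
    _ ≤ 512 * c x ^ 2 := by
        have h3 : ((1 / 16 : ℝ) ^ (lev x + 1)) ^ 2 ≤ c x ^ 2 := by
          have := (h2 x hx).le
          gcongr
        have h4 : ((1 / 16 : ℝ) ^ (lev x + 1)) ^ 2 = (1 / 256) ^ lev x * (1 / 256) := by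
          rw [show (1 / 256 : ℝ) = (1 / 16) ^ 2 by norm_num, ← pow_mul, ← pow_mul, ← pow_add]
          congr 1; ring
        rw [h4] at h3
        linarith

theorem sq_le_of_le_level (h0 : ∀ x ∈ S, 0 < c x) (h1 : ∀ x ∈ S, c x ≤ (1 / 16) ^ lev x)
    {x : ℤ × ℤ} (hx : x ∈ S) : c x ^ 2 ≤ (1 / 256) ^ lev x := by
  calc c x ^ 2 ≤ ((1 / 16 : ℝ) ^ lev x) ^ 2 := by
        have := h1 x hx
        have := (h0 x hx).le
        gcongr
    _ = _ := by rw [← pow_mul, mul_comm, pow_mul]; norm_num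

open Classical in
/-- The pairs (direction, point) at which a line is very rich. -/
noncomputable def richPairs (S : Finset (ℤ × ℤ)) (lev : ℤ × ℤ → ℕ) :
    Finset ((ℤ × ℤ) × (ℤ × ℤ)) :=
  (directions S ×ˢ S).filter fun b ↦ ¬ IsPoorAt S lev b.1 b.2

/-- At each level the incidences with very rich lines are linear in the number of points, for the
directions and for their rotations alike. Hence rich pairs cost no logarithm. -/
theorem sum_richPairs_le (h0 : ∀ x ∈ S, 0 < c x) (h1 : ∀ x ∈ S, c x ≤ (1 / 16) ^ lev x) :
    ∑ b ∈ richPairs S lev, c b.2 ^ 2 ≤ 4 * ∑ a ∈ S.image lev, levelMass S lev a := by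
  classical
  rw [← Finset.sum_fiberwise_of_maps_to (s := richPairs S lev) (g := fun b ↦ lev b.2) (t := S.image lev) fun b hb ↦
    Finset.mem_image_of_mem _ (Finset.mem_product.1 (Finset.mem_filter.1 hb).1).2, Finset.mul_sum]
  refine Finset.sum_le_sum fun a _ ↦ ?_
  set E := sublevel S lev a with hE
  have hD := isDirectionSet_directions S
  have hcard : ((richPairs S lev).filter fun b ↦ lev b.2 = a).card ≤ 4 * E.card := by
    have hsub : ((richPairs S lev).filter fun b ↦ lev b.2 = a) ⊆
        ((directions S ×ˢ E).filter fun p ↦ 4 * E.card < lineCount E p.1 p.2 ^ 2) ∪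
        ((directions S ×ˢ E).filter fun p ↦
          4 * E.card < lineCount E (latticeRot p.1) p.2 ^ 2) := by
      intro b hb
      obtain ⟨hb1, hb2⟩ := Finset.mem_filter.1 hb
      obtain ⟨hb3, hb4⟩ := Finset.mem_filter.1 hb1
      obtain ⟨hb5, hb6⟩ := Finset.mem_product.1 hb3
      have hmem : b ∈ directions S ×ˢ E :=
        Finset.mem_product.2 ⟨hb5, Finset.mem_filter.2 ⟨hb6, hb2.le⟩⟩
      rw [IsPoorAt, hb2, ← hE] at hb4
      rw [Finset.mem_union, Finset.mem_filter, Finset.mem_filter]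
      by_contra! hc
      exact hb4 ⟨hc.1 hmem, hc.2 hmem⟩
    refine (Finset.card_le_card hsub).trans ((Finset.card_union_le _ _).trans ?_)
    have r1 := hD.card_filter_rich_le E
    have r2 := hD.rot.card_filter_rich_le E
    have r3 : ((directions S ×ˢ E).filter fun p ↦
          4 * E.card < lineCount E (latticeRot p.1) p.2 ^ 2).card ≤
        (((directions S).image latticeRot ×ˢ E).filter fun p ↦
          4 * E.card < lineCount E p.1 p.2 ^ 2).card := by
      refine Finset.card_le_card_of_injOn (fun p ↦ (latticeRot p.1, p.2)) (fun p hp ↦ ?_) ?_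
      · obtain ⟨hp1, hp2⟩ := Finset.mem_filter.1 hp
        exact Finset.mem_filter.2 ⟨Finset.mk_mem_product
          (Finset.mem_image_of_mem _ (Finset.mem_product.1 hp1).1) (Finset.mem_product.1 hp1).2, hp2⟩
      · intro p _ q _ h
        exact Prod.ext (latticeRot_injective (Prod.mk_inj.1 h).1) (Prod.mk_inj.1 h).2
    omega
  have hterm : ∀ b ∈ (richPairs S lev).filter fun b ↦ lev b.2 = a, c b.2 ^ 2 ≤ (1 / 256) ^ a := by
    intro b hb
    obtain ⟨hb1, hb2⟩ := Finset.mem_filter.1 hb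
    rw [← hb2]
    exact sq_le_of_le_level h0 h1 (Finset.mem_product.1 (Finset.mem_filter.1 hb1).1).2
  calc _ ≤ (((richPairs S lev).filter fun b ↦ lev b.2 = a).card : ℝ) * (1 / 256) ^ a := by
        rw [← nsmul_eq_mul]; exact Finset.sum_le_card_nsmul _ _ _ hterm
    _ ≤ ((4 * E.card : ℕ) : ℝ) * (1 / 256) ^ a := by gcongr
    _ = 4 * levelMass S lev a := by rw [levelMass]; push_cast; ring

open Classical in
/-- The pairs whose first point has at most the level of the second, is not alone in its
column, and which meet no very rich line. -/
noncomputable def tamePairs (S : Finset (ℤ × ℤ)) (lev : ℤ × ℤ → ℕ) (a b : ℕ) :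
    Finset ((ℤ × ℤ) × (ℤ × ℤ)) :=
  S.offDiag.filter fun p ↦ lev p.1 = a ∧ lev p.2 = b ∧
    IsPoorAt S lev (latticeDir (p.2 - p.1)) p.1 ∧ IsPoorAt S lev (latticeDir (p.2 - p.1)) p.2 ∧
    2 ≤ lineCount (sublevel S lev a) (latticeDir (p.2 - p.1)) p.1

/-- The weight with which the levels `a ≤ b` enter. -/
noncomputable def levelWeight (S : Finset (ℤ × ℤ)) (lev : ℤ × ℤ → ℕ) (a b : ℕ) : ℝ :=
  (1 / 2) ^ (b - a) * (levelMass S lev a + levelMass S lev b)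

-- Let n = b - a. The coefficients contribute 256^{-a} 256^{-b}, and l = 64ⁿ turns the two terms of
-- the rectangle count into 4^{-n} and 16^{-n} times squared level masses. Any base strictly between
-- 16 and 256 makes both decay.
open Classical in
theorem rectForm_tamePairs_le (h0 : ∀ x ∈ S, 0 < c x) (h1 : ∀ x ∈ S, c x ≤ (1 / 16) ^ lev x)
    {M : ℝ} (hM : 0 ≤ M) {a b : ℕ} (hab : a ≤ b) :
    rectForm M S (fun p ↦ if p ∈ tamePairs S lev a b then c p.1 * c p.2 else 0) ≤
      320000 * (M + Nat.log 2 S.card) * levelWeight S lev a b ^ 2 := by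
  set Q := tamePairs S lev a b with hQ
  set E := sublevel S lev a with hE
  set F := sublevel S lev b with hF
  have hEF : E ⊆ F := fun x hx ↦ by
    obtain ⟨hx1, hx2⟩ := Finset.mem_filter.1 hx
    exact Finset.mem_filter.2 ⟨hx1, hx2.trans hab⟩
  have hcount := sum_rectangles_le (S := S) (E := E) (F := F) hEF hM
    (l := 64 ^ (b - a)) (Nat.one_le_pow' _ _) Q (by
      intro p hp
      obtain ⟨hp1, hp2, hp3, hp4, hp5, hp6⟩ := Finset.mem_filter.1 hp
      have hS := Finset.mem_offDiag.1 hp1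
      rw [IsPoorAt, hp2] at hp4
      rw [IsPoorAt, hp3] at hp5
      refine ⟨hp1, Finset.mem_filter.2 ⟨hS.2.1, hp3.le⟩, Finset.mem_filter.2
        ⟨Finset.mk_mem_product (latticeDir_mem_directions hp1)
          (Finset.mem_filter.2 ⟨hS.1, hp2.le⟩), ⟨hp6, hp4.1⟩, hp4.2, ?_⟩⟩
      have : lineCount F (latticeRot (latticeDir (p.2 - p.1))) p.1 =
          lineCount F (latticeRot (latticeDir (p.2 - p.1))) p.2 :=
        lineCount_congr (latticeDot_rot_dir_eq (ne_zero_of_mem_offDiag hp1)).symm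
      simp only [this]
      exact hp5.2)
  have hval : ∀ p ∈ Q, 0 ≤ c p.1 * c p.2 ∧ c p.1 * c p.2 ≤ (1 / 16) ^ a * (1 / 16) ^ b := by
    intro p hp
    obtain ⟨hp1, hp2, hp3, -⟩ := Finset.mem_filter.1 hp
    have hS := Finset.mem_offDiag.1 hp1
    have l1 := h0 _ hS.1
    have l2 := h0 _ hS.2.1
    have l3 := h1 _ hS.1
    have l4 := h1 _ hS.2.1
    rw [hp2] at l3
    rw [hp3] at l4
    exact ⟨by positivity, by gcongr⟩
  have hQS : Q ⊆ S.offDiag := Finset.filter_subset _ _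
  have hform : rectForm M S (fun p ↦ if p ∈ Q then c p.1 * c p.2 else 0) ≤
      ((1 / 256) ^ a * (1 / 256) ^ b) *
        ∑ p ∈ Q, ∑ q ∈ Q with pairKey p = pairKey q, gcdWeight M (p.2 - p.1) := by
    have e1 : rectForm M S (fun p ↦ if p ∈ Q then c p.1 * c p.2 else 0) =
        ∑ p ∈ Q, ∑ q ∈ Q with pairKey p = pairKey q,
          gcdWeight M (p.2 - p.1) * ((c p.1 * c p.2) * (c q.1 * c q.2)) := by
      rw [rectForm, ← Finset.sum_subset hQS]
      · refine Finset.sum_congr rfl fun p hp ↦ ?_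
        simp only [Finset.sum_filter]
        rw [← Finset.sum_subset hQS]
        · exact Finset.sum_congr rfl fun q hq ↦ by simp [hp, hq]
        · intro q _ hq
          simp [hq]
      · intro p _ hp
        simp [hp]
    rw [e1, Finset.mul_sum]
    refine Finset.sum_le_sum fun p hp ↦ ?_
    rw [Finset.mul_sum]
    refine Finset.sum_le_sum fun q hq ↦ ?_
    have hq' := (Finset.mem_filter.1 hq).1
    have e2 : ((1 / 256 : ℝ) ^ a * (1 / 256) ^ b) =
        ((1 / 16) ^ a * (1 / 16) ^ b) * ((1 / 16) ^ a * (1 / 16) ^ b) := by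
      have hpow : ∀ n : ℕ, (1 / 256 : ℝ) ^ n = (1 / 16) ^ n * (1 / 16) ^ n := fun n ↦ by
        rw [← mul_pow]; norm_num
      rw [hpow, hpow]; ring
    rw [mul_comm, e2]
    refine mul_le_mul_of_nonneg_right ?_ (gcdWeight_nonneg hM _)
    exact mul_le_mul (hval p hp).2 (hval q hq').2 (hval q hq').1 (by positivity)
  refine hform.trans ?_
  have hlog : (Nat.log 2 F.card : ℝ) ≤ Nat.log 2 S.card := by
    exact_mod_cast Nat.log_mono_right (Finset.card_le_card (Finset.filter_subset _ _))
  obtain ⟨n, rfl⟩ := Nat.exists_eq_add_of_le hab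
  rw [Nat.add_sub_cancel_left] at hcount
  set X := levelMass S lev a with hX
  set Y := levelMass S lev (a + n) with hY
  have hX0 : 0 ≤ X := levelMass_nonneg _ _ _
  have hY0 : 0 ≤ Y := levelMass_nonneg _ _ _
  have i1 : ((1 / 256 : ℝ) ^ a * (1 / 256) ^ (a + n)) * ((64 ^ n : ℕ) * (E.card : ℝ) ^ 2) =
      (1 / 4) ^ n * X ^ 2 := by
    rw [hX, levelMass, ← hE]
    have : (1 / 4 : ℝ) ^ n = (1 / 256) ^ n * 64 ^ n := by rw [← mul_pow]; norm_num
    rw [this]; push_cast; ring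
  have i2 : ((1 / 256 : ℝ) ^ a * (1 / 256) ^ (a + n)) * ((F.card : ℝ) ^ 2 / (64 ^ n : ℕ) ^ 2) =
      (1 / 16) ^ n * Y ^ 2 := by
    rw [hY, levelMass, ← hF]
    have h4096 : ((64 ^ n : ℕ) : ℝ) ^ 2 = 4096 ^ n := by
      push_cast; rw [← pow_mul, mul_comm, pow_mul]; norm_num
    rw [h4096]
    have : (1 / 16 : ℝ) ^ n = 256 ^ n / 4096 ^ n := by rw [← div_pow]; norm_num
    rw [this]
    have h1 : (1 / 256 : ℝ) ^ n * 256 ^ n = 1 := by rw [← mul_pow]; norm_num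
    field_simp
    linear_combination (-(1 / 256 : ℝ) ^ a * (F.card : ℝ) ^ 2) * h1
  have hle : (1 / 16 : ℝ) ^ n ≤ (1 / 4) ^ n := by gcongr; norm_num
  calc _ ≤ ((1 / 256 : ℝ) ^ a * (1 / 256) ^ (a + n)) * (320000 * (M + Nat.log 2 F.card) *
        ((64 ^ n : ℕ) * (E.card : ℝ) ^ 2 + (F.card : ℝ) ^ 2 / (64 ^ n : ℕ) ^ 2)) := by gcongr
    _ = 320000 * (M + Nat.log 2 F.card) * ((1 / 4) ^ n * X ^ 2 + (1 / 16) ^ n * Y ^ 2) := by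
        rw [← i1, ← i2]; ring
    _ ≤ 320000 * (M + Nat.log 2 S.card) * ((1 / 4) ^ n * (X + Y) ^ 2) := by
        gcongr
        nlinarith [mul_le_mul_of_nonneg_right hle (sq_nonneg Y), mul_nonneg hX0 hY0,
          mul_nonneg (pow_nonneg (show (0 : ℝ) ≤ 1 / 4 by norm_num) n) (mul_nonneg hX0 hY0)]
    _ = _ := by
        rw [levelWeight, ← hX, ← hY, mul_pow, Nat.add_sub_cancel_left, ← pow_mul, mul_comm n 2,
          pow_mul, show (1 / 2 : ℝ) ^ 2 = 1 / 4 by norm_num]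

theorem sum_levelWeight_le (A : Finset ℕ) :
    ∑ t ∈ A ×ˢ A with t.1 ≤ t.2, levelWeight S lev t.1 t.2 ≤ 4 * ∑ a ∈ A, levelMass S lev a := by
  have h1 : ∑ t ∈ A ×ˢ A with t.1 ≤ t.2, (1 / 2 : ℝ) ^ (t.2 - t.1) * levelMass S lev t.1 ≤
      2 * ∑ a ∈ A, levelMass S lev a := by
    rw [Finset.sum_filter, Finset.sum_product, Finset.mul_sum]
    refine Finset.sum_le_sum fun a _ ↦ ?_
    dsimp only
    rw [← Finset.sum_filter, ← Finset.sum_mul]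
    exact mul_le_mul_of_nonneg_right (sum_half_pow_sub_le A a) (levelMass_nonneg _ _ _)
  have h2 : ∑ t ∈ A ×ˢ A with t.1 ≤ t.2, (1 / 2 : ℝ) ^ (t.2 - t.1) * levelMass S lev t.2 ≤
      2 * ∑ a ∈ A, levelMass S lev a := by
    rw [Finset.sum_filter, Finset.sum_product_right, Finset.mul_sum]
    refine Finset.sum_le_sum fun a _ ↦ ?_
    dsimp only
    rw [← Finset.sum_filter, ← Finset.sum_mul]
    exact mul_le_mul_of_nonneg_right (sum_half_pow_sub_le' A a) (levelMass_nonneg _ _ _)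
  simp only [levelWeight, mul_add, Finset.sum_add_distrib]
  linarith

end Levels

/-- Up to reversal, every pair is of one of three kinds: its first point is on a very rich line
(`B`); its first point has the smaller level and is alone in its column, which makes the form
diagonal (`Lo`); or it is tame (`N`), where rectangle counting applies for each pair of levels. -/
theorem rectForm_le_of_le_one {S : Finset (ℤ × ℤ)} {c : ℤ × ℤ → ℝ} (h0 : ∀ x ∈ S, 0 < c x)
    (h1 : ∀ x ∈ S, c x ≤ 1) {M : ℝ} (hM : 0 ≤ M) :
    rectForm M S (fun p ↦ c p.1 * c p.2) ≤
      10 ^ 14 * (M + 1 + Nat.log 2 S.card) * (∑ x ∈ S, c x ^ 2) ^ 2 := by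
  classical
  have hlev : ∀ x ∈ S, ∃ n : ℕ, (1 / 16 : ℝ) ^ (n + 1) < c x ∧ c x ≤ (1 / 16) ^ n := fun x hx ↦
    exists_nat_pow_near_of_lt_one (h0 x hx) (h1 x hx) (by norm_num) (by norm_num)
  choose! lev hl2 hl1 using hlev
  set X := ∑ x ∈ S, c x ^ 2 with hX
  have hX0 : 0 ≤ X := Finset.sum_nonneg fun _ _ ↦ sq_nonneg _
  set A := S.image lev with hA
  set W := ∑ a ∈ A, levelMass S lev a with hW
  have hWX : W ≤ 512 * X := sum_levelMass_le A hl2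
  have hW0 : 0 ≤ W := Finset.sum_nonneg fun _ _ ↦ levelMass_nonneg _ _ _
  let B : (ℤ × ℤ) × (ℤ × ℤ) → ℝ := fun p ↦
    if (latticeDir (p.2 - p.1), p.1) ∈ richPairs S lev then c p.1 * c p.2 else 0
  let Lo : (ℤ × ℤ) × (ℤ × ℤ) → ℝ := fun p ↦ if lev p.1 ≤ lev p.2 ∧
    lineCount (sublevel S lev (lev p.1)) (latticeDir (p.2 - p.1)) p.1 ≤ 1
    then c p.1 * c p.2 else 0
  let T : Finset (ℕ × ℕ) := (A ×ˢ A).filter fun t ↦ t.1 ≤ t.2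
  let f : ℕ × ℕ → (ℤ × ℤ) × (ℤ × ℤ) → ℝ := fun t p ↦
    if p ∈ tamePairs S lev t.1 t.2 then c p.1 * c p.2 else 0
  let N : (ℤ × ℤ) × (ℤ × ℤ) → ℝ := fun p ↦ ∑ t ∈ T, f t p
  have hpos : ∀ p ∈ S.offDiag, 0 ≤ c p.1 * c p.2 := fun p hp ↦ by
    have := Finset.mem_offDiag.1 hp
    have := h0 _ this.1
    have := h0 _ (Finset.mem_offDiag.1 hp).2.1
    positivity
  have hB : rectForm M S B ≤ (1 + M) * (2048 * X * X) := by
    refine (rectForm_le_of_exceptional hM (c := c) (richPairs S lev) fun p hp ↦ ?_).trans ?_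
    · by_cases h : (latticeDir (p.2 - p.1), p.1) ∈ richPairs S lev
      · right; exact ⟨if_pos h, h⟩
      · left; exact if_neg h
    · have := sum_richPairs_le h0 hl1
      gcongr
      linarith
  have hLo : rectForm M S Lo ≤ (1 + M) * X ^ 2 := by
    refine (rectForm_le_of_unique hM ?_).trans ?_
    -- The first point of lower level belongs to the other one's column, in which that one is alone;
    -- so the first points agree, and with them the pairs.
    · have key : ∀ p ∈ S.offDiag, ∀ q ∈ S.offDiag, pairKey p = pairKey q → Lo p ≠ 0 → Lo q ≠ 0 →
          lev p.1 ≤ lev q.1 → p = q := by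
        intro p hp q hq hpq hp0 hq0 hle
        have hq1 := (ite_ne_right_iff.1 hq0).1.2
        obtain ⟨k1, k2⟩ := pairKey_eq_iff.1 hpq
        have hmem : ∀ z ∈ S, lev z ≤ lev q.1 → latticeDot (latticeDir (q.2 - q.1)) z =
            latticeDot (latticeDir (q.2 - q.1)) q.1 → z ∈ (sublevel S lev (lev q.1)).filter
              fun z ↦ latticeDot (latticeDir (q.2 - q.1)) z =
                latticeDot (latticeDir (q.2 - q.1)) q.1 :=
          fun z hz h1 h2 ↦ Finset.mem_filter.2 ⟨Finset.mem_filter.2 ⟨hz, h1⟩, h2⟩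
        have e := Finset.card_le_one.1 hq1 _
          (hmem p.1 (Finset.mem_offDiag.1 hp).1 hle
            (latticeDot_dir_eq (ne_zero_of_mem_offDiag hq) (by rw [← k1]; exact k2)))
          _ (hmem q.1 (Finset.mem_offDiag.1 hq).1 le_rfl rfl)
        rw [e] at k1
        exact Prod.ext e (sub_left_injective k1)
      intro p hp q hq hpq hp0 hq0
      rcases le_total (lev p.1) (lev q.1) with h | h
      · exact key p hp q hq hpq hp0 hq0 h
      · exact (key q hq p hp hpq.symm hq0 hp0 h).symm
    · refine mul_le_mul_of_nonneg_left ?_ (by linarith)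
      calc ∑ p ∈ S.offDiag, Lo p ^ 2 ≤ ∑ p ∈ S.offDiag, c p.1 ^ 2 * c p.2 ^ 2 := by
            refine Finset.sum_le_sum fun p _ ↦ ?_
            by_cases h : lev p.1 ≤ lev p.2 ∧
              lineCount (sublevel S lev (lev p.1)) (latticeDir (p.2 - p.1)) p.1 ≤ 1
            · simp only [Lo, if_pos h, mul_pow, le_refl]
            · simp only [Lo, if_neg h]
              rw [zero_pow two_ne_zero]; positivity
        _ ≤ ∑ p ∈ S ×ˢ S, c p.1 ^ 2 * c p.2 ^ 2 :=
            Finset.sum_le_sum_of_subset_of_nonneg (fun p hp ↦ Finset.mem_product.2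
              ⟨(Finset.mem_offDiag.1 hp).1, (Finset.mem_offDiag.1 hp).2.1⟩) fun _ _ _ ↦ by positivity
        _ = X ^ 2 := by rw [sq, hX, Finset.sum_mul_sum, Finset.sum_product]
  have hN : rectForm M S N ≤ 320000 * (M + Nat.log 2 S.card) * (4 * W) ^ 2 := by
    have hθ : ∀ t ∈ T, 0 < levelWeight S lev t.1 t.2 := by
      intro t ht
      have hA1 := (Finset.mem_product.1 (Finset.mem_filter.1 ht).1).1
      obtain ⟨x, hx, hxt⟩ := Finset.mem_image.1 hA1
      have hc : 0 < (sublevel S lev t.1).card :=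
        Finset.card_pos.2 ⟨x, Finset.mem_filter.2 ⟨hx, hxt.le⟩⟩
      have : 0 < levelMass S lev t.1 := by unfold levelMass; positivity
      have := levelMass_nonneg S lev t.2
      unfold levelWeight
      positivity
    -- With θ the level weights each quotient is again a multiple of θ, so the total is the square
    -- of Σθ.
    refine (rectForm_sum_le hM S T f _ hθ).trans ?_
    have h2 : ∑ t ∈ T, rectForm M S (f t) / levelWeight S lev t.1 t.2 ≤
        ∑ t ∈ T, 320000 * (M + Nat.log 2 S.card) * levelWeight S lev t.1 t.2 := by
      refine Finset.sum_le_sum fun t ht ↦ ?_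
      rw [div_le_iff₀ (hθ t ht)]
      have := rectForm_tamePairs_le h0 hl1 hM (Finset.mem_filter.1 ht).2
      linarith
    rw [← Finset.mul_sum] at h2
    have h3 : ∑ t ∈ T, levelWeight S lev t.1 t.2 ≤ 4 * W := sum_levelWeight_le A
    have h4 : 0 ≤ ∑ t ∈ T, levelWeight S lev t.1 t.2 :=
      Finset.sum_nonneg fun t ht ↦ (hθ t ht).le
    calc _ ≤ (∑ t ∈ T, levelWeight S lev t.1 t.2) * (320000 * (M + Nat.log 2 S.card) *
          ∑ t ∈ T, levelWeight S lev t.1 t.2) := mul_le_mul_of_nonneg_left h2 h4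
      _ = 320000 * (M + Nat.log 2 S.card) * (∑ t ∈ T, levelWeight S lev t.1 t.2) ^ 2 := by ring
      _ ≤ _ := by gcongr
  let g : (ℤ × ℤ) × (ℤ × ℤ) → ℝ := fun p ↦ B p + (Lo p + N p)
  have hN0 : ∀ p ∈ S.offDiag, ∀ t, 0 ≤ f t p := fun p hp t ↦ by
    by_cases h : p ∈ tamePairs S lev t.1 t.2
    · simp only [f, if_pos h, hpos p hp]
    · simp only [f, if_neg h, le_refl]
  have hB0 : ∀ p ∈ S.offDiag, 0 ≤ B p := fun p hp ↦ by
    by_cases h : (latticeDir (p.2 - p.1), p.1) ∈ richPairs S lev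
    · simp only [B, if_pos h, hpos p hp]
    · simp only [B, if_neg h, le_refl]
  have hLo0 : ∀ p ∈ S.offDiag, 0 ≤ Lo p := fun p hp ↦ by
    by_cases h : lev p.1 ≤ lev p.2 ∧
      lineCount (sublevel S lev (lev p.1)) (latticeDir (p.2 - p.1)) p.1 ≤ 1
    · simp only [Lo, if_pos h, hpos p hp]
    · simp only [Lo, if_neg h, le_refl]
  have hg0 : ∀ p ∈ S.offDiag, 0 ≤ g p := fun p hp ↦
    add_nonneg (hB0 p hp) (add_nonneg (hLo0 p hp) (Finset.sum_nonneg fun t _ ↦ hN0 p hp t))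
  have hswap : ∀ p ∈ S.offDiag, p.swap ∈ S.offDiag := fun p hp ↦ by
    simp only [Finset.mem_offDiag, Prod.fst_swap, Prod.snd_swap] at hp ⊢; tauto
  have hcov : ∀ p ∈ S.offDiag, IsPoorAt S lev (latticeDir (p.2 - p.1)) p.2 →
      lev p.1 ≤ lev p.2 → c p.1 * c p.2 ≤ g p := by
    intro p hp hpoor hle
    have hpS := Finset.mem_offDiag.1 hp
    have n1 := hB0 p hp
    have n2 := hLo0 p hp
    have n3 : 0 ≤ N p := Finset.sum_nonneg fun t _ ↦ hN0 p hp t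
    by_cases c1 : (latticeDir (p.2 - p.1), p.1) ∈ richPairs S lev
    · have : B p = c p.1 * c p.2 := if_pos c1
      simp only [g]; linarith
    by_cases c2 : lineCount (sublevel S lev (lev p.1)) (latticeDir (p.2 - p.1)) p.1 ≤ 1
    · have : Lo p = c p.1 * c p.2 := if_pos ⟨hle, c2⟩
      simp only [g]; linarith
    have c3 : IsPoorAt S lev (latticeDir (p.2 - p.1)) p.1 := by
      by_contra hc
      exact c1 (Finset.mem_filter.2
        ⟨Finset.mk_mem_product (latticeDir_mem_directions hp) hpS.1, hc⟩)
    have c4 : p ∈ tamePairs S lev (lev p.1) (lev p.2) :=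
      Finset.mem_filter.2 ⟨hp, rfl, rfl, c3, hpoor, by omega⟩
    have c5 : f (lev p.1, lev p.2) p = c p.1 * c p.2 := if_pos c4
    have c6 : f (lev p.1, lev p.2) p ≤ N p :=
      Finset.single_le_sum (f := fun t ↦ f t p) (fun t _ ↦ hN0 p hp t)
        (Finset.mem_filter.2 ⟨Finset.mk_mem_product (Finset.mem_image_of_mem _ hpS.1)
          (Finset.mem_image_of_mem _ hpS.2.1), hle⟩)
    simp only [g]; linarith
  have hdir : ∀ p ∈ S.offDiag, latticeDir (p.swap.2 - p.swap.1) = latticeDir (p.2 - p.1) := by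
    intro p hp
    rw [← latticeDir_neg (ne_zero_of_mem_offDiag hp), neg_sub]; rfl
  have hrich : ∀ p ∈ S.offDiag, ¬ IsPoorAt S lev (latticeDir (p.2 - p.1)) p.1 →
      c p.1 * c p.2 ≤ g p := by
    intro p hp hc
    have n2 := hLo0 p hp
    have n3 : 0 ≤ N p := Finset.sum_nonneg fun t _ ↦ hN0 p hp t
    have : B p = c p.1 * c p.2 := if_pos (Finset.mem_filter.2
      ⟨Finset.mk_mem_product (latticeDir_mem_directions hp) (Finset.mem_offDiag.1 hp).1, hc⟩)
    simp only [g]; linarith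
  -- Orient the pair so that a rich endpoint comes first or, if there is none, the endpoint of lower
  -- level.
  have hle : ∀ p ∈ S.offDiag, c p.1 * c p.2 ≤ g p + g p.swap := by
    intro p hp
    have m1 := hg0 p hp
    have m2 := hg0 _ (hswap p hp)
    by_cases c1 : IsPoorAt S lev (latticeDir (p.2 - p.1)) p.1
    · by_cases c2 : IsPoorAt S lev (latticeDir (p.2 - p.1)) p.2
      · rcases le_total (lev p.1) (lev p.2) with h | h
        · have := hcov p hp c2 h
          linarith
        · have := hcov p.swap (hswap p hp) (by rw [hdir p hp]; exact c1) h
          simp only [Prod.fst_swap, Prod.snd_swap] at this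
          linarith
      · have := hrich p.swap (hswap p hp) (by rw [hdir p hp]; exact c2)
        simp only [Prod.fst_swap, Prod.snd_swap] at this
        linarith
    · have := hrich p hp c1
      linarith
  have s1 := rectForm_mono hM (f := fun p ↦ c p.1 * c p.2) hpos hle
  have s2 := rectForm_add_le hM S g fun p ↦ g p.swap
  rw [rectForm_swap] at s2
  have s3 := rectForm_add_le hM S B fun p ↦ Lo p + N p
  have s4 := rectForm_add_le hM S Lo N
  have hl0 : (0 : ℝ) ≤ Nat.log 2 S.card := Nat.cast_nonneg _
  have hN' : rectForm M S N ≤ 320000 * (M + Nat.log 2 S.card) * (4 * (512 * X)) ^ 2 :=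
    hN.trans (by gcongr)
  have t1 : 0 ≤ M * X ^ 2 := by positivity
  have t2 : 0 ≤ Nat.log 2 S.card * X ^ 2 := by positivity
  have t3 : 0 ≤ X ^ 2 := by positivity
  change rectForm M S g ≤ _ at s3
  -- The splittings cost 8 for `B` and 16 for `Lo` and `N`; the largest term is 16 · 320000 · 2048²
  -- < 10¹⁴.
  nlinarith

/-- The **rectangle inequality**: sums over rectangles in a finite subset of `ℤ²`, with weight
`1 + M / gcd` in one of the side lengths, lose only a logarithm. -/
theorem rectForm_le {S : Finset (ℤ × ℤ)} {c : ℤ × ℤ → ℝ} (h0 : ∀ x ∈ S, 0 ≤ c x)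
    {M : ℝ} (hM : 0 ≤ M) :
    rectForm M S (fun p ↦ c p.1 * c p.2) ≤
      10 ^ 14 * (M + 1 + Nat.log 2 S.card) * (∑ x ∈ S, c x ^ 2) ^ 2 := by
  classical
  -- Both sides are homogeneous of degree 4, so c may be scaled to be at most 1; points where c
  -- vanishes have no level and are dropped.
  obtain ⟨m, hm0, hm⟩ : ∃ m : ℝ, 0 < m ∧ ∀ x ∈ S, c x ≤ m := by
    refine ⟨1 + ∑ x ∈ S, c x, by linarith [Finset.sum_nonneg h0], fun x hx ↦ ?_⟩
    linarith [Finset.single_le_sum h0 hx]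
  set S' := S.filter fun x ↦ 0 < c x with hS'
  have hsub : S' ⊆ S := Finset.filter_subset _ _
  have key := rectForm_le_of_le_one (S := S') (c := fun x ↦ c x / m)
    (fun x hx ↦ div_pos (Finset.mem_filter.1 hx).2 hm0)
    (fun x hx ↦ (div_le_one hm0).2 (hm x (hsub hx))) hM
  have hz : ∀ x ∈ S, x ∉ S' → c x = 0 := fun x hx hx' ↦
    le_antisymm (not_lt.1 fun h ↦ hx' (Finset.mem_filter.2 ⟨hx, h⟩)) (h0 x hx)
  have hoff : S'.offDiag ⊆ S.offDiag := Finset.offDiag_mono hsub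
  have hz2 : ∀ p ∈ S.offDiag, p ∉ S'.offDiag → c p.1 * c p.2 = 0 := by
    intro p hp hp'
    obtain ⟨p1, p2, p3⟩ := Finset.mem_offDiag.1 hp
    by_cases q1 : p.1 ∈ S'
    · by_cases q2 : p.2 ∈ S'
      · exact absurd (Finset.mem_offDiag.2 ⟨q1, q2, p3⟩) hp'
      · rw [hz _ p2 q2, mul_zero]
    · rw [hz _ p1 q1, zero_mul]
  have e1 : rectForm M S (fun p ↦ c p.1 * c p.2) =
      m ^ 4 * rectForm M S' (fun p ↦ c p.1 / m * (c p.2 / m)) := by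
    rw [rectForm, rectForm, ← Finset.sum_subset hoff, Finset.mul_sum]
    · refine Finset.sum_congr rfl fun p hp ↦ ?_
      simp only [Finset.sum_filter]
      rw [← Finset.sum_subset hoff, Finset.mul_sum]
      · refine Finset.sum_congr rfl fun q hq ↦ ?_
        split_ifs
        · field_simp
        · simp
      · intro q hq hq'
        rw [hz2 q hq hq']; simp
    · intro p hp hp'
      rw [hz2 p hp hp']; simp
  have e2 : ∑ x ∈ S, c x ^ 2 = m ^ 2 * ∑ x ∈ S', (c x / m) ^ 2 := by
    rw [← Finset.sum_subset hsub, Finset.mul_sum]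
    · exact Finset.sum_congr rfl fun x _ ↦ by field_simp
    · intro x hx hx'
      rw [hz x hx hx']; simp
  have hlog : (Nat.log 2 S'.card : ℝ) ≤ Nat.log 2 S.card := by
    exact_mod_cast Nat.log_mono_right (Finset.card_le_card hsub)
  rw [e1, e2]
  calc _ ≤ m ^ 4 * (10 ^ 14 * (M + 1 + Nat.log 2 S'.card) * (∑ x ∈ S', (c x / m) ^ 2) ^ 2) := by
        gcongr
    _ ≤ m ^ 4 * (10 ^ 14 * (M + 1 + Nat.log 2 S.card) * (∑ x ∈ S', (c x / m) ^ 2) ^ 2) := by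
        gcongr
    _ = _ := by ring

/-! ### Fourier series on the torus. -/

theorem continuous_torusChar (k : ℤ × ℤ) : Continuous (torusChar k) := by
  unfold torusChar
  exact ((fourier k.1).continuous.comp continuous_fst).mul
    ((fourier k.2).continuous.comp continuous_snd)

theorem norm_torusChar (k : ℤ × ℤ) (x : Torus2) : ‖torusChar k x‖ = 1 := by
  simp only [torusChar, fourier_apply, norm_mul, Circle.norm_coe, one_mul]

theorem torusChar_mul (k l : ℤ × ℤ) (x : Torus2) :
    torusChar k x * torusChar l x = torusChar (k + l) x := by
  simp only [torusChar, Prod.fst_add, Prod.snd_add, fourier_add]; ring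

theorem conj_torusChar (k : ℤ × ℤ) (x : Torus2) : conj (torusChar k x) = torusChar (-k) x := by
  simp only [torusChar, map_mul, Prod.fst_neg, Prod.snd_neg, fourier_neg]

/-- A nontrivial character changes sign under a suitable translation, which preserves the integral.
-/
theorem integral_fourier_addCircle (n : ℤ) :
    ∫ x : AddCircle (2 * Real.pi), (fourier n x : ℂ) = if n = 0 then 2 * Real.pi else 0 := by
  split_ifs with hn
  · subst hn
    simp [Measure.real, AddCircle.measure_univ, Real.pi_pos.le]
  · have h : ∀ x : AddCircle (2 * Real.pi), (fourier n (x + ((2 * Real.pi / 2 / n : ℝ) : AddCircle (2 * Real.pi))) : ℂ) = -fourier n x :=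
      fun x ↦ fourier_add_half_inv_index hn Real.two_pi_pos x
    have h2 := integral_add_right_eq_self (μ := (volume : Measure (AddCircle (2 * Real.pi)))) (fun x ↦ (fourier n x : ℂ))
      ((2 * Real.pi / 2 / n : ℝ) : AddCircle (2 * Real.pi))
    simp only [h, integral_neg] at h2
    exact self_eq_neg.1 h2.symm

theorem integral_torusChar (k : ℤ × ℤ) :
    ∫ x : Torus2, torusChar k x = if k = 0 then ((2 * Real.pi) ^ 2 : ℂ) else 0 := by
  simp only [torusChar]
  rw [Measure.volume_eq_prod, integral_prod_mul (fun x ↦ (fourier k.1 x : ℂ))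
    (fun x ↦ (fourier k.2 x : ℂ)), integral_fourier_addCircle, integral_fourier_addCircle]
  by_cases h1 : k.1 = 0 <;> by_cases h2 : k.2 = 0 <;>
    simp [h1, h2, Prod.ext_iff, sq]

theorem integrable_torus_of_continuous {f : Torus2 → ℂ} (hf : Continuous f) : Integrable f :=
  hf.integrable_of_hasCompactSupport (HasCompactSupport.of_compactSpace f)

/-- Bessel's inequality on the torus. -/
theorem sum_sq_torusCoeff_le {f : Torus2 → ℂ} (hf : MemLp f 2 volume) (S : Finset (ℤ × ℤ)) :
    (2 * Real.pi) ^ 2 * ∑ k ∈ S, ‖torusCoeff f k‖ ^ 2 ≤ ∫ x, ‖f x‖ ^ 2 := by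
  set c : ℂ := (((2 * Real.pi) ^ 2 : ℝ) : ℂ) with hc
  have hc0 : c ≠ 0 := by rw [hc]; exact_mod_cast (by positivity : ((2 * Real.pi) ^ 2 : ℝ) ≠ 0)
  set a := torusCoeff f with ha
  let g : Torus2 → ℂ := fun x ↦ ∑ k ∈ S, a k * torusChar k x
  have hgc : Continuous g := continuous_finsetSum _ fun k _ ↦
    continuous_const.mul (continuous_torusChar k)
  have hfi : Integrable f := hf.integrable one_le_two
  have hcoef : ∀ k, ∫ x, conj (torusChar k x) * f x = c * a k := by
    intro k
    simp only [ha, torusCoeff, conj_torusChar]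
    rw [Complex.real_smul, ← mul_assoc, hc, ← Complex.ofReal_mul, mul_inv_cancel₀ (by positivity),
      Complex.ofReal_one, one_mul]
  have hchi : ∀ k, Integrable fun x ↦ conj (torusChar k x) * f x := by
    intro k
    refine hfi.bdd_mul (c := 1) ?_ ?_
    · exact (Complex.continuous_conj.comp (continuous_torusChar k)).aestronglyMeasurable
    · exact Filter.Eventually.of_forall fun x ↦ by simp [norm_torusChar]
  have h1 : ∫ x, conj (g x) * f x = c * ∑ k ∈ S, (‖a k‖ : ℂ) ^ 2 := by
    simp only [g, map_sum, map_mul, Finset.sum_mul, mul_assoc]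
    rw [integral_finsetSum _ fun k _ ↦ (hchi k).const_mul _]
    simp only [integral_const_mul, hcoef, Finset.mul_sum]
    refine Finset.sum_congr rfl fun k _ ↦ ?_
    rw [← Complex.conj_mul']; ring
  have h2 : ∫ x, conj (g x) * g x = c * ∑ k ∈ S, (‖a k‖ : ℂ) ^ 2 := by
    have e : ∀ x, conj (g x) * g x =
        ∑ k ∈ S, ∑ l ∈ S, (conj (a k) * a l) * torusChar (l - k) x := by
      intro x
      simp only [g, map_sum, map_mul, Finset.sum_mul_sum, conj_torusChar]
      refine Finset.sum_congr rfl fun k _ ↦ Finset.sum_congr rfl fun l _ ↦ ?_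
      rw [sub_eq_add_neg, ← torusChar_mul]; ring
    simp only [e]
    have hint : ∀ k l : ℤ × ℤ, Integrable fun x ↦ (conj (a k) * a l) * torusChar (l - k) x :=
      fun k l ↦ (integrable_torus_of_continuous (continuous_torusChar _)).const_mul _
    rw [integral_finsetSum _ fun k _ ↦ integrable_finsetSum _ fun l _ ↦ hint k l, Finset.mul_sum]
    refine Finset.sum_congr rfl fun k hk ↦ ?_
    rw [integral_finsetSum _ fun l _ ↦ hint k l]
    simp only [integral_const_mul, integral_torusChar, sub_eq_zero]
    rw [Finset.sum_eq_single k (fun l _ hl ↦ by simp [hl]) (fun h ↦ absurd hk h), if_pos rfl,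
      Complex.conj_mul', hc]
    push_cast; ring
  have hpt : ∀ x, ‖f x - g x‖ ^ 2 =
      ‖f x‖ ^ 2 - 2 * (conj (g x) * f x).re + (conj (g x) * g x).re := by
    intro x
    rw [← Complex.normSq_eq_norm_sq, ← Complex.normSq_eq_norm_sq, Complex.normSq_apply,
      Complex.normSq_apply]
    simp only [Complex.sub_re, Complex.sub_im, Complex.mul_re, Complex.conj_re, Complex.conj_im]
    ring
  have i1 : Integrable fun x ↦ ‖f x‖ ^ 2 := hf.integrable_norm_pow two_ne_zero
  have i2 : Integrable fun x ↦ conj (g x) * f x := by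
    simp only [g, map_sum, map_mul, Finset.sum_mul, mul_assoc]
    exact integrable_finsetSum _ fun k _ ↦ (hchi k).const_mul _
  have i3 : Integrable fun x ↦ conj (g x) * g x :=
    integrable_torus_of_continuous ((Complex.continuous_conj.comp hgc).mul hgc)
  have h3 : 0 ≤ ∫ x, ‖f x - g x‖ ^ 2 := integral_nonneg fun _ ↦ by positivity
  simp only [hpt] at h3
  have j2 : Integrable fun x ↦ 2 * (conj (g x) * f x).re := i2.re.const_mul 2
  have j3 : Integrable fun x ↦ (conj (g x) * g x).re := i3.re
  have j12 : Integrable fun x ↦ ‖f x‖ ^ 2 - 2 * (conj (g x) * f x).re := i1.sub j2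
  rw [integral_add j12 j3, integral_sub i1 j2, integral_const_mul] at h3
  have r1 : ∫ x, (conj (g x) * f x).re = (∫ x, conj (g x) * f x).re := integral_re i2
  have r2 : ∫ x, (conj (g x) * g x).re = (∫ x, conj (g x) * g x).re := integral_re i3
  have r3 : (c * ∑ k ∈ S, (‖a k‖ : ℂ) ^ 2).re = (2 * Real.pi) ^ 2 * ∑ k ∈ S, ‖a k‖ ^ 2 := by
    rw [hc, Complex.re_ofReal_mul]
    congr 1
    rw [← Complex.ofReal_re (∑ k ∈ S, ‖a k‖ ^ 2)]
    push_cast; rfl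
  rw [r1, r2, h1, h2, r3] at h3
  linarith

/-! ### The fourth power of the L⁴ norm in terms of key sums. -/

/-- The sum of `a_y conj a_x` over the pairs `(x, y)` with a given key. -/
noncomputable def keySum (S : Finset (ℤ × ℤ)) (a : ℤ × ℤ → ℂ) (κ : (ℤ × ℤ) × ℤ) : ℂ :=
  ∑ p ∈ S.offDiag with pairKey p = κ, a p.2 * conj (a p.1)

/-- The keys of pairs of distinct points. -/
def keys (S : Finset (ℤ × ℤ)) : Finset ((ℤ × ℤ) × ℤ) := S.offDiag.image pairKey

/-- The integrand is |u ū|², and orthogonality keeps the quadruples with equal differences. -/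
theorem integral_norm_pow_four_trig (S : Finset (ℤ × ℤ)) (b : ℤ × ℤ → ℂ) :
    ((∫ x : Torus2, ‖∑ k ∈ S, b k * torusChar k x‖ ^ 4 : ℝ) : ℂ) = (2 * Real.pi) ^ 2 *
      ∑ p ∈ S ×ˢ S, ∑ q ∈ S ×ˢ S with p.2 - p.1 = q.2 - q.1,
        (b p.2 * conj (b p.1)) * conj (b q.2 * conj (b q.1)) := by
  let β : (ℤ × ℤ) × (ℤ × ℤ) → ℂ := fun p ↦ b p.2 * conj (b p.1)
  have e1 : ∀ x, (∑ k ∈ S, b k * torusChar k x) * conj (∑ k ∈ S, b k * torusChar k x) =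
      ∑ p ∈ S ×ˢ S, β p * torusChar (p.2 - p.1) x := by
    intro x
    rw [map_sum, Finset.sum_mul_sum, Finset.sum_product_right]
    refine Finset.sum_congr rfl fun k _ ↦ Finset.sum_congr rfl fun l _ ↦ ?_
    simp only [β, map_mul, conj_torusChar]
    rw [sub_eq_add_neg, ← torusChar_mul]; ring
  have e2 : ∀ x, ((‖∑ k ∈ S, b k * torusChar k x‖ ^ 4 : ℝ) : ℂ) = ∑ p ∈ S ×ˢ S, ∑ q ∈ S ×ˢ S,
      β p * conj (β q) * torusChar ((p.2 - p.1) - (q.2 - q.1)) x := by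
    intro x
    have : ((‖∑ k ∈ S, b k * torusChar k x‖ ^ 4 : ℝ) : ℂ) =
        ((∑ k ∈ S, b k * torusChar k x) * conj (∑ k ∈ S, b k * torusChar k x)) *
        conj ((∑ k ∈ S, b k * torusChar k x) * conj (∑ k ∈ S, b k * torusChar k x)) := by
      generalize ∑ k ∈ S, b k * torusChar k x = z
      have hz : z * conj z = (‖z‖ : ℂ) ^ 2 := Complex.mul_conj' z
      rw [hz, map_pow, Complex.conj_ofReal]; push_cast; ring
    rw [this, e1, map_sum, Finset.sum_mul_sum]
    refine Finset.sum_congr rfl fun p _ ↦ Finset.sum_congr rfl fun q _ ↦ ?_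
    rw [map_mul, conj_torusChar, sub_eq_add_neg (p.2 - p.1), ← torusChar_mul]; ring
  rw [← integral_complex_ofReal]
  simp only [e2]
  have hint : ∀ p q : (ℤ × ℤ) × (ℤ × ℤ), Integrable fun x ↦
      β p * conj (β q) * torusChar ((p.2 - p.1) - (q.2 - q.1)) x :=
    fun p q ↦ (integrable_torus_of_continuous (continuous_torusChar _)).const_mul _
  rw [integral_finsetSum _ fun p _ ↦ integrable_finsetSum _ fun q _ ↦ hint p q, Finset.mul_sum]
  refine Finset.sum_congr rfl fun p _ ↦ ?_
  rw [integral_finsetSum _ fun q _ ↦ hint p q, Finset.sum_filter, Finset.mul_sum]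
  refine Finset.sum_congr rfl fun q _ ↦ ?_
  rw [integral_const_mul, integral_torusChar]
  by_cases h : p.2 - p.1 = q.2 - q.1
  · rw [if_pos (sub_eq_zero.2 h), if_pos h]; ring
  · rw [if_neg (mt sub_eq_zero.1 h), if_neg h]; ring

/-- The phase `e^{-iθ|k|²}`. -/
noncomputable def phase (θ : ℝ) (k : ℤ × ℤ) : ℂ :=
  Complex.exp (-Complex.I * θ * ((k.1 : ℂ) ^ 2 + (k.2 : ℂ) ^ 2))

theorem phase_eq (θ : ℝ) (k : ℤ × ℤ) :
    phase θ k = Complex.exp (((-θ * ((k.1 : ℝ) ^ 2 + (k.2 : ℝ) ^ 2) : ℝ) : ℂ) * Complex.I) := by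
  rw [phase]; congr 1; push_cast; ring

theorem norm_phase (θ : ℝ) (k : ℤ × ℤ) : ‖phase θ k‖ = 1 := by
  rw [phase_eq, Complex.norm_exp_ofReal_mul_I]

theorem conj_phase (θ : ℝ) (k : ℤ × ℤ) : conj (phase θ k) =
    Complex.exp (((θ * ((k.1 : ℝ) ^ 2 + (k.2 : ℝ) ^ 2) : ℝ) : ℂ) * Complex.I) := by
  rw [phase_eq, ← Complex.exp_conj, map_mul, Complex.conj_I, Complex.conj_ofReal]
  congr 1; push_cast; ring

/-- For pairs (x, x+v), (y, y+v) the squares in the phases cancel except for 2v·(x-y), which depends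
only on the two keys. Pairs with v = 0 carry no phase and give the first term. -/
theorem integral_norm_pow_four (S : Finset (ℤ × ℤ)) (a : ℤ × ℤ → ℂ) (θ : ℝ) :
    ((∫ x : Torus2, ‖∑ k ∈ S, phase θ k * a k * torusChar k x‖ ^ 4 : ℝ) : ℂ) =
      (2 * Real.pi) ^ 2 * ((∑ k ∈ S, (‖a k‖ : ℂ) ^ 2) ^ 2 +
        ∑ κ ∈ keys S, ∑ μ ∈ keys S with μ.1 = κ.1, keySum S a κ * conj (keySum S a μ) *
          Complex.exp (Complex.I * θ * ((-2 * (κ.2 - μ.2) : ℤ) : ℝ))) := by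
  classical
  rw [integral_norm_pow_four_trig S fun k ↦ phase θ k * a k]
  congr 1
  set β : (ℤ × ℤ) × (ℤ × ℤ) → ℂ := fun p ↦ phase θ p.2 * a p.2 * conj (phase θ p.1 * a p.1)
  have hS : S ×ˢ S = S.diag ∪ S.offDiag := (Finset.diag_union_offDiag S).symm
  have hd0 : ∀ p ∈ S.diag, p.2 - p.1 = 0 := fun p hp ↦ sub_eq_zero.2 (Finset.mem_diag.1 hp).2.symm
  have ho0 : ∀ p ∈ S.offDiag, p.2 - p.1 ≠ 0 := fun p hp ↦ ne_zero_of_mem_offDiag hp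
  have hdisj := Finset.disjoint_diag_offDiag S
  rw [hS, Finset.sum_union hdisj]
  simp only [Finset.filter_union]
  congr 1
  · have h1 : ∀ p ∈ S.diag, β p = (‖a p.1‖ : ℂ) ^ 2 := by
      intro p hp
      have : p.2 = p.1 := (Finset.mem_diag.1 hp).2.symm
      simp only [β, this]
      rw [Complex.mul_conj', norm_mul, norm_phase, one_mul]
    have h2 : ∑ p ∈ S.diag, β p = ∑ k ∈ S, (‖a k‖ : ℂ) ^ 2 := by
      rw [Finset.sum_congr rfl h1, Finset.sum_diag]
    rw [sq, ← h2]
    conv_rhs => rw [Finset.sum_mul]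
    refine Finset.sum_congr rfl fun p hp ↦ ?_
    have f1 : (S.diag.filter fun q ↦ p.2 - p.1 = q.2 - q.1) = S.diag :=
      Finset.filter_true_of_mem fun q hq ↦ by rw [hd0 p hp, hd0 q hq]
    have f2 : (S.offDiag.filter fun q ↦ p.2 - p.1 = q.2 - q.1) = ∅ :=
      Finset.filter_false_of_mem fun q hq h ↦ ho0 q hq (by rw [← h, hd0 p hp])
    rw [f1, f2, Finset.union_empty, Finset.mul_sum]
    refine Finset.sum_congr rfl fun q hq ↦ ?_
    rw [h1 q hq]
    congr 1
    change conj (β q) = _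
    rw [h1 q hq, map_pow, Complex.conj_ofReal]
  · have h3 : ∀ p ∈ S.offDiag, (S.diag.filter fun q ↦ p.2 - p.1 = q.2 - q.1) ∪
        (S.offDiag.filter fun q ↦ p.2 - p.1 = q.2 - q.1) =
        S.offDiag.filter fun q ↦ q.2 - q.1 = p.2 - p.1 := by
      intro p hp
      have f1 : (S.diag.filter fun q ↦ p.2 - p.1 = q.2 - q.1) = ∅ :=
        Finset.filter_false_of_mem fun q hq h ↦ ho0 p hp (by rw [h, hd0 q hq])
      rw [f1, Finset.empty_union]
      exact Finset.filter_congr fun q _ ↦ eq_comm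
    let α : (ℤ × ℤ) × (ℤ × ℤ) → ℂ := fun p ↦ a p.2 * conj (a p.1)
    let E : ℤ → ℂ := fun m ↦ Complex.exp (Complex.I * θ * ((-2 * m : ℤ) : ℝ))
    have h4 : ∀ p q : (ℤ × ℤ) × (ℤ × ℤ), q.2 - q.1 = p.2 - p.1 → β p * conj (β q) =
        α p * conj (α q) * E ((pairKey p).2 - (pairKey q).2) := by
      intro p q hpq
      have e1 : phase θ p.2 * conj (phase θ p.1) * conj (phase θ q.2 * conj (phase θ q.1)) =
          E ((pairKey p).2 - (pairKey q).2) := by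
        rw [map_mul, Complex.conj_conj]
        rw [conj_phase, conj_phase, phase_eq, phase_eq, ← Complex.exp_add, ← Complex.exp_add,
          ← Complex.exp_add]
        simp only [E]
        congr 1
        simp only [pairKey, latticeDot, Prod.ext_iff, Prod.fst_sub, Prod.snd_sub] at hpq ⊢
        have q1 : (q.2.1 : ℂ) = q.1.1 + (p.2.1 - p.1.1) := by
          have : q.2.1 = q.1.1 + (p.2.1 - p.1.1) := by linarith [hpq.1]
          exact_mod_cast this
        have q2 : (q.2.2 : ℂ) = q.1.2 + (p.2.2 - p.1.2) := by
          have : q.2.2 = q.1.2 + (p.2.2 - p.1.2) := by linarith [hpq.2]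
          exact_mod_cast this
        push_cast
        rw [q1, q2]
        ring
      rw [← e1]
      simp only [β, α, map_mul, Complex.conj_conj]
      ring
    have h5 : ∀ κ ∈ keys S, ∑ μ ∈ keys S with μ.1 = κ.1, keySum S a κ * conj (keySum S a μ) *
        E (κ.2 - μ.2) = ∑ p ∈ S.offDiag with pairKey p = κ,
          ∑ q ∈ S.offDiag with q.2 - q.1 = p.2 - p.1, β p * conj (β q) := by
      intro κ _
      have h6 : ∀ p ∈ S.offDiag.filter (fun p ↦ pairKey p = κ),
          ∑ q ∈ S.offDiag with q.2 - q.1 = p.2 - p.1, β p * conj (β q) =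
          ∑ μ ∈ keys S with μ.1 = κ.1, ∑ q ∈ S.offDiag with pairKey q = μ,
            α p * conj (α q) * E (κ.2 - μ.2) := by
        intro p hp
        have hpκ := (Finset.mem_filter.1 hp).2
        rw [← Finset.sum_fiberwise_of_maps_to (g := pairKey)
          (t := (keys S).filter fun μ ↦ μ.1 = κ.1)]
        · refine Finset.sum_congr rfl fun μ hμ ↦ ?_
          rw [Finset.filter_filter]
          refine Finset.sum_congr (Finset.filter_congr fun q _ ↦ ?_) fun q hq ↦ ?_
          · refine ⟨fun h ↦ h.2, fun h ↦ ⟨?_, h⟩⟩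
            have := (Finset.mem_filter.1 hμ).2
            rw [← h, ← hpκ] at this
            exact this
          · have hqμ := (Finset.mem_filter.1 hq).2
            have := (Finset.mem_filter.1 hμ).2
            rw [← hqμ, ← hpκ] at this
            rw [h4 p q this, hpκ, hqμ]
        · intro q hq
          obtain ⟨hq1, hq2⟩ := Finset.mem_filter.1 hq
          exact Finset.mem_filter.2 ⟨Finset.mem_image_of_mem _ hq1, by rw [← hpκ]; exact hq2⟩
      rw [Finset.sum_congr rfl h6, Finset.sum_comm]
      refine Finset.sum_congr rfl fun μ _ ↦ ?_
      rw [keySum, keySum, map_sum, Finset.sum_mul_sum, Finset.sum_mul]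
      refine Finset.sum_congr rfl fun p _ ↦ ?_
      rw [Finset.sum_mul]
    rw [Finset.sum_congr rfl h5, keys, Finset.sum_fiberwise_of_maps_to
      fun p hp ↦ Finset.mem_image_of_mem _ hp]
    exact Finset.sum_congr rfl fun p hp ↦ by rw [h3 p hp]

theorem norm_keySum_le (S : Finset (ℤ × ℤ)) (a : ℤ × ℤ → ℂ) (κ : (ℤ × ℤ) × ℤ) :
    ‖keySum S a κ‖ ≤ ∑ p ∈ S.offDiag with pairKey p = κ, ‖a p.1‖ * ‖a p.2‖ := by
  refine (norm_sum_le _ _).trans (Finset.sum_le_sum fun p _ ↦ ?_)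
  rw [norm_mul, RCLike.norm_conj, mul_comm]

/-! ### Schur's test and the averaged L⁴ bound. -/

/-- Schur's test for a kernel in the offset of two columns, combined with the rectangle
inequality. -/
theorem sum_keySum_le (S : Finset (ℤ × ℤ)) (a : ℤ × ℤ → ℂ) {Φ : ℤ → ℝ} {C M R : ℝ}
    (hM : 0 ≤ M) (hC : 0 ≤ C) (hΦ0 : ∀ m, 0 ≤ Φ m) (hΦn : ∀ m, Φ (-m) = Φ m)
    (hR : ∀ x ∈ S, ∀ y ∈ S, ∀ z ∈ S, ∀ w ∈ S, |(latticeDot (x - y) (z - w) : ℝ)| ≤ R)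
    (hΦ : ∀ g : ℕ, 0 < g → ∀ I : Finset ℤ, 0 ∉ I → (∀ i ∈ I, |(g * i : ℝ)| ≤ R) →
      Φ 0 + ∑ i ∈ I, Φ (g * i) ≤ C * (1 + M / g)) :
    ∑ κ ∈ keys S, ∑ μ ∈ keys S with μ.1 = κ.1, ‖keySum S a κ‖ * ‖keySum S a μ‖ * Φ (κ.2 - μ.2) ≤
      C * (10 ^ 14 * (M + 1 + Nat.log 2 S.card) * (∑ k ∈ S, ‖a k‖ ^ 2) ^ 2) := by
  classical
  set G : (ℤ × ℤ) × ℤ → ℝ := fun κ ↦ ‖keySum S a κ‖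
  -- For fixed v the second components of keys are multiples of gcd(v), so a row of the kernel
  -- samples Φ at distinct multiples of the gcd; the multiple 0 is separated off.
  have hrow : ∀ κ ∈ keys S, ∑ μ ∈ keys S with μ.1 = κ.1, Φ (κ.2 - μ.2) ≤ C * gcdWeight M κ.1 := by
    intro κ hκ
    obtain ⟨p, hp, rfl⟩ := Finset.mem_image.1 hκ
    have hp0 := ne_zero_of_mem_offDiag hp
    have hpS := Finset.mem_offDiag.1 hp
    have hg := latticeGcd_pos hp0
    obtain ⟨-, -, t, ht0, htg, htv⟩ := latticeDir_spec hp0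
    set v := p.2 - p.1 with hv
    have hdvd : ∀ z, (latticeGcd v : ℤ) ∣ latticeDot v z := by
      intro z
      have h1 : (latticeGcd v : ℤ) ∣ t := by rw [← htg]; exact Int.natAbs_dvd.2 dvd_rfl
      rw [htv, latticeDot_smul, ← htv]
      exact Dvd.dvd.mul_right h1 _
    have hex : ∀ μ ∈ (keys S).filter (fun μ ↦ μ.1 = v), ∃ i : ℤ,
        (pairKey p).2 - μ.2 = latticeGcd v * i ∧ |((latticeGcd v * i : ℤ) : ℝ)| ≤ R := by
      intro μ hμ
      obtain ⟨hμ1, hμ2⟩ := Finset.mem_filter.1 hμ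
      obtain ⟨q, hq, rfl⟩ := Finset.mem_image.1 hμ1
      have hqS := Finset.mem_offDiag.1 hq
      have e : (pairKey p).2 - (pairKey q).2 = latticeDot v (p.1 - q.1) := by
        have : q.2 - q.1 = v := hμ2
        rw [latticeDot_sub, pairKey, pairKey, this]
      obtain ⟨i, hi⟩ := hdvd (p.1 - q.1)
      refine ⟨i, e.trans hi, ?_⟩
      rw [← hi]
      exact hR _ hpS.2.1 _ hpS.1 _ hpS.1 _ hqS.1
    choose! i hi hiR using hex
    have hinj : Set.InjOn i ((keys S).filter fun μ ↦ μ.1 = v) := by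
      intro μ hμ ν hν h
      have e1 := hi μ hμ
      rw [h, ← hi ν hν] at e1
      exact Prod.ext ((Finset.mem_filter.1 hμ).2.trans (Finset.mem_filter.1 hν).2.symm)
        (sub_right_injective e1)
    have hsum : ∑ μ ∈ keys S with μ.1 = (pairKey p).1, Φ ((pairKey p).2 - μ.2) =
        ∑ j ∈ ((keys S).filter fun μ ↦ μ.1 = v).image i, Φ (latticeGcd v * j) := by
      rw [Finset.sum_image hinj]
      exact Finset.sum_congr rfl fun μ hμ ↦ by rw [hi μ hμ]
    rw [hsum]
    set J := ((keys S).filter fun μ ↦ μ.1 = v).image i with hJ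
    have hJ2 := hΦ (latticeGcd v) hg (J.erase 0) (by simp) (by
      intro j hj
      obtain ⟨μ, hμ, rfl⟩ := Finset.mem_image.1 (Finset.mem_of_mem_erase hj)
      have := hiR μ hμ
      push_cast at this ⊢
      exact this)
    refine le_trans ?_ hJ2
    have h1 : J ⊆ insert 0 (J.erase 0) := fun j hj ↦ by
      by_cases h : j = 0 <;> simp [h, hj]
    refine (Finset.sum_le_sum_of_subset_of_nonneg h1 fun _ _ _ ↦ hΦ0 _).trans ?_
    rw [Finset.sum_insert (by simp)]
    simp
  have hsymm : ∑ κ ∈ keys S, ∑ μ ∈ keys S with μ.1 = κ.1, G μ ^ 2 * Φ (κ.2 - μ.2) =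
      ∑ κ ∈ keys S, ∑ μ ∈ keys S with μ.1 = κ.1, G κ ^ 2 * Φ (κ.2 - μ.2) := by
    simp only [Finset.sum_filter]
    rw [Finset.sum_comm]
    refine Finset.sum_congr rfl fun κ _ ↦ Finset.sum_congr rfl fun μ _ ↦ ?_
    rw [← hΦn, neg_sub]
    by_cases h : κ.1 = μ.1
    · rw [if_pos h, if_pos h.symm]
    · rw [if_neg h, if_neg (Ne.symm h)]
  calc ∑ κ ∈ keys S, ∑ μ ∈ keys S with μ.1 = κ.1, G κ * G μ * Φ (κ.2 - μ.2)
      ≤ ∑ κ ∈ keys S, ∑ μ ∈ keys S with μ.1 = κ.1,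
        (G κ ^ 2 * Φ (κ.2 - μ.2) + G μ ^ 2 * Φ (κ.2 - μ.2)) / 2 := by
        refine Finset.sum_le_sum fun κ _ ↦ Finset.sum_le_sum fun μ _ ↦ ?_
        nlinarith [mul_nonneg (sq_nonneg (G κ - G μ)) (hΦ0 (κ.2 - μ.2))]
    _ = ∑ κ ∈ keys S, ∑ μ ∈ keys S with μ.1 = κ.1, G κ ^ 2 * Φ (κ.2 - μ.2) := by
        simp only [← Finset.sum_div, Finset.sum_add_distrib]
        rw [hsymm, add_self_div_two]
    _ ≤ ∑ κ ∈ keys S, C * (gcdWeight M κ.1 *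
          (∑ p ∈ S.offDiag with pairKey p = κ, ‖a p.1‖ * ‖a p.2‖) ^ 2) := by
        refine Finset.sum_le_sum fun κ hκ ↦ ?_
        rw [← Finset.mul_sum]
        calc G κ ^ 2 * ∑ μ ∈ keys S with μ.1 = κ.1, Φ (κ.2 - μ.2)
            ≤ (∑ p ∈ S.offDiag with pairKey p = κ, ‖a p.1‖ * ‖a p.2‖) ^ 2 *
              (C * gcdWeight M κ.1) := by
              have h1 : G κ ^ 2 ≤ (∑ p ∈ S.offDiag with pairKey p = κ, ‖a p.1‖ * ‖a p.2‖) ^ 2 :=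
                pow_le_pow_left₀ (norm_nonneg _) (norm_keySum_le S a κ) 2
              exact mul_le_mul h1 (hrow κ hκ) (Finset.sum_nonneg fun _ _ ↦ hΦ0 _) (sq_nonneg _)
          _ = _ := by ring
    _ = C * rectForm M S fun p ↦ ‖a p.1‖ * ‖a p.2‖ := by
        rw [rectForm_eq_sum_sq, Finset.mul_sum]; rfl
    _ ≤ _ := mul_le_mul_of_nonneg_left (rectForm_le (fun _ _ ↦ norm_nonneg _) hM) hC

theorem norm_keySum_le_card_mul (S : Finset (ℤ × ℤ)) (a : ℤ × ℤ → ℂ) (κ : (ℤ × ℤ) × ℤ) :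
    ‖keySum S a κ‖ ≤ S.card * ∑ k ∈ S, ‖a k‖ ^ 2 := by
  refine (norm_keySum_le S a κ).trans ?_
  calc ∑ p ∈ S.offDiag with pairKey p = κ, ‖a p.1‖ * ‖a p.2‖
      ≤ ∑ p ∈ S ×ˢ S, ‖a p.1‖ * ‖a p.2‖ := by
        refine Finset.sum_le_sum_of_subset_of_nonneg (fun p hp ↦ ?_) fun _ _ _ ↦ by positivity
        have := Finset.mem_offDiag.1 (Finset.mem_filter.1 hp).1
        exact Finset.mem_product.2 ⟨this.1, this.2.1⟩
    _ = (∑ k ∈ S, ‖a k‖) ^ 2 := by rw [sq, Finset.sum_mul_sum, Finset.sum_product]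
    _ ≤ _ := sq_sum_le_card_mul_sum_sq

theorem lintegral_norm_pow_four (S : Finset (ℤ × ℤ)) (a : ℤ × ℤ → ℂ) (θ : ℝ) :
    ∫⁻ x : Torus2, ‖∑ k ∈ S, phase θ k * a k * torusChar k x‖ₑ ^ 4 =
      ENNReal.ofReal ((2 * Real.pi) ^ 2 * ((∑ k ∈ S, ‖a k‖ ^ 2) ^ 2 +
        ∑ κ ∈ keys S, ∑ μ ∈ keys S with μ.1 = κ.1, (keySum S a κ * conj (keySum S a μ) *
          Complex.exp (Complex.I * θ * ((-2 * (κ.2 - μ.2) : ℤ) : ℝ))).re)) := by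
  have hc : Continuous fun x ↦ ∑ k ∈ S, phase θ k * a k * torusChar k x :=
    continuous_finsetSum _ fun k _ ↦ continuous_const.mul (continuous_torusChar k)
  have hi : Integrable fun x ↦ ‖∑ k ∈ S, phase θ k * a k * torusChar k x‖ ^ 4 :=
    (hc.norm.pow 4).integrable_of_hasCompactSupport (HasCompactSupport.of_compactSpace _)
  have h1 : ∫ x : Torus2, ‖∑ k ∈ S, phase θ k * a k * torusChar k x‖ ^ 4 =
      (2 * Real.pi) ^ 2 * ((∑ k ∈ S, ‖a k‖ ^ 2) ^ 2 +
        ∑ κ ∈ keys S, ∑ μ ∈ keys S with μ.1 = κ.1, (keySum S a κ * conj (keySum S a μ) *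
          Complex.exp (Complex.I * θ * ((-2 * (κ.2 - μ.2) : ℤ) : ℝ))).re) := by
    have h2 := congrArg Complex.re (integral_norm_pow_four S a θ)
    have e1 : ((2 * Real.pi) ^ 2 : ℂ) = (((2 * Real.pi) ^ 2 : ℝ) : ℂ) := by push_cast; rfl
    have e2 : (∑ k ∈ S, (‖a k‖ : ℂ) ^ 2) ^ 2 = (((∑ k ∈ S, ‖a k‖ ^ 2) ^ 2 : ℝ) : ℂ) := by
      push_cast; rfl
    rw [e1, e2, Complex.ofReal_re, Complex.re_ofReal_mul, Complex.add_re, Complex.ofReal_re] at h2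
    simpa only [Complex.re_sum] using h2
  rw [← h1, ofReal_integral_eq_lintegral_ofReal hi (Filter.Eventually.of_forall fun _ ↦ by positivity)]
  refine lintegral_congr fun x ↦ ?_
  rw [← ofReal_norm, ENNReal.ofReal_pow (norm_nonneg _)]

/-- The averaged `L⁴` bound, given decay of the averaged oscillating exponentials. -/
theorem lintegral_lintegral_norm_pow_four_le {Y : Type*} [MeasurableSpace Y] {ν : Measure Y}
    (S : Finset (ℤ × ℤ)) {a : ℤ × ℤ → Y → ℂ} (ha : ∀ k, AEMeasurable (a k) ν)
    (hai : Integrable (fun y ↦ (∑ k ∈ S, ‖a k y‖ ^ 2) ^ 2) ν)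
    {θ : Y → ℝ} (hθ : AEMeasurable θ ν) {Φ : ℤ → ℝ} {C M R : ℝ}
    (hM : 0 ≤ M) (hC : 0 ≤ C) (hΦ0 : ∀ m, 0 ≤ Φ m) (hΦn : ∀ m, Φ (-m) = Φ m)
    (hR : ∀ x ∈ S, ∀ y ∈ S, ∀ z ∈ S, ∀ w ∈ S, |(latticeDot (x - y) (z - w) : ℝ)| ≤ R)
    (hΦ : ∀ g : ℕ, 0 < g → ∀ I : Finset ℤ, 0 ∉ I → (∀ i ∈ I, |(g * i : ℝ)| ≤ R) →
      Φ 0 + ∑ i ∈ I, Φ (g * i) ≤ C * (1 + M / g))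
    (hint : ∀ κ μ, ‖∫ y, keySum S (a · y) κ * conj (keySum S (a · y) μ) *
        Complex.exp (Complex.I * θ y * ((-2 * (κ.2 - μ.2) : ℤ) : ℝ)) ∂ν‖ ≤
      (∫ y, ‖keySum S (a · y) κ‖ * ‖keySum S (a · y) μ‖ ∂ν) * Φ (κ.2 - μ.2)) :
    ∫⁻ y, (∫⁻ x : Torus2, ‖∑ k ∈ S, phase (θ y) k * a k y * torusChar k x‖ₑ ^ 4) ∂ν ≤
      ENNReal.ofReal ((2 * Real.pi) ^ 2 * ((1 + C * (10 ^ 14 * (M + 1 + Nat.log 2 S.card))) *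
        ∫ y, (∑ k ∈ S, ‖a k y‖ ^ 2) ^ 2 ∂ν)) := by
  have hkm : ∀ κ, AEMeasurable (fun y ↦ keySum S (a · y) κ) ν := by
    intro κ
    unfold keySum
    exact Finset.aemeasurable_fun_sum _ fun p _ ↦
      (ha _).mul (Complex.continuous_conj.measurable.comp_aemeasurable (ha _))
  -- Each key sum is crudely dominated by |S| Σ|a_k|². This serves integrability only and does not
  -- enter the estimate.
  have hkk : ∀ κ μ, Integrable (fun y ↦ ‖keySum S (a · y) κ‖ * ‖keySum S (a · y) μ‖) ν := by
    intro κ μ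
    refine (hai.const_mul ((S.card : ℝ) ^ 2)).mono'
      ((hkm κ).norm.mul (hkm μ).norm).aestronglyMeasurable (Filter.Eventually.of_forall fun y ↦ ?_)
    rw [Real.norm_of_nonneg (by positivity)]
    calc _ ≤ (S.card * ∑ k ∈ S, ‖a k y‖ ^ 2) * (S.card * ∑ k ∈ S, ‖a k y‖ ^ 2) :=
          mul_le_mul (norm_keySum_le_card_mul _ _ _) (norm_keySum_le_card_mul _ _ _)
            (norm_nonneg _) (by positivity)
      _ = _ := by ring
  have hexp : ∀ κ μ : (ℤ × ℤ) × ℤ, AEMeasurable (fun y ↦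
      Complex.exp (Complex.I * θ y * ((-2 * (κ.2 - μ.2) : ℤ) : ℝ))) ν := fun κ μ ↦
    Complex.measurable_exp.comp_aemeasurable
      (((Complex.measurable_ofReal.comp_aemeasurable hθ).const_mul _).mul_const _)
  have hki : ∀ κ μ, Integrable (fun y ↦ keySum S (a · y) κ * conj (keySum S (a · y) μ) *
        Complex.exp (Complex.I * θ y * ((-2 * (κ.2 - μ.2) : ℤ) : ℝ))) ν := by
    intro κ μ
    refine (hkk κ μ).mono' (((hkm κ).mul (Complex.continuous_conj.measurable.comp_aemeasurable
      (hkm μ))).mul (hexp κ μ)).aestronglyMeasurable (Filter.Eventually.of_forall fun y ↦ ?_)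
    rw [norm_mul, norm_mul, RCLike.norm_conj, mul_assoc Complex.I, ← Complex.ofReal_mul, mul_comm Complex.I,
      Complex.norm_exp_ofReal_mul_I, mul_one]
  have hkr := fun κ μ ↦ (hki κ μ).re
  simp only [RCLike.re_to_complex] at hkr
  simp only [lintegral_norm_pow_four]
  have hsi : Integrable (fun y ↦ ∑ κ ∈ keys S, ∑ μ ∈ keys S with μ.1 = κ.1,
      (keySum S (a · y) κ * conj (keySum S (a · y) μ) *
        Complex.exp (Complex.I * θ y * ((-2 * (κ.2 - μ.2) : ℤ) : ℝ))).re) ν :=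
    integrable_finsetSum _ fun κ _ ↦ integrable_finsetSum _ fun μ _ ↦ hkr κ μ
  have htot : Integrable (fun y ↦ (∑ k ∈ S, ‖a k y‖ ^ 2) ^ 2 + ∑ κ ∈ keys S,
      ∑ μ ∈ keys S with μ.1 = κ.1, (keySum S (a · y) κ * conj (keySum S (a · y) μ) *
        Complex.exp (Complex.I * θ y * ((-2 * (κ.2 - μ.2) : ℤ) : ℝ))).re) ν := hai.add hsi
  rw [← ofReal_integral_eq_lintegral_ofReal (htot.const_mul _)]
  · refine ENNReal.ofReal_le_ofReal ?_
    rw [integral_const_mul]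
    refine mul_le_mul_of_nonneg_left ?_ (by positivity)
    rw [integral_add hai hsi, add_mul, one_mul]
    gcongr
    rw [integral_finsetSum _ fun κ _ ↦ integrable_finsetSum _ fun μ _ ↦ hkr κ μ]
    calc ∑ κ ∈ keys S, ∫ y, ∑ μ ∈ keys S with μ.1 = κ.1, _ ∂ν
        ≤ ∑ κ ∈ keys S, ∫ y, ∑ μ ∈ keys S with μ.1 = κ.1,
          ‖keySum S (a · y) κ‖ * ‖keySum S (a · y) μ‖ * Φ (κ.2 - μ.2) ∂ν := by
          refine Finset.sum_le_sum fun κ _ ↦ ?_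
          rw [integral_finsetSum _ fun μ _ ↦ hkr κ μ,
            integral_finsetSum _ fun μ _ ↦ (hkk κ μ).mul_const _]
          refine Finset.sum_le_sum fun μ _ ↦ ?_
          rw [integral_mul_const]
          refine le_trans ?_ (hint κ μ)
          have : ∫ y, (keySum S (a · y) κ * conj (keySum S (a · y) μ) *
              Complex.exp (Complex.I * θ y * ((-2 * (κ.2 - μ.2) : ℤ) : ℝ))).re ∂ν =
              (∫ y, keySum S (a · y) κ * conj (keySum S (a · y) μ) *
              Complex.exp (Complex.I * θ y * ((-2 * (κ.2 - μ.2) : ℤ) : ℝ)) ∂ν).re :=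
            integral_re (hki κ μ)
          rw [this]
          exact Complex.re_le_norm _
      _ = ∫ y, ∑ κ ∈ keys S, ∑ μ ∈ keys S with μ.1 = κ.1,
          ‖keySum S (a · y) κ‖ * ‖keySum S (a · y) μ‖ * Φ (κ.2 - μ.2) ∂ν :=
          (integral_finsetSum _ fun κ _ ↦ integrable_finsetSum _ fun μ _ ↦
            (hkk κ μ).mul_const _).symm
      _ ≤ ∫ y, C * (10 ^ 14 * (M + 1 + Nat.log 2 S.card)) * (∑ k ∈ S, ‖a k y‖ ^ 2) ^ 2 ∂ν := by
          refine integral_mono (integrable_finsetSum _ fun κ _ ↦ integrable_finsetSum _ fun μ _ ↦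
            (hkk κ μ).mul_const _) (hai.const_mul _) fun y ↦ ?_
          refine (sum_keySum_le S (a · y) hM hC hΦ0 hΦn hR hΦ).trans_eq ?_
          ring
      _ = _ := integral_const_mul _ _
  -- The expression is nonnegative because it is the integral of a fourth power.
  · refine Filter.Eventually.of_forall fun y ↦ ?_
    have h2 := congrArg Complex.re (integral_norm_pow_four S (a · y) (θ y))
    have e1 : ((2 * Real.pi) ^ 2 : ℂ) = (((2 * Real.pi) ^ 2 : ℝ) : ℂ) := by push_cast; rfl
    have e2 : (∑ k ∈ S, (‖a k y‖ : ℂ) ^ 2) ^ 2 = (((∑ k ∈ S, ‖a k y‖ ^ 2) ^ 2 : ℝ) : ℂ) := by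
      push_cast; rfl
    rw [e1, e2, Complex.ofReal_re, Complex.re_ofReal_mul, Complex.add_re, Complex.ofReal_re] at h2
    simp only [Complex.re_sum] at h2
    simp only [Pi.zero_apply]
    rw [← h2]
    exact integral_nonneg fun _ ↦ by positivity

/-! ### The pathwise estimate. -/

theorem sum_natAbs_le {φ : ℕ → ℝ} (hφ : ∀ j, 0 ≤ φ j) {I : Finset ℤ} (hI : 0 ∉ I) {n : ℕ}
    (hn : ∀ i ∈ I, i.natAbs ≤ n) :
    ∑ i ∈ I, φ i.natAbs ≤ 2 * ∑ j ∈ Finset.Icc 1 n, φ j := by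
  classical
  have hhalf : ∀ J ⊆ I, Set.InjOn Int.natAbs J →
      ∑ i ∈ J, φ i.natAbs ≤ ∑ j ∈ Finset.Icc 1 n, φ j := by
    intro J hJ hinj
    rw [← Finset.sum_image hinj]
    refine Finset.sum_le_sum_of_subset_of_nonneg (fun j hj ↦ ?_) fun _ _ _ ↦ hφ _
    obtain ⟨i, hi, rfl⟩ := Finset.mem_image.1 hj
    refine Finset.mem_Icc.2 ⟨?_, hn i (hJ hi)⟩
    have : i ≠ 0 := fun h ↦ hI (h ▸ hJ hi)
    omega
  rw [← Finset.sum_filter_add_sum_filter_not I (fun i ↦ 0 < i), two_mul]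
  refine add_le_add (hhalf _ (Finset.filter_subset _ _) ?_) (hhalf _ (Finset.filter_subset _ _) ?_)
  all_goals
    intro a ha b hb h
    have ha' := (Finset.mem_filter.1 ha).2
    have hb' := (Finset.mem_filter.1 hb).2
    omega

/-- For ε ≤ 1, Bernoulli's inequality gives ε(n+1)^{ε-1} ≤ (n+1)^ε - n^ε, which telescopes. For ε ≥
1 each term is at most n^{ε-1}. -/
theorem sum_rpow_sub_one_le {ε : ℝ} (hε : 0 < ε) (n : ℕ) :
    ∑ j ∈ Finset.Icc 1 n, (j : ℝ) ^ (ε - 1) ≤ (1 + 1 / ε) * (n : ℝ) ^ ε := by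
  rcases le_total ε 1 with h1 | h1
  · suffices ∑ j ∈ Finset.Icc 1 n, (j : ℝ) ^ (ε - 1) ≤ (n : ℝ) ^ ε / ε by
      have h2 : 0 ≤ (n : ℝ) ^ ε := by positivity
      calc _ ≤ _ := this
        _ ≤ _ := by rw [add_mul, one_div, inv_mul_eq_div]; linarith
    induction n with
    | zero => simp [hε.ne']
    | succ n ih =>
      rw [Finset.sum_Icc_succ_top (by omega)]
      have hp : (0 : ℝ) < n + 1 := by positivity
      have hb := rpow_one_add_le_one_add_mul_self (s := -((n : ℝ) + 1)⁻¹)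
        (neg_le_neg (inv_le_one_of_one_le₀ (by linarith [(Nat.cast_nonneg n : (0 : ℝ) ≤ n)])))
        hε.le h1
      have e : 1 + -((n : ℝ) + 1)⁻¹ = n / (n + 1) := by field_simp; ring
      rw [e, Real.div_rpow (by positivity) hp.le, div_le_iff₀ (by positivity)] at hb
      have e2 : ((n : ℝ) + 1) ^ (ε - 1) = ((n : ℝ) + 1) ^ ε * ((n : ℝ) + 1)⁻¹ := by
        rw [Real.rpow_sub_one hp.ne', div_eq_mul_inv]
      push_cast
      have : (n : ℝ) ^ ε / ε + ((n : ℝ) + 1) ^ (ε - 1) ≤ ((n : ℝ) + 1) ^ ε / ε := by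
        rw [e2, div_add' _ _ _ hε.ne']
        gcongr
        linarith
      linarith
  · calc ∑ j ∈ Finset.Icc 1 n, (j : ℝ) ^ (ε - 1)
        ≤ ∑ j ∈ Finset.Icc 1 n, (n : ℝ) ^ (ε - 1) := by
          refine Finset.sum_le_sum fun j hj ↦ ?_
          exact Real.rpow_le_rpow (by positivity) (by exact_mod_cast (Finset.mem_Icc.1 hj).2)
            (by linarith)
      _ = n * (n : ℝ) ^ (ε - 1) := by simp
      _ = (n : ℝ) ^ ε := by
          rcases Nat.eq_zero_or_pos n with rfl | hn
          · simp [hε.ne']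
          · rw [Real.rpow_sub_one (by positivity)]; field_simp
      _ ≤ _ := le_mul_of_one_le_left (by positivity) (by linarith [one_div_pos.2 hε])

/-- The sum of `(1 + 2|m|)^{ε-1}` over nonzero multiples of `g` of size at most `R`. -/
theorem sum_one_add_two_mul_rpow_le {ε R : ℝ} (hε : 0 < ε) (hR : 0 ≤ R) {g : ℕ} (hg : 0 < g)
    {I : Finset ℤ} (hI : 0 ∉ I) (hIR : ∀ i ∈ I, |(g * i : ℝ)| ≤ R) :
    ∑ i ∈ I, (1 + 2 * |((g * i : ℤ) : ℝ)|) ^ (ε - 1) ≤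
      2 * 3 ^ ε * (1 + 1 / ε) * R ^ ε / g := by
  have hg' : (0 : ℝ) < g := by exact_mod_cast hg
  -- The factor 3^ε is needed for ε > 1, where the power increases and 1 + 2y ≤ 3y is used for y ≥
  -- 1.
  have hterm : ∀ i ∈ I, (1 + 2 * |((g * i : ℤ) : ℝ)|) ^ (ε - 1) ≤
      3 ^ ε * (g : ℝ) ^ (ε - 1) * ((i.natAbs : ℕ) : ℝ) ^ (ε - 1) := by
    intro i hi
    have hi0 : i ≠ 0 := fun h ↦ hI (h ▸ hi)
    have hx : |((g * i : ℤ) : ℝ)| = g * (i.natAbs : ℝ) := by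
      push_cast
      rw [abs_mul, Nat.abs_cast, Nat.cast_natAbs, Int.cast_abs]
    have hi1 : (1 : ℝ) ≤ i.natAbs := by exact_mod_cast Int.natAbs_pos.2 hi0
    have hg1 : (1 : ℝ) ≤ g := by exact_mod_cast hg
    rw [hx, mul_assoc, ← Real.mul_rpow hg'.le (by positivity)]
    set y : ℝ := g * (i.natAbs : ℝ)
    have hy : 1 ≤ y := one_le_mul_of_one_le_of_one_le hg1 hi1
    rcases le_total ε 1 with h1 | h1
    · calc (1 + 2 * y) ^ (ε - 1) ≤ y ^ (ε - 1) :=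
            Real.rpow_le_rpow_of_nonpos (by linarith) (by linarith) (by linarith)
        _ ≤ _ := le_mul_of_one_le_left (by positivity)
            (Real.one_le_rpow (by norm_num) hε.le)
    · calc (1 + 2 * y) ^ (ε - 1) ≤ (3 * y) ^ (ε - 1) :=
            Real.rpow_le_rpow (by linarith) (by linarith) (by linarith)
        _ = 3 ^ (ε - 1) * y ^ (ε - 1) := Real.mul_rpow (by norm_num) (by linarith)
        _ ≤ _ := by
            gcongr
            · norm_num
            · linarith
  have hn : ∀ i ∈ I, i.natAbs ≤ ⌊R / g⌋₊ := by
    intro i hi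
    refine Nat.le_floor ?_
    rw [le_div_iff₀ hg', mul_comm, Nat.cast_natAbs, Int.cast_abs]
    have := hIR i hi
    rwa [abs_mul, Nat.abs_cast] at this
  refine (Finset.sum_le_sum hterm).trans ?_
  rw [← Finset.mul_sum]
  have h2 := sum_natAbs_le (φ := fun j ↦ (j : ℝ) ^ (ε - 1)) (fun j ↦ by positivity) hI hn
  have h3 := sum_rpow_sub_one_le hε ⌊R / g⌋₊
  have h4 : ((⌊R / g⌋₊ : ℕ) : ℝ) ^ ε ≤ R ^ ε / (g : ℝ) ^ ε := by
    rw [← Real.div_rpow hR hg'.le]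
    exact Real.rpow_le_rpow (by positivity) (Nat.floor_le (by positivity)) hε.le
  have hε' : 0 < 1 + 1 / ε := by positivity
  calc 3 ^ ε * (g : ℝ) ^ (ε - 1) * ∑ i ∈ I, ((i.natAbs : ℕ) : ℝ) ^ (ε - 1)
      ≤ 3 ^ ε * (g : ℝ) ^ (ε - 1) * (2 * ((1 + 1 / ε) * (R ^ ε / (g : ℝ) ^ ε))) := by
        gcongr
        refine h2.trans ?_
        gcongr
        exact h3.trans (by gcongr)
    _ = _ := by
        have : (g : ℝ) ^ ε ≠ 0 := by positivity
        rw [Real.rpow_sub_one hg'.ne']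
        field_simp

theorem card_freqSquare_le (a b : ℝ) {N : ℝ} (hN : 1 ≤ N) :
    ((freqSquare a b N).card : ℝ) ≤ 9 * N ^ 2 := by
  have h : ∀ a : ℝ, ((Finset.Icc ⌈a - N⌉ ⌊a + N⌋).card : ℝ) ≤ 3 * N := by
    intro a
    rw [Int.card_Icc, ← Int.cast_natCast, Int.toNat_eq_max, Int.cast_max]
    refine max_le ?_ (by push_cast; linarith)
    push_cast
    linarith [Int.floor_le (a + N), Int.le_ceil (a - N)]
  rw [freqSquare, Finset.card_product, Nat.cast_mul]
  calc _ ≤ (3 * N) * (3 * N) := mul_le_mul (h a) (h b) (by positivity) (by positivity)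
    _ = _ := by ring

theorem abs_latticeDot_freqSquare_le {a b N : ℝ} {x y z w : ℤ × ℤ}
    (hx : x ∈ freqSquare a b N) (hy : y ∈ freqSquare a b N)
    (hz : z ∈ freqSquare a b N) (hw : w ∈ freqSquare a b N) :
    |(latticeDot (x - y) (z - w) : ℝ)| ≤ 8 * N ^ 2 := by
  have h : ∀ {c u v : ℝ}, |u - c| ≤ N → |v - c| ≤ N → |u - v| ≤ 2 * N := by
    intro c u v hu hv
    rw [abs_le] at *
    constructor <;> linarith
  rw [mem_freqSquare] at hx hy hz hw
  have h1 := mul_le_mul (h hx.1 hy.1) (h hz.1 hw.1) (abs_nonneg _)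
    ((abs_nonneg _).trans (h hx.1 hy.1))
  have h2 := mul_le_mul (h hx.2 hy.2) (h hz.2 hw.2) (abs_nonneg _)
    ((abs_nonneg _).trans (h hx.2 hy.2))
  rw [← abs_mul] at h1 h2
  simp only [latticeDot, Prod.fst_sub, Prod.snd_sub]
  push_cast
  refine (abs_add_le _ _).trans ?_
  linarith

theorem natLog_card_freqSquare_le (a b : ℝ) {N : ℝ} (hN : 1 ≤ N) :
    (Nat.log 2 (freqSquare a b N).card : ℝ) ≤ Real.log (9 * N ^ 2) / Real.log 2 := by
  rcases Nat.eq_zero_or_pos (freqSquare a b N).card with h0 | h0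
  · rw [h0]
    simp only [Nat.log_zero_right, Nat.cast_zero]
    exact div_nonneg (Real.log_nonneg (by nlinarith)) (Real.log_nonneg (by norm_num))
  · refine (Real.natLog_le_logb _ _).trans ?_
    rw [Real.logb]
    have : (0 : ℝ) < (freqSquare a b N).card := by exact_mod_cast h0
    refine div_le_div_of_nonneg_right (Real.log_le_log this (card_freqSquare_le a b hN)) ?_
    exact Real.log_nonneg (by norm_num)

/-- The square of Bessel's inequality, with a surplus factor (2π)² ≥ 1 discarded. -/
theorem ofReal_sq_sum_torusCoeff_le {f : Torus2 → ℂ} (hf : MemLp f 2 volume)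
    (S : Finset (ℤ × ℤ)) :
    ENNReal.ofReal ((2 * Real.pi) ^ 2 * (∑ k ∈ S, ‖torusCoeff f k‖ ^ 2) ^ 2) ≤
      eLpNorm f 2 volume ^ 4 := by
  have h1 : eLpNorm f 2 volume ^ 2 = ENNReal.ofReal (∫ x, ‖f x‖ ^ 2) := by
    rw [hf.eLpNorm_eq_integral_rpow_norm two_ne_zero ENNReal.ofNat_ne_top,
      ← ENNReal.ofReal_pow (by positivity)]
    congr 1
    rw [← Real.rpow_natCast, ← Real.rpow_mul (integral_nonneg fun _ ↦ by positivity)]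
    simp
  have h2 := sum_sq_torusCoeff_le hf S
  set A := ∑ k ∈ S, ‖torusCoeff f k‖ ^ 2
  have hA : 0 ≤ A := Finset.sum_nonneg fun _ _ ↦ by positivity
  rw [show (4 : ℕ) = 2 * 2 from rfl, pow_mul, h1, ← ENNReal.ofReal_pow (hA.trans (by
    refine le_trans (le_mul_of_one_le_left hA ?_) h2
    nlinarith [Real.pi_gt_three]))]
  refine ENNReal.ofReal_le_ofReal ?_
  calc (2 * Real.pi) ^ 2 * A ^ 2 ≤ ((2 * Real.pi) ^ 2 * A) ^ 2 := by
        rw [mul_pow _ A]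
        refine mul_le_mul_of_nonneg_right (le_self_pow₀ ?_ two_ne_zero) (sq_nonneg A)
        nlinarith [Real.pi_gt_three]
    _ ≤ _ := by gcongr

theorem eLpNorm_four_pow {α : Type*} [MeasurableSpace α] {μ : Measure α} {E : Type*} [ENorm E] (u : α → E) :
    eLpNorm u 4 μ ^ 4 = ∫⁻ x, ‖u x‖ₑ ^ 4 ∂μ := by
  have h := eLpNorm_nnreal_pow_eq_lintegral (μ := μ) (f := u) (p := 4) (by norm_num)
  have e : (((4 : ℝ≥0) : ℝ)) = ((4 : ℕ) : ℝ) := by norm_num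
  simp only [e, ENNReal.rpow_natCast] at h
  exact h

theorem le_of_pow_four_le {X Y : ℝ≥0∞} {Q Z : ℝ} (hQ : 0 ≤ Q) (hZ : 0 ≤ Z)
    (h : X ^ 4 ≤ ENNReal.ofReal (Q * Z) * Y ^ 4) :
    X ≤ ((Q ^ (1 / 4 : ℝ)).toNNReal : ℝ≥0∞) * ENNReal.ofReal (Z ^ (1 / 4 : ℝ)) * Y := by
  rw [← ENNReal.pow_le_pow_left_iff (n := 4) (by norm_num), mul_pow, mul_pow]
  have e : ∀ q : ℝ, 0 ≤ q → ENNReal.ofReal (q ^ (1 / 4 : ℝ)) ^ 4 = ENNReal.ofReal q := by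
    intro q hq
    rw [← ENNReal.ofReal_pow (by positivity), ← Real.rpow_natCast, ← Real.rpow_mul hq]
    norm_num
  rw [e Z hZ]
  change X ^ 4 ≤ ENNReal.ofReal (Q ^ (1 / 4 : ℝ)) ^ 4 * _ * _
  rw [e Q hQ, ← ENNReal.ofReal_mul hQ]
  exact h

/-- The space-time `L⁴` bound on an interval of positive length, for an irregular phase. -/
theorem lintegral_schrodingerProj_pow_four_le {T ρ ε C₀ : ℝ} {W : ℝ → ℝ} (hε : 0 < ε)
    (hρ : 1 - ε ≤ ρ) (hW : ContinuousOn W (Set.Icc 0 T)) (hC₀ : 0 ≤ C₀)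
    (hC : ∀ s t : ℝ, 0 ≤ s → s < t → t ≤ T → ∀ τ : ℝ,
      (1 + |τ|) ^ ρ * ‖∫ u in s..t, Complex.exp (Complex.I * W u * τ)‖ / |s - t| ^ (1 / 2 : ℝ) ≤ C₀)
    {a b N : ℝ} (hN : 1 ≤ N) {s t : ℝ} (hs : 0 ≤ s) (hst : s < t) (ht : t ≤ T) (f : Torus2 → ℂ) :
    ∫⁻ r in Set.Icc s t, (∫⁻ x, ‖schrodingerProj (W r) (freqSquare a b N) f x‖ₑ ^ 4) ≤
      ENNReal.ofReal ((2 * Real.pi) ^ 2 * (((t - s) + C₀ * √(t - s) * (10 ^ 14 *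
        (2 * 3 ^ ε * (1 + 1 / ε) * (8 * N ^ 2) ^ ε + 1 + Nat.log 2 (freqSquare a b N).card))) *
        (∑ k ∈ freqSquare a b N, ‖torusCoeff f k‖ ^ 2) ^ 2)) := by
  set S := freqSquare a b N
  have hT0 : 0 < t - s := sub_pos.2 hst
  have hsq0 : 0 < √(t - s) := Real.sqrt_pos.2 hT0
  -- The averaged bound compares with the total measure t - s, so the kernel carries the factor
  -- C₀/√(t-s).
  have hdiv : C₀ * √(t - s) = (t - s) * (C₀ / √(t - s)) := by
    rw [mul_div_left_comm, Real.div_sqrt]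
  have hvol : volume.real (Set.Icc s t) = t - s := by
    rw [Measure.real, Real.volume_Icc, ENNReal.toReal_ofReal hT0.le]
  have hosc : ∀ m : ℤ, ‖∫ u in Set.Icc s t, Complex.exp (Complex.I * W u * ((-2 * m : ℤ) : ℝ))‖ ≤
      C₀ * √(t - s) * (1 + 2 * |(m : ℝ)|) ^ (ε - 1) := by
    intro m
    have h1 := hC s t hs hst ht ((-2 * m : ℤ) : ℝ)
    rw [intervalIntegral.integral_of_le hst.le, ← integral_Icc_eq_integral_Ioc] at h1
    have e1 : |((-2 * m : ℤ) : ℝ)| = 2 * |(m : ℝ)| := by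
      push_cast; rw [abs_mul]; norm_num
    have hb : 1 ≤ 1 + 2 * |(m : ℝ)| := by linarith [abs_nonneg (m : ℝ)]
    have hb0 : 0 < 1 + 2 * |(m : ℝ)| := by linarith
    rw [e1, abs_sub_comm, abs_of_pos hT0, ← Real.sqrt_eq_rpow, div_le_iff₀ hsq0] at h1
    set J := ‖∫ u in Set.Icc s t, Complex.exp (Complex.I * W u * ((-2 * m : ℤ) : ℝ))‖
    calc J = (1 + 2 * |(m : ℝ)|) ^ (-ρ) * ((1 + 2 * |(m : ℝ)|) ^ ρ * J) := by
          rw [← mul_assoc, ← Real.rpow_add hb0]; simp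
      _ ≤ (1 + 2 * |(m : ℝ)|) ^ (-ρ) * (C₀ * √(t - s)) := by gcongr
      _ ≤ (1 + 2 * |(m : ℝ)|) ^ (ε - 1) * (C₀ * √(t - s)) := by
          gcongr
          linarith
      _ = _ := mul_comm _ _
  have hε1 : 0 < 1 + 1 / ε := by positivity
  have key := lintegral_lintegral_norm_pow_four_le (ν := volume.restrict (Set.Icc s t)) S
    (a := fun k _ ↦ torusCoeff f k) (fun _ ↦ aemeasurable_const) (integrable_const _)
    (θ := W) ((hW.mono (Set.Icc_subset_Icc hs ht)).aemeasurable measurableSet_Icc)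
    (Φ := fun m ↦ C₀ / √(t - s) * (1 + 2 * |(m : ℝ)|) ^ (ε - 1)) (C := C₀ / √(t - s))
    (M := 2 * 3 ^ ε * (1 + 1 / ε) * (8 * N ^ 2) ^ ε) (R := 8 * N ^ 2)
    (by positivity) (by positivity) (fun m ↦ by positivity) (fun m ↦ by simp)
    (fun x hx y hy z hz w hw ↦ abs_latticeDot_freqSquare_le hx hy hz hw)
    (fun g hg I hI hIR ↦ by
      have := sum_one_add_two_mul_rpow_le hε (by positivity) hg hI hIR
      rw [← Finset.mul_sum, ← mul_add]
      refine mul_le_mul_of_nonneg_left ?_ (by positivity)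
      simp only [Int.cast_zero, abs_zero, mul_zero, add_zero, Real.one_rpow]
      linarith)
    (fun κ μ ↦ by
      rw [integral_const_mul, integral_const, measureReal_restrict_apply_univ, hvol, norm_mul,
        norm_mul, RCLike.norm_conj, smul_eq_mul]
      have h1 := mul_le_mul_of_nonneg_left (hosc (κ.2 - μ.2))
        (by positivity : 0 ≤ ‖keySum S (torusCoeff f) κ‖ * ‖keySum S (torusCoeff f) μ‖)
      refine h1.trans_eq ?_
      rw [hdiv]; ring)
  refine key.trans_eq ?_
  rw [integral_const, measureReal_restrict_apply_univ, hvol, smul_eq_mul]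
  congr 2
  rw [← mul_assoc]
  congr 1
  rw [hdiv]; ring

/-- Strichartz estimates for a deterministic irregular phase. -/
theorem strichartz_of_isIrregular {T ρ ε : ℝ} {W : ℝ → ℝ} (hT : 0 < T) (hε : 0 < ε)
    (hρ : 1 - ε ≤ ρ) (hW : IsIrregular ρ (1 / 2) T W) :
    ∃ C : ℝ≥0, ∀ a b N : ℝ, 1 ≤ N → ∀ s t : ℝ, 0 ≤ s → s ≤ t → t ≤ T →
      ∀ f : Torus2 → ℂ, MemLp f 2 volume →
        eLpNorm (fun p : ℝ × Torus2 ↦ schrodingerProj (W p.1) (freqSquare a b N) f p.2) 4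
            ((volume.restrict (Set.Icc s t)).prod volume)
          ≤ C * ENNReal.ofReal ((N ^ (2 * ε) * √(t - s)) ^ (1 / 4 : ℝ)) *
            eLpNorm f 2 volume := by
  obtain ⟨C₁, hC₁⟩ := hW.bounded
  set C₀ := max C₁ 0
  have hC₀ : 0 ≤ C₀ := le_max_right _ _
  have hl2 : 0 < Real.log 2 := Real.log_pos (by norm_num)
  -- The first part comes from the kernel sum, with (8N²)^ε = 8^ε N^{2ε}; the last bounds
  -- log(9N²)/log 2 by a multiple of N^{2ε}.
  set K : ℝ := 2 * 3 ^ ε * (1 + 1 / ε) * 8 ^ ε + 1 + 9 ^ ε / ε / Real.log 2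
  have hK : 0 ≤ K := by positivity
  refine ⟨((√T + C₀ * (10 ^ 14 * K)) ^ (1 / 4 : ℝ)).toNNReal, fun a b N hN s t hs hst ht f hf ↦ ?_⟩
  refine le_of_pow_four_le (by positivity) (by positivity) ?_
  rw [eLpNorm_four_pow]
  refine (lintegral_prod_le _).trans ?_
  rcases hst.eq_or_lt with rfl | hst
  · simp
  refine (lintegral_schrodingerProj_pow_four_le hε hρ hW.continuousOn hC₀
    (fun s t h1 h2 h3 τ ↦ (hC₁ s t h1 h2 h3 τ).trans (le_max_left _ _)) hN hs hst ht f).trans ?_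
  have hT0 : 0 < t - s := sub_pos.2 hst
  have hN2 : (N ^ 2) ^ ε = N ^ (2 * ε) := by
    rw [← Real.rpow_natCast, ← Real.rpow_mul (by linarith)]; norm_num
  have hN1 : 1 ≤ N ^ (2 * ε) := Real.one_le_rpow hN (by positivity)
  have hlog : (Nat.log 2 (freqSquare a b N).card : ℝ) ≤ 9 ^ ε / ε / Real.log 2 * N ^ (2 * ε) := by
    refine (natLog_card_freqSquare_le a b hN).trans ?_
    calc Real.log (9 * N ^ 2) / Real.log 2 ≤ ((9 * N ^ 2) ^ ε / ε) / Real.log 2 := by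
          gcongr
          exact Real.log_le_rpow_div (by positivity) hε
      _ = _ := by
          rw [Real.mul_rpow (by norm_num) (by positivity), hN2]; ring
  have hsum : 2 * 3 ^ ε * (1 + 1 / ε) * (8 * N ^ 2) ^ ε + 1 +
      (Nat.log 2 (freqSquare a b N).card : ℝ) ≤ K * N ^ (2 * ε) := by
    rw [Real.mul_rpow (by norm_num) (by positivity), hN2]
    simp only [K, add_mul]
    linarith
  -- The diagonal term is linear in the length; bounding √(t-s) by √T makes the constant depend on
  -- the domain of `W`.
  have hts : t - s ≤ √T * √(t - s) := by
    calc t - s = √(t - s) * √(t - s) := (Real.mul_self_sqrt hT0.le).symm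
      _ ≤ _ := by
        gcongr
        linarith
  refine le_trans (ENNReal.ofReal_le_ofReal (q := (√T + C₀ * (10 ^ 14 * K)) *
    (N ^ (2 * ε) * √(t - s)) * ((2 * Real.pi) ^ 2 *
      (∑ k ∈ freqSquare a b N, ‖torusCoeff f k‖ ^ 2) ^ 2)) ?_) ?_
  · rw [mul_left_comm]
    refine mul_le_mul_of_nonneg_right ?_ (by positivity)
    calc (t - s) + C₀ * √(t - s) * (10 ^ 14 * (2 * 3 ^ ε * (1 + 1 / ε) * (8 * N ^ 2) ^ ε + 1 +
          (Nat.log 2 (freqSquare a b N).card : ℝ)))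
        ≤ √T * √(t - s) * N ^ (2 * ε) + C₀ * √(t - s) * (10 ^ 14 * (K * N ^ (2 * ε))) := by
          gcongr
          exact hts.trans (le_mul_of_one_le_right (by positivity) hN1)
      _ = _ := by ring
  · rw [ENNReal.ofReal_mul (by positivity)]
    gcongr
    exact ofReal_sq_sum_torusCoeff_le hf _

/-! ### Fractional Brownian motion and the stochastic estimate. -/

namespace IsFractionalBrownian

variable {Ω : Type*} [MeasurableSpace Ω] {P : Measure Ω} {H : ℝ} {B : ℝ≥0 → Ω → ℝ}

theorem variance_eq (hH : 0 < H) (hB : IsFractionalBrownian H B P) (t : ℝ≥0) :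
    Var[B t; P] = (t : ℝ) ^ (2 * H) := by
  have h := hB.covariance t t
  rw [covariance_self (hB.gaussian.aemeasurable t)] at h
  rw [h, sub_self, abs_zero, Real.zero_rpow (by positivity)]
  ring

theorem map_eq_gaussianReal (hH : 0 < H) (hB : IsFractionalBrownian H B P) (t : ℝ≥0) :
    P.map (B t) = gaussianReal 0 ((t : ℝ) ^ (2 * H)).toNNReal := by
  rw [(hB.gaussian.hasGaussianLaw_eval t).map_eq_gaussianReal, hB.centered, hB.variance_eq hH]

/-- The Gaussian characteristic function at -2m; this is the decaying kernel Φ of the stochastic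
case. -/
theorem integral_exp (hH : 0 < H) (hB : IsFractionalBrownian H B P) (t : ℝ≥0) (m : ℤ) :
    ∫ ω, Complex.exp (Complex.I * B t ω * ((-2 * m : ℤ) : ℝ)) ∂P =
      ((Real.exp (-2 * ((m : ℝ) * (t : ℝ) ^ H) ^ 2) : ℝ) : ℂ) := by
  have h1 := charFun_apply_real (μ := P.map (B t)) (((-2 * m : ℤ) : ℝ))
  rw [integral_map (hB.gaussian.aemeasurable t) (by fun_prop), hB.map_eq_gaussianReal hH,
    charFun_gaussianReal] at h1
  have h2 : (((t : ℝ) ^ H) ^ 2) = (t : ℝ) ^ (2 * H) := by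
    rw [← Real.rpow_natCast, ← Real.rpow_mul (by positivity), mul_comm]; norm_num
  calc _ = _ := integral_congr_ae (Filter.Eventually.of_forall fun ω ↦ by
        congr 1; ring)
    _ = _ := h1.symm
    _ = _ := by
        rw [Real.coe_toNNReal _ (by positivity), mul_pow, h2]
        push_cast
        congr 1
        ring

theorem ae_zero (hH : 0 < H) (hB : IsFractionalBrownian H B P) : B 0 =ᵐ[P] 0 := by
  have : IsProbabilityMeasure P := hB.gaussian.isProbabilityMeasure
  have h := ae_eq_integral_of_variance_eq_zero (hB.gaussian.hasGaussianLaw_eval 0).memLp_two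
    (by rw [hB.variance_eq hH, NNReal.coe_zero, Real.zero_rpow (by positivity)])
  rw [hB.centered] at h
  exact h

/-- A version all of whose paths are continuous and all of whose values are measurable. -/
theorem exists_continuous_version (hB : IsFractionalBrownian H B P) :
    ∃ B' : ℝ≥0 → Ω → ℝ, (∀ ω, Continuous fun t ↦ B' t ω) ∧ (∀ t, Measurable (B' t)) ∧
      ∀ᵐ ω ∂P, ∀ t, B t ω = B' t ω := by
  classical
  have hm := fun t ↦ hB.gaussian.aemeasurable t
  let D := TopologicalSpace.denseSeq ℝ≥0
  have hae : ∀ᵐ ω ∂P, (Continuous fun t ↦ B t ω) ∧ ∀ n, B (D n) ω = (hm (D n)).mk _ ω :=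
    hB.continuous_paths.and (ae_all_iff.2 fun n ↦ (hm (D n)).ae_eq_mk)
  -- The exceptional set need not be measurable; a measurable null superset is needed to redefine
  -- the process there.
  obtain ⟨N, hN, hNm, hN0⟩ := exists_measurable_superset_of_null hae
  have hgood : ∀ ω ∉ N, (Continuous fun t ↦ B t ω) ∧ ∀ n, B (D n) ω = (hm (D n)).mk _ ω :=
    fun ω hω ↦ by_contra fun h ↦ hω (hN h)
  let B' : ℝ≥0 → Ω → ℝ := fun t ω ↦ if ω ∈ N then 0 else B t ω
  have hcont : ∀ ω, Continuous fun t ↦ B' t ω := by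
    intro ω
    by_cases h : ω ∈ N
    · simp only [B', h, if_true]; exact continuous_const
    · simp only [B', h, if_false]; exact (hgood ω h).1
  have hD : ∀ n, Measurable (B' (D n)) := by
    intro n
    have : B' (D n) = fun ω ↦ if ω ∈ N then 0 else (hm (D n)).mk _ ω := by
      ext ω
      by_cases h : ω ∈ N
      · simp only [B', h, if_true]
      · simp only [B', h, if_false]; exact (hgood ω h).2 n
    rw [this]
    exact Measurable.ite hNm measurable_const (hm (D n)).measurable_mk
  refine ⟨B', hcont, fun t ↦ ?_, ?_⟩
  -- By continuity every value is a limit of values along the dense sequence, where measurability is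
  -- known.
  · obtain ⟨u, hu, hut⟩ := mem_closure_iff_seq_limit.1
      ((TopologicalSpace.denseRange_denseSeq ℝ≥0) t)
    choose n hn using hu
    refine measurable_of_tendsto_metrizable (fun k ↦ hD (n k)) (tendsto_pi_nhds.2 fun ω ↦ ?_)
    have h1 := ((hcont ω).tendsto t).comp hut
    refine h1.congr fun k ↦ ?_
    simp only [Function.comp, D, hn]
  · filter_upwards [measure_eq_zero_iff_ae_notMem.1 hN0] with ω hω t
    simp only [B', hω, if_false]

end IsFractionalBrownian

theorem sum_exp_neg_mul_le {x : ℝ} (hx : 0 < x) (n : ℕ) :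
    ∑ j ∈ Finset.Icc 1 n, Real.exp (-(x * j)) ≤ 1 / x := by
  suffices x * ∑ j ∈ Finset.Icc 1 n, Real.exp (-(x * j)) ≤ 1 - Real.exp (-(x * n)) by
    rw [le_div_iff₀ hx, mul_comm]
    linarith [Real.exp_pos (-(x * n))]
  induction n with
  | zero => simp
  | succ n ih =>
    rw [Finset.sum_Icc_succ_top (by omega), mul_add]
    have h1 : Real.exp (-(x * n)) = Real.exp (-(x * (n + 1 : ℕ))) * Real.exp x := by
      rw [← Real.exp_add]; congr 1; push_cast; ring
    have h2 := mul_le_mul_of_nonneg_left (Real.add_one_le_exp x)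
      (Real.exp_pos (-(x * (n + 1 : ℕ)))).le
    linarith

theorem sum_exp_neg_sq_le {y : ℝ} (hy : 0 < y) {g : ℕ} (hg : 0 < g) {I : Finset ℤ} (hI : 0 ∉ I) :
    ∑ i ∈ I, Real.exp (-2 * (((g * i : ℤ) : ℝ) * y) ^ 2) ≤ 4 * y⁻¹ / g := by
  have hg' : (0 : ℝ) < g := by exact_mod_cast hg
  have hterm : ∀ i ∈ I, Real.exp (-2 * (((g * i : ℤ) : ℝ) * y) ^ 2) ≤
      2 * Real.exp (-(g * y * (i.natAbs : ℕ))) := by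
    intro i _
    have hl : (0.6931471803 : ℝ) < Real.log 2 := Real.log_two_gt_d9
    have h2 : ∀ z, 2 * Real.exp z = Real.exp (Real.log 2 + z) := fun z ↦ by
      rw [Real.exp_add, Real.exp_log (by norm_num)]
    rw [h2, Real.exp_le_exp]
    have : (((g * i : ℤ) : ℝ) * y) ^ 2 = (g * y * (i.natAbs : ℕ)) ^ 2 := by
      rw [Nat.cast_natAbs, Int.cast_abs]
      push_cast
      rw [mul_pow (g * y : ℝ) |(i : ℝ)|, sq_abs]
      ring
    rw [this]
    -- With x = g y |i|, the claim log 2 - x + 2x² ≥ 0 holds since 2x² - x ≥ -1/8. The Gaussian is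
    -- thus dominated by a geometric series.
    nlinarith [sq_nonneg (4 * (g * y * (i.natAbs : ℕ)) - 1)]
  refine (Finset.sum_le_sum hterm).trans ?_
  rw [← Finset.mul_sum]
  have h1 := sum_natAbs_le (φ := fun j ↦ Real.exp (-(g * y * j))) (fun j ↦ by positivity) hI
    (fun i hi ↦ Finset.le_sup (f := Int.natAbs) hi)
  have h2 := sum_exp_neg_mul_le (mul_pos hg' hy) (I.sup Int.natAbs)
  calc _ ≤ 2 * (2 * (1 / (g * y))) := by gcongr; exact h1.trans (by gcongr)
    _ = _ := by field_simp; norm_num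

/-- Subadditivity of x^{1-H}, together with 1/(1-H) ≤ 2 from H ≤ 1/2. -/
theorem integral_rpow_neg_le {H s t : ℝ} (hH0 : 0 < H) (hH : H ≤ 1 / 2) (hs : 0 ≤ s) (hst : s ≤ t) :
    ∫ r in s..t, r ^ (-H) ≤ 2 * (t - s) ^ (1 - H) := by
  rw [integral_rpow (Or.inl (by linarith)), neg_add_eq_sub]
  have h2 := Real.rpow_add_le_add_rpow (sub_nonneg.2 hst) hs (by linarith : 0 ≤ 1 - H) (by linarith)
  rw [sub_add_cancel] at h2
  have h3 : 0 ≤ (t - s) ^ (1 - H) := Real.rpow_nonneg (sub_nonneg.2 hst) _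
  rw [div_le_iff₀ (by linarith)]
  nlinarith

/-- For N ≥ 2 constants are absorbed by log N; for N < 2 the case hypothesis gives τ ≤ 1, hence τ ≤
τ^{1-H}. -/
theorem one_add_natLog_card_freqSquare_le (a b : ℝ) {N τ H : ℝ} (hN : 1 ≤ N) (hτ : 0 ≤ τ)
    (hH : 0 < H) (hcase : 2 ≤ N ∨ τ ≤ 1) :
    τ * (1 + Nat.log 2 (freqSquare a b N).card) ≤ 14 * (Real.log N * τ + τ ^ (1 - H)) := by
  have h1 := natLog_card_freqSquare_le a b hN
  have hl2 : (0.6931471803 : ℝ) < Real.log 2 := Real.log_two_gt_d9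
  have hl2' : 0 < Real.log 2 := by linarith
  have hN0 : 0 < N := by linarith
  have h9 : Real.log 9 ≤ 4 * Real.log 2 := by
    rw [show (4 : ℝ) * Real.log 2 = Real.log (2 ^ 4) by rw [Real.log_pow]; norm_num]
    exact Real.log_le_log (by norm_num) (by norm_num)
  rw [Real.log_mul (by norm_num) (by positivity), Real.log_pow, le_div_iff₀ hl2'] at h1
  push_cast at h1
  have hlN : 0 ≤ Real.log N := Real.log_nonneg hN
  have hpow : 0 ≤ τ ^ (1 - H) := Real.rpow_nonneg hτ _
  set L : ℝ := (Nat.log 2 (freqSquare a b N).card : ℝ)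
  have hL0 : 0 ≤ L := Nat.cast_nonneg _
  rcases le_total 2 N with h2 | h2
  · have h3 : Real.log 2 ≤ Real.log N := Real.log_le_log (by norm_num) h2
    have h4 : 1 + L ≤ 14 * Real.log N := by nlinarith
    calc τ * (1 + L) ≤ τ * (14 * Real.log N) := by gcongr
      _ ≤ _ := by linarith
  · have h3 : Real.log N ≤ Real.log 2 := Real.log_le_log hN0 h2
    have h4 : 1 + L ≤ 14 := by nlinarith
    have hτ1 : τ ≤ τ ^ (1 - H) ∨ 2 ≤ N := by
      rcases hcase with h | h
      · exact Or.inr h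
      · left
        rcases hτ.eq_or_lt with h0 | h0
        · rw [← h0]; positivity
        · calc τ = τ ^ (1 : ℝ) := (Real.rpow_one τ).symm
            _ ≤ _ := Real.rpow_le_rpow_of_exponent_ge h0 h (by linarith)
    rcases hτ1 with h5 | h5
    · have : 0 ≤ Real.log N * τ := mul_nonneg hlN hτ
      nlinarith
    · have h3 : Real.log 2 ≤ Real.log N := Real.log_le_log (by norm_num) h5
      have h4 : 1 + L ≤ 14 * Real.log N := by nlinarith
      calc τ * (1 + L) ≤ τ * (14 * Real.log N) := by gcongr
        _ ≤ _ := by linarith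

theorem measurable_keySum (S : Finset (ℤ × ℤ)) (κ : (ℤ × ℤ) × ℤ) :
    Measurable fun a : ℤ × ℤ → ℂ ↦ keySum S a κ := by
  unfold keySum
  exact Finset.measurable_fun_sum _ fun p _ ↦
    (measurable_pi_apply _).mul (Complex.continuous_conj.measurable.comp (measurable_pi_apply _))

theorem measurable_lintegral_phase (S : Finset (ℤ × ℤ)) :
    Measurable fun q : (ℤ × ℤ → ℂ) × ℝ ↦
      ∫⁻ x : Torus2, ‖∑ k ∈ S, phase q.2 k * q.1 k * torusChar k x‖ₑ ^ 4 := by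
  have h : Measurable fun z : ((ℤ × ℤ → ℂ) × ℝ) × Torus2 ↦
      ‖∑ k ∈ S, phase z.1.2 k * z.1.1 k * torusChar k z.2‖ₑ ^ 4 := by
    refine (Finset.measurable_fun_sum _ fun k _ ↦ ?_).enorm.pow_const 4
    have h1 : Continuous fun θ ↦ phase θ k := by unfold phase; fun_prop
    exact ((h1.measurable.comp (measurable_snd.comp measurable_fst)).mul
      ((measurable_pi_apply k).comp (measurable_fst.comp measurable_fst))).mul
      ((continuous_torusChar k).measurable.comp measurable_snd)
  exact h.lintegral_prod_right'

namespace IsFractionalBrownian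

variable {Ω : Type*} [MeasurableSpace Ω] {P : Measure Ω} {H : ℝ} {B : ℝ≥0 → Ω → ℝ}

/-- The `L⁴` bound at a fixed positive time, averaged over the probability space. -/
theorem lintegral_norm_pow_four_le (hH : 0 < H) (hB : IsFractionalBrownian H B P) {r : ℝ≥0}
    (hr : 0 < r) (a b : ℝ) {N : ℝ} {α : ℤ × ℤ → Ω → ℂ} (hα : ∀ k, AEMeasurable (α k) P)
    (hind : IndepFun (fun ω k ↦ α k ω) (B r) P)
    (hai : Integrable (fun ω ↦ (∑ k ∈ freqSquare a b N, ‖α k ω‖ ^ 2) ^ 2) P) :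
    ∫⁻ ω, (∫⁻ x : Torus2,
        ‖∑ k ∈ freqSquare a b N, phase (B r ω) k * α k ω * torusChar k x‖ₑ ^ 4) ∂P ≤
      ENNReal.ofReal ((2 * Real.pi) ^ 2 * ((1 + 1 * (10 ^ 14 *
        (4 * ((r : ℝ) ^ H)⁻¹ + 1 + Nat.log 2 (freqSquare a b N).card))) *
        ∫ ω, (∑ k ∈ freqSquare a b N, ‖α k ω‖ ^ 2) ^ 2 ∂P)) := by
  set S := freqSquare a b N
  have hrH : 0 < (r : ℝ) ^ H := Real.rpow_pos_of_pos (by exact_mod_cast hr) _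
  refine lintegral_lintegral_norm_pow_four_le S hα hai (hB.gaussian.aemeasurable r)
    (Φ := fun m ↦ Real.exp (-2 * ((m : ℝ) * (r : ℝ) ^ H) ^ 2)) (R := 8 * N ^ 2)
    (by positivity) zero_le_one (fun m ↦ by positivity) (fun m ↦ by simp)
    (fun x hx y hy z hz w hw ↦ abs_latticeDot_freqSquare_le hx hy hz hw)
    -- Here C = 1 and M = 4 r^{-H}. The Gaussian kernel is summable, so the restriction to |g i| ≤ R
    -- plays no role.
    (fun g hg I hI _ ↦ ?_) fun κ μ ↦ ?_
  · have := sum_exp_neg_sq_le hrH hg hI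
    simp only [Int.cast_zero, zero_mul, ne_eq, OfNat.ofNat_ne_zero, not_false_eq_true, zero_pow,
      mul_zero, Real.exp_zero, one_mul]
    linarith
  -- Key sums depend only on the coefficients and the exponential only on `B r`, so the expectation
  -- factors.
  · have h1 : IndepFun (fun ω ↦ keySum S (α · ω) κ * conj (keySum S (α · ω) μ))
        (fun ω ↦ Complex.exp (Complex.I * B r ω * ((-2 * (κ.2 - μ.2) : ℤ) : ℝ))) P :=
      hind.comp (φ := fun a ↦ keySum S a κ * conj (keySum S a μ))
        (ψ := fun y : ℝ ↦ Complex.exp (Complex.I * y * ((-2 * (κ.2 - μ.2) : ℤ) : ℝ)))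
        ((measurable_keySum S κ).mul
          (Complex.continuous_conj.measurable.comp (measurable_keySum S μ)))
        (by fun_prop)
    have hαm : AEMeasurable (fun ω k ↦ α k ω) P := aemeasurable_pi_lambda _ hα
    rw [h1.integral_fun_mul_eq_mul_integral, hB.integral_exp hH, norm_mul, Complex.norm_real,
      Real.norm_of_nonneg (by positivity)]
    · refine mul_le_mul_of_nonneg_right ((norm_integral_le_integral_norm _).trans_eq ?_)
        (by positivity)
      simp only [norm_mul, RCLike.norm_conj]
    · exact (((measurable_keySum S κ).mul (Complex.continuous_conj.measurable.comp
        (measurable_keySum S μ))).comp_aemeasurable hαm).aestronglyMeasurable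
    · have : Measurable fun y : ℝ ↦
        Complex.exp (Complex.I * y * ((-2 * (κ.2 - μ.2) : ℤ) : ℝ)) := by fun_prop
      exact (this.comp_aemeasurable (hB.gaussian.aemeasurable r)).aestronglyMeasurable

/-- Independence from the increments gives independence from each value. -/
theorem indepFun_of_increments (hH : 0 < H) (hB : IsFractionalBrownian H B P) {E : Type*}
    [MeasurableSpace E] {X : Ω → E}
    (hX : IndepFun X (fun ω (q : ℝ≥0 × ℝ≥0) ↦ B q.2 ω - B q.1 ω) P) (r : ℝ≥0) :
    IndepFun X (B r) P := by
  -- Almost surely `B 0` vanishes, so `B r` is the increment over (0, r).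
  have hv : Measurable fun v : ℝ≥0 × ℝ≥0 → ℝ ↦ v (0, r) := measurable_pi_apply _
  have h1 := hX.comp (φ := id) measurable_id hv
  refine h1.congr (Filter.EventuallyEq.refl _ _) ?_
  filter_upwards [hB.ae_zero hH] with ω hω
  simp [hω]

end IsFractionalBrownian

theorem lintegral_Icc_add_rpow_neg_le {H s t c p q : ℝ} (hH0 : 0 < H) (hH : H ≤ 1 / 2)
    (hs : 0 ≤ s) (hst : s ≤ t) (hc : 0 ≤ c) (hp : 0 ≤ p) (hq : 0 ≤ q) :
    ∫⁻ r in Set.Icc s t, ENNReal.ofReal (c * (p + q * r ^ (-H))) ≤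
      ENNReal.ofReal (c * (p * (t - s) + 2 * q * (t - s) ^ (1 - H))) := by
  have hi : IntegrableOn (fun r : ℝ ↦ r ^ (-H)) (Set.Icc s t) :=
    (intervalIntegrable_iff_integrableOn_Icc_of_le hst).1
      (intervalIntegral.intervalIntegrable_rpow' (by linarith))
  have hpi : IntegrableOn (fun _ : ℝ ↦ p) (Set.Icc s t) :=
    integrableOn_const measure_Icc_lt_top.ne
  have hti : IntegrableOn (fun r : ℝ ↦ c * (p + q * r ^ (-H))) (Set.Icc s t) :=
    (hpi.add (hi.const_mul q)).const_mul c
  rw [← ofReal_integral_eq_lintegral_ofReal hti]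
  · refine ENNReal.ofReal_le_ofReal ?_
    rw [integral_const_mul]
    refine mul_le_mul_of_nonneg_left ?_ hc
    rw [integral_add hpi (hi.const_mul q), integral_const_mul, integral_const,
      measureReal_restrict_apply_univ, integral_Icc_eq_integral_Ioc,
      ← intervalIntegral.integral_of_le hst, Measure.real, Real.volume_Icc,
      ENNReal.toReal_ofReal (sub_nonneg.2 hst), smul_eq_mul]
    nlinarith [integral_rpow_neg_le hH0 hH hs hst]
  · filter_upwards [ae_restrict_mem measurableSet_Icc] with r hr
    have : 0 ≤ r ^ (-H) := Real.rpow_nonneg (hs.trans hr.1) _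
    simp only [Pi.zero_apply]
    positivity

/-- Strichartz estimates for a fractional Brownian phase. -/
theorem strichartz_of_isFractionalBrownian {H : ℝ} (hH0 : 0 < H) (hH : H ≤ 1 / 2)
    {Ω : Type*} [MeasurableSpace Ω] {P : Measure Ω} [IsProbabilityMeasure P]
    {B : ℝ≥0 → Ω → ℝ} (hB : IsFractionalBrownian H B P) (a b : ℝ) {N : ℝ} (hN : 1 ≤ N)
    {s t : ℝ} (hs : 0 ≤ s) (hst : s ≤ t) (hcase : 2 ≤ N ∨ t - s ≤ 1)
    {f : Ω × Torus2 → ℂ} (hf : MemLp f 2 (P.prod volume))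
    (hind : IndepFun (fun ω (k : ℤ × ℤ) ↦ torusCoeff (fun x ↦ f (ω, x)) k)
      (fun ω (q : ℝ≥0 × ℝ≥0) ↦ B q.2 ω - B q.1 ω) P) :
    eLpNorm (fun p : Ω × ℝ × Torus2 ↦
        schrodingerProj (B p.2.1.toNNReal p.1) (freqSquare a b N)
          (fun x ↦ f (p.1, x)) p.2.2) 4
        (P.prod ((volume.restrict (Set.Icc s t)).prod volume))
      ≤ (((10 ^ 16 : ℝ) ^ (1 / 4 : ℝ)).toNNReal : ℝ≥0∞) * ENNReal.ofReal
          ((Real.log N * (t - s) + (t - s) ^ (1 - H)) ^ (1 / 4 : ℝ)) *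
        eLpNorm (fun ω ↦ eLpNorm (fun x ↦ f (ω, x)) 2 volume) 4 P := by
  rcases hst.eq_or_lt with rfl | hlt
  · simp
  have hT0 : 0 < t - s := sub_pos.2 hlt
  have hlogN : 0 ≤ Real.log N := Real.log_nonneg hN
  have hZ : 0 < Real.log N * (t - s) + (t - s) ^ (1 - H) := by positivity
  set Y := eLpNorm (fun ω ↦ eLpNorm (fun x ↦ f (ω, x)) 2 volume) 4 P with hY
  -- If the right-hand norm is infinite there is nothing to prove, since the other two factors are
  -- positive. Otherwise it provides the integrability used below.
  rcases eq_or_ne Y ∞ with hYtop | hYtop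
  · rw [hYtop, ENNReal.mul_top]
    · exact le_top
    · refine mul_ne_zero ?_ ?_
      · rw [ne_eq, ENNReal.coe_eq_zero, Real.toNNReal_eq_zero, not_le]
        positivity
      · rw [ne_eq, ENNReal.ofReal_eq_zero, not_le]
        positivity
  refine le_of_pow_four_le (by positivity) hZ.le ?_
  set S := freqSquare a b N
  let α : ℤ × ℤ → Ω → ℂ := fun k ω ↦ torusCoeff (fun x ↦ f (ω, x)) k
  have hα : ∀ k, AEMeasurable (α k) P := by
    intro k
    have h1 : AEStronglyMeasurable (fun p : Ω × Torus2 ↦ torusChar (-k) p.2 * f p)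
        (P.prod volume) :=
      ((continuous_torusChar (-k)).measurable.comp measurable_snd).aestronglyMeasurable.mul hf.1
    have h2 := h1.integral_prod_right'.const_smul (((2 * Real.pi) ^ 2)⁻¹ : ℝ)
    exact h2.aemeasurable
  have hY4 : Y ^ 4 = ∫⁻ ω, eLpNorm (fun x ↦ f (ω, x)) 2 volume ^ 4 ∂P := by
    rw [hY, eLpNorm_four_pow]; rfl
  have hmem : ∀ᵐ ω ∂P, MemLp (fun x ↦ f (ω, x)) 2 volume := by
    filter_upwards [hf.1.prodMk_left,
      ((memLp_two_iff_integrable_sq_norm hf.1).1 hf).prod_right_ae] with ω h1 h2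
    exact (memLp_two_iff_integrable_sq_norm h1).2 h2
  set A : Ω → ℝ := fun ω ↦ ∑ k ∈ S, ‖α k ω‖ ^ 2
  have hAm : AEMeasurable (fun ω ↦ A ω ^ 2) P :=
    (Finset.aemeasurable_fun_sum _ fun k _ ↦ (hα k).norm.pow_const 2).pow_const 2
  have hAle : ∫⁻ ω, ENNReal.ofReal ((2 * Real.pi) ^ 2 * A ω ^ 2) ∂P ≤ Y ^ 4 := by
    rw [hY4]
    refine lintegral_mono_ae ?_
    filter_upwards [hmem] with ω hω
    exact ofReal_sq_sum_torusCoeff_le hω S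
  have hAi' : Integrable (fun ω ↦ (2 * Real.pi) ^ 2 * A ω ^ 2) P := by
    refine ⟨(hAm.const_mul _).aestronglyMeasurable, ?_⟩
    rw [hasFiniteIntegral_iff_ofReal (Filter.Eventually.of_forall fun ω ↦ by positivity)]
    exact hAle.trans_lt (ENNReal.pow_lt_top (lt_top_iff_ne_top.2 hYtop))
  have hAi : Integrable (fun ω ↦ A ω ^ 2) P := by
    refine (hAi'.const_mul (((2 * Real.pi) ^ 2)⁻¹)).congr (Filter.Eventually.of_forall fun ω ↦ ?_)
    have : (2 * Real.pi) ^ 2 ≠ 0 := by positivity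
    simp only []
    field_simp
  have hAY : ENNReal.ofReal ((2 * Real.pi) ^ 2 * ∫ ω, A ω ^ 2 ∂P) ≤ Y ^ 4 := by
    rw [← integral_const_mul, ofReal_integral_eq_lintegral_ofReal hAi'
      (Filter.Eventually.of_forall fun ω ↦ by positivity)]
    exact hAle
  set Q := ∫ ω, A ω ^ 2 ∂P
  have hQ : 0 ≤ Q := integral_nonneg fun ω ↦ by positivity
  -- Exchanging the integrals over Ω and time needs joint measurability, which the continuous
  -- version has.
  obtain ⟨B', hB'c, hB'm, hBB'⟩ := hB.exists_continuous_version
  let Ψ : (ℤ × ℤ → ℂ) × ℝ → ℝ≥0∞ := fun q ↦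
    ∫⁻ x : Torus2, ‖∑ k ∈ S, phase q.2 k * q.1 k * torusChar k x‖ₑ ^ 4
  have hΨ : AEMeasurable (Function.uncurry fun ω (r : ℝ) ↦ Ψ (fun k ↦ α k ω, B' r.toNNReal ω))
      (P.prod (volume.restrict (Set.Icc s t))) := by
    refine (measurable_lintegral_phase S).comp_aemeasurable (AEMeasurable.prodMk ?_ ?_)
    · exact aemeasurable_pi_lambda _ fun k ↦ (hα k).comp_fst
    · exact ((measurable_uncurry_of_continuous_of_measurable hB'c hB'm).comp
        ((measurable_real_toNNReal.comp measurable_snd).prodMk measurable_fst)).aemeasurable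
  set L : ℝ := (Nat.log 2 S.card : ℝ) with hL
  have hL0 : 0 ≤ L := Nat.cast_nonneg _
  calc _ = _ := eLpNorm_four_pow _
    _ ≤ ∫⁻ ω, ∫⁻ q, ‖schrodingerProj (B q.1.toNNReal ω) S (fun x ↦ f (ω, x)) q.2‖ₑ ^ 4
        ∂((volume.restrict (Set.Icc s t)).prod volume) ∂P := lintegral_prod_le _
    _ ≤ ∫⁻ ω, (∫⁻ r in Set.Icc s t, Ψ (fun k ↦ α k ω, B r.toNNReal ω)) ∂P :=
        lintegral_mono fun ω ↦ lintegral_prod_le _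
    _ = ∫⁻ ω, (∫⁻ r in Set.Icc s t, Ψ (fun k ↦ α k ω, B' r.toNNReal ω)) ∂P := by
        refine lintegral_congr_ae ?_
        filter_upwards [hBB'] with ω hω
        simp only [hω]
    _ = ∫⁻ r in Set.Icc s t, (∫⁻ ω, Ψ (fun k ↦ α k ω, B' r.toNNReal ω) ∂P) :=
        lintegral_lintegral_swap hΨ
    _ ≤ ∫⁻ r in Set.Icc s t, ENNReal.ofReal (((2 * Real.pi) ^ 2 * Q) *
          ((1 + 10 ^ 14 * (1 + L)) + (4 * 10 ^ 14) * r ^ (-H))) := by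
        refine lintegral_mono_ae ?_
        -- The fixed-time bound requires r > 0; the time 0 is a null set.
        filter_upwards [ae_restrict_mem measurableSet_Icc,
          ae_restrict_of_ae (compl_mem_ae_iff.2 (measure_singleton (0 : ℝ)))] with r hr hr0
        have hr1 : 0 < r := lt_of_le_of_ne (hs.trans hr.1) (Ne.symm hr0)
        have h1 := hB.lintegral_norm_pow_four_le hH0 (Real.toNNReal_pos.2 hr1) a b hα
          (hB.indepFun_of_increments hH0 hind _) hAi
        calc ∫⁻ ω, Ψ (fun k ↦ α k ω, B' r.toNNReal ω) ∂P
            = ∫⁻ ω, Ψ (fun k ↦ α k ω, B r.toNNReal ω) ∂P := by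
              refine lintegral_congr_ae ?_
              filter_upwards [hBB'] with ω hω
              simp only [hω]
          _ ≤ _ := h1
          _ = _ := by
              congr 1
              rw [Real.coe_toNNReal _ hr1.le, Real.rpow_neg hr1.le]
              ring
    _ ≤ ENNReal.ofReal (((2 * Real.pi) ^ 2 * Q) * ((1 + 10 ^ 14 * (1 + L)) * (t - s) +
          2 * (4 * 10 ^ 14) * (t - s) ^ (1 - H))) :=
        lintegral_Icc_add_rpow_neg_le hH0 hH hs hst (by positivity) (by positivity) (by positivity)
    _ ≤ ENNReal.ofReal ((10 ^ 16 * (Real.log N * (t - s) + (t - s) ^ (1 - H))) *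
          ((2 * Real.pi) ^ 2 * Q)) := by
        refine ENNReal.ofReal_le_ofReal ?_
        rw [mul_comm]
        refine mul_le_mul_of_nonneg_right ?_ (by positivity)
        have h1 := one_add_natLog_card_freqSquare_le a b hN hT0.le hH0 hcase
        rw [← hL] at h1
        have h2 : 0 ≤ (t - s) ^ (1 - H) := by positivity
        have h3 : 0 ≤ Real.log N * (t - s) := by positivity
        have h4 : 0 ≤ L * (t - s) := by positivity
        nlinarith
    _ ≤ _ := by
        rw [ENNReal.ofReal_mul (by positivity)]
        gcongr

theorem theorem3p3 :
    (∀ (T ρ ε : ℝ) (W : ℝ → ℝ), 0 < T → 0 < ε → 1 - ε ≤ ρ → IsIrregular ρ (1 / 2) T W →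
      ∃ C : ℝ≥0, ∀ a b N : ℝ, 1 ≤ N → ∀ s t : ℝ, 0 ≤ s → s ≤ t → t ≤ T →
        ∀ f : Torus2 → ℂ, MemLp f 2 volume →
          eLpNorm (fun p : ℝ × Torus2 ↦ schrodingerProj (W p.1) (freqSquare a b N) f p.2) 4
              ((volume.restrict (Set.Icc s t)).prod volume)
            ≤ C * ENNReal.ofReal ((N ^ (2 * ε) * √(t - s)) ^ (1 / 4 : ℝ)) *
              eLpNorm f 2 volume) ∧
    (∀ H : ℝ, 0 < H → H ≤ 1 / 2 →
      ∃ C : ℝ≥0, ∀ (Ω : Type*) [MeasurableSpace Ω] (P : Measure Ω) [IsProbabilityMeasure P]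
        (B : ℝ≥0 → Ω → ℝ), IsFractionalBrownian H B P →
        ∀ a b N : ℝ, 1 ≤ N → ∀ s t : ℝ, 0 ≤ s → s ≤ t → (2 ≤ N ∨ t - s ≤ 1) →
        ∀ f : Ω × Torus2 → ℂ, MemLp f 2 (P.prod volume) →
          IndepFun (fun ω (k : ℤ × ℤ) ↦ torusCoeff (fun x ↦ f (ω, x)) k)
            (fun ω (q : ℝ≥0 × ℝ≥0) ↦ B q.2 ω - B q.1 ω) P →
          eLpNorm (fun p : Ω × ℝ × Torus2 ↦
              schrodingerProj (B p.2.1.toNNReal p.1) (freqSquare a b N)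
                (fun x ↦ f (p.1, x)) p.2.2) 4
              (P.prod ((volume.restrict (Set.Icc s t)).prod volume))
            ≤ C * ENNReal.ofReal
                ((Real.log N * (t - s) + (t - s) ^ (1 - H)) ^ (1 / 4 : ℝ)) *
              eLpNorm (fun ω ↦ eLpNorm (fun x ↦ f (ω, x)) 2 volume) 4 P) := by
  exact ⟨fun T ρ ε W hT hε hρ hW ↦ strichartz_of_isIrregular hT hε hρ hW,
    fun H hH0 hH ↦ ⟨((10 ^ 16 : ℝ) ^ (1 / 4 : ℝ)).toNNReal,
      fun _Ω _ _P _ _B hB a b _N hN _s _t hs hst hcase _f hf hind ↦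
        strichartz_of_isFractionalBrownian hH0 hH hB a b hN hs hst hcase hf hind⟩⟩
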